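/- Theorem. Let $T$ be a finite directed tree (a digraph, without loops, parallel edges and 2-cycles, whose underlying undirected graph is a tree) with a fixed planar embedding, i.e. with a prescribed clockwise cyclic order of the edges around each vertex. Suppose that $T$ is 4-modal: around each vertex there are at most four pairs of cyclically consecutive edges that are neither both incoming nor both outgoing. A planar confluent orthogonal drawing (PCOD) of an embedded digraph represents the vertices by points and each edge by an orthogonal polyline that starts with a vertical segment at its tail and ends with a horizontal segment at its head. Such a polyline has $2k+1$ bends for some $k\ge 0$; its second, fourth, $\dots$ bends are called independent, and $k$ is the split complexity of the edge. All vertices and independent bends have pairwise distinct $x$-coordinates and pairwise distinct $y$-coordinates. Two distinct edges may overlap in their first segments at a common tail or in their last segments at a common head and may meet in a common end vertex, but do not intersect otherwise; edges do not cross themselves or pass through other vertices. The clockwise cyclic order of the edges around each vertex is the prescribed one, where overlapping edges are ordered by the side to which, and the distance at which, they turn off. The split complexity of a PCOD is the maximum split complexity of its edges (zero if there are none); a PCOD of split complexity zero is also called a planar L-drawing. Then $T$ has a PCOD with split complexity zero. Moreover, for every leaf $v$ of $T$ and each of the four corners, $T$ has a PCOD with split complexity zero in which $v$ lies in that corner of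 the bounding box of the drawing. Furthermore, PCODs of split complexity zero can be constructed in linear time: there are a random access machine program and a constant $C$ such that, for every $n$ and every 4-modal embedded directed tree on the vertices $0,\dots,n-1$, given by its adjacency lists in clockwise order with the directions of the edges, the program halts after at most $C\,n$ elementary steps and outputs natural-number coordinates of the vertices of a PCOD of that tree with split complexity zero. (The machine works on natural numbers in scalar variables and randomly accessible arrays; its elementary operations are constants, copying, reading and writing array cells, adding or subtracting one, comparisons, and branching.) -/

import Mathlib

/-! ## Digraphs with a fixed embedding -/

/-- A digraph without loops and 2-cycles, together with a combinatorial embedding: `rot v` lists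
the neighbours of `v` (equivalently, the edges incident to `v`) in clockwise order around `v`.
The list is to be read cyclically.  When the underlying graph is a tree, every such rotation
system is a planar embedding, and it has a single face, the outer one. -/
structure EmbeddedDigraph (V : Type*) extends Digraph V where
  asymm : ∀ u v, Adj u v → ¬ Adj v u
  rot : V → List V
  nodup_rot : ∀ v, (rot v).Nodup
  mem_rot : ∀ v w, w ∈ rot v ↔ Adj v w ∨ Adj w v

namespace EmbeddedDigraph

variable {V : Type*} (T : EmbeddedDigraph V)

/-- The underlying undirected graph is a tree. -/
def IsTree : Prop := T.toDigraph.toSimpleGraphInclusive.IsTree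

/-- A vertex of degree one. -/
def IsLeaf (v : V) : Prop := (T.rot v).length = 1

open Classical in
/-- The number of cyclically consecutive pairs of edges around `v` that are neither both incoming
nor both outgoing edges of `v`. -/
noncomputable def alternations (v : V) : ℕ :=
  ((T.rot v).zip ((T.rot v).rotate 1)).countP
    fun p => decide (¬ (T.Adj v p.1 ↔ T.Adj v p.2))

/-- `k`-modality. -/
def IsModal (k : ℕ) : Prop := ∀ v, T.alternations v ≤ k

end EmbeddedDigraph

/-! ## Planar confluent orthogonal drawings -/

/-- The vertical segment with which the L-shaped polyline from `p` to `q` starts. -/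
def vertSeg (p q : ℝ × ℝ) : Set (ℝ × ℝ) := {z | z.1 = p.1 ∧ z.2 ∈ Set.uIcc p.2 q.2}

/-- The horizontal segment with which the L-shaped polyline from `p` to `q` ends. -/
def horSeg (p q : ℝ × ℝ) : Set (ℝ × ℝ) := {z | z.2 = q.2 ∧ z.1 ∈ Set.uIcc p.1 q.1}

/-- The one-bend orthogonal polyline from `p` via `(p.1, q.2)` to `q`. -/
def ell (p q : ℝ × ℝ) : Set (ℝ × ℝ) := vertSeg p q ∪ horSeg p q

/-- The data of an orthogonal drawing: the points that represent the vertices and, for each edge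
`(u, v)`, the list `bends u v` of its independent bends (its second, fourth, ... bend).  The edge
is the concatenation of the L-shaped polylines between consecutive points of
`pos u, bends u v, pos v`; with `k` independent bends it has `2 * k + 1` bends, starts with a
vertical segment at `u` and ends with a horizontal segment at `v`.  Only the values of `bends` at
edges matter. -/
structure OrthoDrawing (V : Type*) where
  pos : V → ℝ × ℝ
  bends : V → V → List (ℝ × ℝ)

namespace OrthoDrawing

variable {V : Type*} (Γ : OrthoDrawing V) (T : EmbeddedDigraph V)

/-- The points at which the edge `(u, v)` is cut into L-shaped pieces. -/
def chain (u v : V) : List (ℝ × ℝ) := Γ.pos u :: (Γ.bends u v ++ [Γ.pos v])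

/-- There is an L-shaped piece from `p` to `q`. -/
def Piece (p q : ℝ × ℝ) : Prop :=
  ∃ u v, T.Adj u v ∧ (p, q) ∈ (Γ.chain u v).zip (Γ.chain u v).tail

/-- Vertices and independent bends, i.e. the vertices of the subdivision of `T` of which the
drawing is an L-drawing. -/
abbrev Node : Type _ :=
  V ⊕ (Σ a : {a : V × V // T.Adj a.1 a.2}, Fin (Γ.bends a.1.1 a.1.2).length)

def nodePos : Γ.Node T → ℝ × ℝ :=
  Sum.elim Γ.pos fun i => (Γ.bends i.1.1.1 i.1.1.2).get i.2

/-- Two distinct pieces meet only where both follow their first segment out of the same node,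
or where both follow their last segment into the same node, or in a node where one of them ends and
the other one starts; and no edge passes through a vertex. -/
def NonCrossing : Prop :=
  (∀ p q p' q', Γ.Piece T p q → Γ.Piece T p' q' → (p, q) ≠ (p', q') →
    ∀ z ∈ ell p q ∩ ell p' q',
      (p = p' ∧ z ∈ vertSeg p q ∩ vertSeg p' q') ∨
      (q = q' ∧ z ∈ horSeg p q ∩ horSeg p' q') ∨
      (z = p ∧ z = q') ∨ (z = q ∧ z = p')) ∧
  (∀ w p q, Γ.Piece T p q → Γ.pos w ∈ ell p q → Γ.pos w = p ∨ Γ.pos w = q)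

/-- Clockwise position, around the vertex at `p`, of an edge whose first piece is `ell p q`.
The first component is the port, `1` for North and `3` for South (`0`, `1`, `2`, `3` being West,
North, East, South, in clockwise order).  Edges at the same port are ordered by the side to which
they turn off and by the distance from `p` at which they do so; thus at the North port one
has first the edges turning left, the nearest bend first, and then those turning right,
the farthest bend first. -/
noncomputable def outKey (p q : ℝ × ℝ) : ℕ ×ₗ ℝ :=
  toLex (if p.2 < q.2 then 1 else 3, Real.sign (q.1 - p.1) / (q.2 - p.2))

/-- Clockwise position, around the vertex at `p`, of an edge whose last piece is `ell q p`.  It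
arrives at the West port (`0`) or the East port (`2`); thus at the West port one has
first the edges coming from below, the nearest bend first, and then those coming from above, the
farthest bend first. -/
noncomputable def inKey (p q : ℝ × ℝ) : ℕ ×ₗ ℝ :=
  toLex (if q.1 < p.1 then 0 else 2, - Real.sign (q.2 - p.2) / (q.1 - p.1))

open Classical in
/-- Clockwise position around `v` of the edge between `v` and its neighbour `w`. -/
noncomputable def key (v w : V) : ℕ ×ₗ ℝ :=
  if T.Adj v w then outKey (Γ.pos v) ((Γ.bends v w).headD (Γ.pos w))
  else inKey (Γ.pos v) ((Γ.bends w v).getLastD (Γ.pos w))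

/-- The cyclic clockwise order of the edges around each vertex in the drawing is the prescribed
one. -/
def RespectsEmbedding : Prop :=
  ∀ v, ∃ l : List V, l ~r T.rot v ∧ l.Pairwise fun a b => Γ.key T v a < Γ.key T v b

/-- `Γ` is a planar confluent orthogonal drawing of the embedded digraph `T`. -/
structure IsPCOD : Prop where
  injective_x : Function.Injective fun i => (Γ.nodePos T i).1
  injective_y : Function.Injective fun i => (Γ.nodePos T i).2
  nonCrossing : Γ.NonCrossing T
  respectsEmbedding : Γ.RespectsEmbedding T

/-- The maximum number of independent bends of an edge. -/
noncomputable def splitComplexity : ℕ∞ :=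
  ⨆ (u : V) (v : V) (_ : T.Adj u v), ((Γ.bends u v).length : ℕ∞)

/-- The set of all points of the drawing. -/
def points : Set (ℝ × ℝ) := Set.range Γ.pos ∪ {z | ∃ p q, Γ.Piece T p q ∧ z ∈ ell p q}

/-- The vertex `v` lies in a corner of the bounding box of the drawing: a right one or a left one
according to `right`, an upper one or a lower one according to `upper`. -/
def AtCorner (v : V) (right upper : Bool) : Prop :=
  ∀ z ∈ Γ.points T,
    (if right then z.1 ≤ (Γ.pos v).1 else (Γ.pos v).1 ≤ z.1) ∧
    (if upper then z.2 ≤ (Γ.pos v).2 else (Γ.pos v).2 ≤ z.2)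

/-- The drawing without independent bends given by integer coordinates of the vertices. -/
def ofCoords {n : ℕ} (x y : ℕ → ℕ) : OrthoDrawing (Fin n) where
  pos v := ((x v : ℝ), (y v : ℝ))
  bends _ _ := []

end OrthoDrawing

/-! ## A random access machine with a step count

Programs act on natural numbers that are stored in scalar variables and in arrays with random
access.  The only arithmetic is adding or subtracting one, so a program that runs for `t`
steps handles only numbers of size `O(t)` plus the size of the largest input number, i.e. words of
logarithmic length when `t` is linear. -/

namespace RAM

inductive Expr : Type
  | const (k : ℕ)
  | var (x : ℕ)
  | read (A : ℕ) (i : Expr)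
  | succ (e : Expr)
  | pred (e : Expr)

inductive Test : Type
  | eq (e f : Expr)
  | lt (e f : Expr)
  | not (b : Test)
  | and (b c : Test)

inductive Cmd : Type
  | skip
  | assign (x : ℕ) (e : Expr)
  | write (A : ℕ) (i e : Expr)
  | seq (c d : Cmd)
  | ite (b : Test) (c d : Cmd)
  | while (b : Test) (c : Cmd)

/-- The memory: scalar variables and arrays, both named by natural numbers. -/
structure Store : Type where
  var : ℕ → ℕ
  arr : ℕ → ℕ → ℕ

namespace Store

def setVar (s : Store) (x a : ℕ) : Store :=
  { s with var := Function.update s.var x a }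

def setArr (s : Store) (A i a : ℕ) : Store :=
  { s with arr := Function.update s.arr A (Function.update (s.arr A) i a) }

end Store

namespace Expr

def eval (s : Store) : Expr → ℕ
  | const k => k
  | var x => s.var x
  | read A i => s.arr A (i.eval s)
  | succ e => e.eval s + 1
  | pred e => e.eval s - 1

def cost : Expr → ℕ
  | const _ => 1
  | var _ => 1
  | read _ i => i.cost + 1
  | succ e => e.cost + 1
  | pred e => e.cost + 1

end Expr

namespace Test

def holds (s : Store) : Test → Prop
  | eq e f => e.eval s = f.eval s
  | lt e f => e.eval s < f.eval s
  | not b => ¬ b.holds s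
  | and b c => b.holds s ∧ c.holds s

def cost : Test → ℕ
  | eq e f => e.cost + f.cost + 1
  | lt e f => e.cost + f.cost + 1
  | not b => b.cost + 1
  | and b c => b.cost + c.cost + 1

end Test

/-- `Exec c s t s'`: started in the memory `s`, the program `c` halts after `t` elementary steps
in the memory `s'`. -/
inductive Exec : Cmd → Store → ℕ → Store → Prop
  | skip (s : Store) : Exec Cmd.skip s 1 s
  | assign (s : Store) (x : ℕ) (e : Expr) :
      Exec (Cmd.assign x e) s (e.cost + 1) (s.setVar x (e.eval s))
  | write (s : Store) (A : ℕ) (i e : Expr) :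
      Exec (Cmd.write A i e) s (i.cost + e.cost + 1) (s.setArr A (i.eval s) (e.eval s))
  | seq {c d : Cmd} {s s₁ s₂ : Store} {t₁ t₂ : ℕ} :
      Exec c s t₁ s₁ → Exec d s₁ t₂ s₂ → Exec (Cmd.seq c d) s (t₁ + t₂) s₂
  | ite_true {b : Test} {c d : Cmd} {s s₁ : Store} {t : ℕ} :
      b.holds s → Exec c s t s₁ → Exec (Cmd.ite b c d) s (b.cost + 1 + t) s₁
  | ite_false {b : Test} {c d : Cmd} {s s₁ : Store} {t : ℕ} :
      ¬ b.holds s → Exec d s t s₁ → Exec (Cmd.ite b c d) s (b.cost + 1 + t) s₁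
  | while_true {b : Test} {c : Cmd} {s s₁ s₂ : Store} {t₁ t₂ : ℕ} :
      b.holds s → Exec c s t₁ s₁ → Exec (Cmd.while b c) s₁ t₂ s₂ →
        Exec (Cmd.while b c) s (b.cost + 1 + t₁ + t₂) s₂
  | while_false {b : Test} {c : Cmd} {s : Store} :
      ¬ b.holds s → Exec (Cmd.while b c) s (b.cost + 1) s

end RAM

namespace EmbeddedDigraph

variable {n : ℕ} (T : EmbeddedDigraph (Fin n))

/-- The adjacency lists in clockwise order, one after the other: all pairs of a vertex and one of
its neighbours. -/
def slots : List (Fin n × Fin n) :=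
  (List.finRange n).flatMap fun v => (T.rot v).map fun w => (v, w)

open Classical in
/-- The memory that holds the input `T`: variable `0` is the number of vertices, the neighbours of
`v` stand in array `1` in clockwise order in the cells from `arr 0 v` up to but not including
`arr 0 (v + 1)`, and array `2` holds at the same places a `1` for outgoing and a `0` for incoming
edges of `v`.  All other cells are zero. -/
noncomputable def inputStore : RAM.Store where
  var := Function.update (fun _ => 0) 0 n
  arr
    | 0 => fun v => if v ≤ n then T.slots.countP fun p => decide ((p.1 : ℕ) < v) else 0
    | 1 => fun i => (T.slots.map fun p => (p.2 : ℕ)).getD i 0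
    | 2 => fun i => (T.slots.map fun p => if T.Adj p.1 p.2 then 1 else 0).getD i 0
    | _ => fun _ => 0

end EmbeddedDigraph

/-! The tree is drawn by growing it: a new neighbour `c` of a placed vertex `v` is inserted
immediately beside `v` in both the left-to-right and the bottom-to-top order of the vertices. No
vertex then lies strictly between `v` and `c` in either order, so the thin new edge cannot cross
anything, and every other vertex compares with `c` exactly as it does with `v` (`Near`,
`IsDraw.attach`). Because the underlying graph is a tree, the far end of an undrawn edge at a placed
vertex is never placed already; otherwise that edge would not be a bridge
(`IsDraw.notMem_of_not_nb`).

The four quadrants at `v` give control over the rotation. A vertex placed beside `v` in the quadrant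
between directions `Q` and `Q + 1` turns off nearer to `v` than all earlier neighbours at the port
used, so it comes last at port `Q` or first at port `Q + 1`; the direction of the edge decides which
(`IsDraw.attach_last`, `IsDraw.attach_first`). Hence the edges around `v` can be added one at a
time, starting from the edge to the parent `r` at some port `d`. Going counterclockwise from `r`,
the edges with the direction of `r` are put in front of `r` at port `d`. The others are added
clockwise after `r`, moving on to the next port at every change of direction, which fits because
ports are alternately outgoing and incoming. If the clockwise part is nonempty, its last edge
differs in direction from `r`, so at least one of the at most four cyclic changes lies beyond it. At
most three remain, and the clockwise part never runs past port `d + 3` (`countSteps_le_three`,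
`PortAfter.change`, `Placed.expand`).

Starting from one edge and expanding every vertex yields the whole tree. If the start vertex is a
leaf with its neighbour in quadrant `Q`, it is finished at once and stays extreme in the directions
opposite to `Q` and `Q + 1`, since later vertices are only put beside others; the four choices of
`Q` give the four corners.

For linear time the two orders are kept as doubly linked lists and the vertices as a queue.
Expanding `v` costs time proportional to its degree, that is, a constant plus a constant per newly
attached vertex (`expandCmd_spec`). Walking along the finished lists gives the coordinates. -/

namespace TreeDrawing

/-! ### Drawings of partial trees

The ports of a vertex are numbered `0`, `1`, `2`, `3` for West, North, East, South.  The function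
`al q` measures how far a vertex lies in direction `q`. -/

/-- The ports at which the outgoing edges leave. -/
def OutPort (q : Fin 4) : Prop := q = 1 ∨ q = 3

instance : DecidablePred OutPort := fun q => inferInstanceAs (Decidable (q = 1 ∨ q = 3))

lemma outPort_add_one (q : Fin 4) : OutPort (q + 1) ↔ ¬ OutPort q := by revert q; decide
lemma outPort_add_two (q : Fin 4) : OutPort (q + 2) ↔ OutPort q := by revert q; decide
lemma outPort_add_three (q : Fin 4) : OutPort (q + 3) ↔ ¬ OutPort q := by revert q; decide

variable {V : Type*}

/-- The edge between `v` and `w` has the direction that port `q` of `v` requires. -/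
def Fits (T : EmbeddedDigraph V) (q : Fin 4) (v w : V) : Prop :=
  (OutPort q ∧ T.Adj v w) ∨ (¬ OutPort q ∧ T.Adj w v)

lemma Fits.swap {T : EmbeddedDigraph V} {q q' : Fin 4} {v w : V} (h : Fits T q v w)
    (hq : OutPort q' ↔ ¬ OutPort q) : Fits T q' w v := by
  unfold Fits at *; tauto

def StrictBetween (f : V → ℤ) (a m b : V) : Prop :=
  (f a < f m ∧ f m < f b) ∨ (f b < f m ∧ f m < f a)

/-- The clockwise order of two neighbours `a` and `b` that are attached at port `q` of `v`. -/
def Prec (al : Fin 4 → V → ℤ) (q : Fin 4) (v a b : V) : Prop :=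
  (al (q + 1) a < al (q + 1) v ∧ al (q + 1) v < al (q + 1) b) ∨
  (al (q + 1) a < al (q + 1) v ∧ al (q + 1) b < al (q + 1) v ∧ al q a < al q b) ∨
  (al (q + 1) v < al (q + 1) a ∧ al (q + 1) v < al (q + 1) b ∧ al q b < al q a)

/-- `w` is a neighbour of `v` in the drawn part. -/
def Nb (G : V → Fin 4 → List V) (v w : V) : Prop := ∃ q, w ∈ G v q

/-- A drawing of the part of `T` that consists of the vertices in `P` and of the edges given by
`G`, where `G v q` lists in clockwise order the neighbours attached at port `q` of `v`. -/
structure IsDraw (T : EmbeddedDigraph V) (P : Set V) (al : Fin 4 → V → ℤ)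
    (G : V → Fin 4 → List V) : Prop where
  neg : ∀ q v, al (q + 2) v = - al q v
  inj : ∀ q, Set.InjOn (al q) P
  mem_left : ∀ {v q w}, w ∈ G v q → v ∈ P
  mem_right : ∀ {v q w}, w ∈ G v q → w ∈ P
  lt : ∀ {v q w}, w ∈ G v q → al q v < al q w
  fits : ∀ {v q w}, w ∈ G v q → Fits T q v w
  symm : ∀ {v w}, Nb G v w → Nb G w v
  sorted : ∀ v q, (G v q).Pairwise (Prec al q v)
  conn : ∀ a ∈ P, ∀ b ∈ P, Relation.ReflTransGen (Nb G) a b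
  -- The edge from `p` to `q` has its vertical segment at the abscissa of `p`, the edge from `a` to
  -- `b` its horizontal one at the height of `b`. Parallel segments need no condition, as distinct
  -- vertices differ in both coordinates.
  noncrossing : ∀ p q a b, T.Adj p q → Nb G p q → T.Adj a b → Nb G a b →
    ¬ (StrictBetween (al 1) p b q ∧ StrictBetween (al 2) a p b)

/-- `al'` arises from `al` by placing `c` directly beside `v`, in the quadrant between the
directions `Q` and `Q + 1`. -/
structure Near (P : Set V) (al al' : Fin 4 → V → ℤ) (v c : V) (Q : Fin 4) : Prop where
  neg : ∀ q v, al' (q + 2) v = - al' q v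
  old : ∀ q, ∀ a ∈ P, ∀ b ∈ P, al' q a < al' q b ↔ al q a < al q b
  new : ∀ q, ∀ a ∈ P, a ≠ v → (al' q a < al' q c ↔ al q a < al q v)
  fst : al' Q v < al' Q c
  snd : al' (Q + 1) v < al' (Q + 1) c

lemma IsDraw.ne {T : EmbeddedDigraph V} {P : Set V} {al : Fin 4 → V → ℤ}
    {G : V → Fin 4 → List V} (h : IsDraw T P al G) {v w : V} (hw : Nb G v w) : v ≠ w := by
  obtain ⟨q, hq⟩ := hw
  rintro rfl
  exact lt_irrefl _ (h.lt hq)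

section Near

variable {P : Set V} {al al' : Fin 4 → V → ℤ} {v c : V} {Q : Fin 4}

/-- The field `new` in the opposite direction `q + 2`, where all comparisons are reversed. -/
lemma Near.new' (h : Near P al al' v c Q) (hneg : ∀ q v, al (q + 2) v = - al q v) (q : Fin 4)
    {a : V} (ha : a ∈ P) (hav : a ≠ v) : al' q c < al' q a ↔ al q v < al q a := by
  have := h.new (q + 2) a ha hav
  rw [h.neg, h.neg, hneg, hneg] at this
  simpa using this

lemma Near.ne (h : Near P al al' v c Q) (q : Fin 4) : al' q v ≠ al' q c := by
  have h1 := h.fst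
  have h2 := h.snd
  have h3 := h.neg Q v
  have h4 := h.neg Q c
  have h5 := h.neg (Q + 1) v
  have h6 := h.neg (Q + 1) c
  have key : ∀ q Q : Fin 4, q = Q ∨ q = Q + 1 ∨ q = Q + 2 ∨ q = Q + 1 + 2 := by decide
  rcases key q Q with rfl | rfl | rfl | rfl <;> omega

lemma Near.strictBetween (h : Near P al al' v c Q) (q : Fin 4) {a b d : V} (ha : a ∈ P)
    (hb : b ∈ P) (hd : d ∈ P) : StrictBetween (al' q) a b d ↔ StrictBetween (al q) a b d := by
  simp only [StrictBetween, h.old q a ha b hb, h.old q b hb d hd, h.old q d hd b hb,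
    h.old q b hb a ha]

/-- No vertex lies strictly between `v` and the new vertex `c`. -/
lemma Near.not_strictBetween (h : Near P al al' v c Q) (hneg : ∀ q v, al (q + 2) v = - al q v)
    (hv : v ∈ P) (q : Fin 4) {m : V} (hm : m ∈ insert c P) :
    ¬ StrictBetween (al' q) v m c ∧ ¬ StrictBetween (al' q) c m v := by
  unfold StrictBetween
  rcases hm with rfl | hm
  · omega
  · rcases eq_or_ne m v with rfl | hne
    · omega
    · have h1 := h.new q m hm hne
      have h2 := h.new' hneg q hm hne
      have h3 := h.old q m hm v hv
      have h4 := h.old q v hv m hm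
      omega

lemma Near.prec (h : Near P al al' v c Q) {q : Fin 4} {u a b : V} (hu : u ∈ P) (ha : a ∈ P)
    (hb : b ∈ P) (hp : Prec al q u a b) : Prec al' q u a b := by
  unfold Prec at *
  simpa only [h.old _ a ha u hu, h.old _ u hu b hb, h.old _ b hb u hu, h.old _ a ha b hb,
    h.old _ u hu a ha, h.old _ b hb a ha] using hp

end Near

/-- The neighbour lists after `c` has been attached to `v`, where `L` is the new list at port `q`
of `v`, and `q'` is the port of `c` at which `v` is attached. -/
def attach [DecidableEq V] (G : V → Fin 4 → List V) (v : V) (q : Fin 4) (L : List V) (c : V)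
    (q' : Fin 4) : V → Fin 4 → List V := fun a p =>
  if a = c then (if p = q' then [v] else []) else if a = v ∧ p = q then L else G a p

variable {T : EmbeddedDigraph V} {P : Set V} {al al' : Fin 4 → V → ℤ} {G : V → Fin 4 → List V}

/-- A neighbour of a placed vertex along an edge that is not yet drawn is not yet placed. -/
theorem IsDraw.notMem_of_not_nb (h : IsDraw T P al G) (hT : T.IsTree) {v c : V} (hv : v ∈ P)
    (hvc : c ∈ T.rot v) (hn : ¬ Nb G v c) : c ∉ P := by
  intro hc
  have hadj : T.Adj v c ∨ T.Adj c v := (T.mem_rot v c).1 hvc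
  have hne : v ≠ c := by
    rintro rfl
    rcases hadj with h1 | h1 <;> exact T.asymm _ _ h1 h1
  have hG : T.toDigraph.toSimpleGraphInclusive.Adj v c := ⟨hne, hadj⟩
  -- In a tree the edge between `v` and `c` is a bridge. But if `c` were placed, drawn edges would
  -- join `v` to `c`, and none of them is this one.
  have hb := SimpleGraph.isAcyclic_iff_forall_adj_isBridge.1 hT.isAcyclic hG
  rw [SimpleGraph.isBridge_iff] at hb
  refine hb ?_
  have hr := h.conn v hv c hc
  have key : ∀ a b, Relation.ReflTransGen (Nb G) a b →
      (T.toDigraph.toSimpleGraphInclusive \ SimpleGraph.fromEdgeSet {s(v, c)}).Reachable a b := by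
    intro a b hab
    induction hab with
    | refl => exact SimpleGraph.Reachable.refl _
    | tail _ hxy ih =>
      rename_i x y
      refine ih.trans (SimpleGraph.Adj.reachable ?_)
      obtain ⟨q, hq⟩ := hxy
      have hf := h.fits hq
      rw [SimpleGraph.sdiff_adj]
      refine ⟨⟨h.ne ⟨q, hq⟩, ?_⟩, ?_⟩
      · rcases hf with hf | hf
        · exact Or.inl hf.2
        · exact Or.inr hf.2
      · rw [SimpleGraph.fromEdgeSet_adj]
        rintro ⟨h1, -⟩
        simp only [Set.mem_singleton_iff, Sym2.eq_iff] at h1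
        rcases h1 with ⟨rfl, rfl⟩ | ⟨rfl, rfl⟩
        · exact hn ⟨q, hq⟩
        · exact hn (h.symm ⟨q, hq⟩)
  exact key _ _ hr

variable [DecidableEq V]

lemma mem_attach (h : IsDraw T P al G) {v c : V} (hv : v ∈ P) (hc : c ∉ P) {q q' : Fin 4}
    {L : List V} (hL : ∀ w, w ∈ L ↔ w = c ∨ w ∈ G v q) {a b : V} {p : Fin 4} :
    b ∈ attach G v q L c q' a p ↔
      b ∈ G a p ∨ (a = c ∧ b = v ∧ p = q') ∨ (a = v ∧ b = c ∧ p = q) := by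
  have hne : v ≠ c := fun e => hc (e ▸ hv)
  unfold attach
  by_cases hac : a = c
  · subst hac
    have : b ∉ G a p := fun hb => hc (h.mem_left hb)
    by_cases hp : p = q'
    · subst hp; simp [this, hne.symm]
    · simp [hp, this, hne.symm]
  · by_cases hav : a = v ∧ p = q
    · obtain ⟨rfl, rfl⟩ := hav
      simp [hac, hL, or_comm]
    · simp only [hac, hav, if_false, false_and, false_or]
      constructor
      · exact Or.inl
      · rintro (hb | ⟨h1, -, h2⟩)
        · exact hb
        · exact absurd ⟨h1, h2⟩ hav

lemma nb_attach (h : IsDraw T P al G) {v c : V} (hv : v ∈ P) (hc : c ∉ P) {q q' : Fin 4}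
    {L : List V} (hL : ∀ w, w ∈ L ↔ w = c ∨ w ∈ G v q) {a b : V} :
    Nb (attach G v q L c q') a b ↔ Nb G a b ∨ (a = c ∧ b = v) ∨ (a = v ∧ b = c) := by
  simp only [Nb, mem_attach h hv hc hL]
  constructor
  · rintro ⟨p, h1 | h1 | h1⟩
    · exact Or.inl ⟨p, h1⟩
    · exact Or.inr (Or.inl ⟨h1.1, h1.2.1⟩)
    · exact Or.inr (Or.inr ⟨h1.1, h1.2.1⟩)
  · rintro (⟨p, h1⟩ | h1 | h1)
    · exact ⟨p, Or.inl h1⟩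
    · exact ⟨q', Or.inr (Or.inl ⟨h1.1, h1.2, rfl⟩)⟩
    · exact ⟨q, Or.inr (Or.inr ⟨h1.1, h1.2, rfl⟩)⟩

/-- Old edges keep the relative order of their ends and so remain uncrossed by each other. A
crossing requires some vertex strictly between the ends of each of the two edges, in the vertical
order for one and in the horizontal order for the other; the new edge has none in either order, so
it can play neither role. -/
theorem IsDraw.attach (h : IsDraw T P al G) {v c : V} (hv : v ∈ P) (hc : c ∉ P) {Q : Fin 4}
    (hn : Near P al al' v c Q) {q q' : Fin 4} {L : List V}
    (hL : ∀ w, w ∈ L ↔ w = c ∨ w ∈ G v q) (hs : L.Pairwise (Prec al' q v))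
    (hq : al' q v < al' q c) (hq' : al' q' c < al' q' v)
    (hf : Fits T q v c) (hf' : Fits T q' c v) :
    IsDraw T (insert c P) al' (attach G v q L c q') := by
  have hne : v ≠ c := fun e => hc (e ▸ hv)
  have hnc : ∀ {a b}, Nb G a b → a ∈ P ∧ b ∈ P := fun ⟨_, h1⟩ => ⟨h.mem_left h1, h.mem_right h1⟩
  refine ⟨hn.neg, ?_, ?_, ?_, ?_, ?_, ?_, ?_, ?_, ?_⟩
  · have key : ∀ q, ∀ a ∈ P, al' q a ≠ al' q c := by
      intro q a ha e
      rcases eq_or_ne a v with rfl | hav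
      · exact hn.ne q e
      · have h1 := hn.new q a ha hav
        have h2 := hn.new' h.neg q ha hav
        exact hav (h.inj q ha hv (by omega))
    intro q a ha b hb e
    rcases ha with rfl | ha <;> rcases hb with rfl | hb
    · rfl
    · exact absurd e.symm (key q b hb)
    · exact absurd e (key q a ha)
    · have h1 := hn.old q a ha b hb
      have h2 := hn.old q b hb a ha
      exact h.inj q ha hb (by omega)
  · intro a p b hb
    rcases (mem_attach h hv hc hL).1 hb with hb | ⟨rfl, -, -⟩ | ⟨rfl, -, -⟩
    · exact Or.inr (h.mem_left hb)
    · exact Or.inl rfl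
    · exact Or.inr hv
  · intro a p b hb
    rcases (mem_attach h hv hc hL).1 hb with hb | ⟨-, rfl, -⟩ | ⟨-, rfl, -⟩
    · exact Or.inr (h.mem_right hb)
    · exact Or.inr hv
    · exact Or.inl rfl
  · intro a p b hb
    rcases (mem_attach h hv hc hL).1 hb with hb | ⟨rfl, rfl, rfl⟩ | ⟨rfl, rfl, rfl⟩
    · exact (hn.old p a (h.mem_left hb) b (h.mem_right hb)).2 (h.lt hb)
    · exact hq'
    · exact hq
  · intro a p b hb
    rcases (mem_attach h hv hc hL).1 hb with hb | ⟨rfl, rfl, rfl⟩ | ⟨rfl, rfl, rfl⟩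
    · exact h.fits hb
    · exact hf'
    · exact hf
  · intro a b hab
    rw [nb_attach h hv hc hL] at *
    rcases hab with hab | hab | hab
    · exact Or.inl (h.symm hab)
    · exact Or.inr (Or.inr hab.symm)
    · exact Or.inr (Or.inl hab.symm)
  · intro a p
    unfold TreeDrawing.attach
    split_ifs with h1 h2 h2
    · simp
    · simp
    · rw [h2.1, h2.2]; exact hs
    · exact (h.sorted a p).imp_of_mem fun hx hy hxy =>
        hn.prec (h.mem_left hx) (h.mem_right hx) (h.mem_right hy) hxy
  · have hmono : ∀ a b, Relation.ReflTransGen (Nb G) a b →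
        Relation.ReflTransGen (Nb (TreeDrawing.attach G v q L c q')) a b := fun a b hab =>
      Relation.ReflTransGen.mono (fun x y hxy =>
        (nb_attach (q' := q') h hv hc hL).2 (Or.inl hxy)) _ _ hab
    intro a ha b hb
    have e1 : Relation.ReflTransGen (Nb (TreeDrawing.attach G v q L c q')) a v := by
      rcases ha with rfl | ha
      · exact .single ((nb_attach h hv hc hL).2 (Or.inr (Or.inl ⟨rfl, rfl⟩)))
      · exact hmono _ _ (h.conn a ha v hv)
    have e2 : Relation.ReflTransGen (Nb (TreeDrawing.attach G v q L c q')) v b := by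
      rcases hb with rfl | hb
      · exact .single ((nb_attach h hv hc hL).2 (Or.inr (Or.inr ⟨rfl, rfl⟩)))
      · exact hmono _ _ (h.conn v hv b hb)
    exact e1.trans e2
  · have hmem : ∀ {a b}, Nb (TreeDrawing.attach G v q L c q') a b →
        a ∈ insert c P ∧ b ∈ insert c P := by
      intro a b hab
      rcases (nb_attach h hv hc hL).1 hab with hab | ⟨rfl, rfl⟩ | ⟨rfl, rfl⟩
      · exact ⟨Or.inr (hnc hab).1, Or.inr (hnc hab).2⟩
      · exact ⟨Or.inl rfl, Or.inr hv⟩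
      · exact ⟨Or.inr hv, Or.inl rfl⟩
    rintro a b a' b' hab nab hab' nab' ⟨s1, s2⟩
    have m1 := hmem nab
    have m2 := hmem nab'
    rcases (nb_attach h hv hc hL).1 nab with nab | ⟨rfl, rfl⟩ | ⟨rfl, rfl⟩
    · rcases (nb_attach h hv hc hL).1 nab' with nab' | ⟨rfl, rfl⟩ | ⟨rfl, rfl⟩
      · refine h.noncrossing a b a' b' hab nab hab' nab' ⟨?_, ?_⟩
        · exact (hn.strictBetween 1 (hnc nab).1 (hnc nab').2 (hnc nab).2).1 s1
        · exact (hn.strictBetween 2 (hnc nab').1 (hnc nab).1 (hnc nab').2).1 s2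
      · exact (hn.not_strictBetween h.neg hv 2 m1.1).2 s2
      · exact (hn.not_strictBetween h.neg hv 2 m1.1).1 s2
    · exact (hn.not_strictBetween h.neg hv 1 m2.2).2 s1
    · exact (hn.not_strictBetween h.neg hv 1 m2.2).1 s1

/-- Attaching `c` as the last neighbour at port `Q` of `v`. -/
theorem IsDraw.attach_last (h : IsDraw T P al G) {v c : V} (hv : v ∈ P) (hc : c ∉ P) {Q : Fin 4}
    (hn : Near P al al' v c Q) (hf : Fits T Q v c) :
    IsDraw T (insert c P) al' (TreeDrawing.attach G v Q (G v Q ++ [c]) c (Q + 3)) := by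
  have e3 : Q + 3 = Q + 1 + 2 := by rw [add_assoc]; rfl
  refine h.attach hv hc hn (by simp [or_comm]) ?_ hn.fst ?_ hf (hf.swap (outPort_add_three Q))
  · rw [List.pairwise_append]
    refine ⟨(h.sorted v Q).imp_of_mem fun hx hy hxy =>
      hn.prec (h.mem_left hx) (h.mem_right hx) (h.mem_right hy) hxy, by simp, ?_⟩
    -- An old neighbour `a` at this port lies beyond `v` in direction `Q`, and `c` is the immediate
    -- successor of `v`, so the bend towards `c` is the nearest. Since `c` turns off to the
    -- clockwise side, where far bends come first, it follows every such `a`.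
    intro a ha b hb
    obtain rfl : b = c := by simpa using hb
    have hav : a ≠ v := (h.ne ⟨Q, ha⟩).symm
    have h1 := hn.snd
    have h2 := (hn.new' h.neg Q (h.mem_right ha) hav).2 (h.lt ha)
    have h3 : al' (Q + 1) a ≠ al' (Q + 1) v := by
      intro e
      have h4 := hn.old (Q + 1) a (h.mem_right ha) v hv
      have h5 := hn.old (Q + 1) v hv a (h.mem_right ha)
      exact hav (h.inj (Q + 1) (h.mem_right ha) hv (by omega))
    unfold Prec
    omega
  · have := hn.snd
    rw [e3, hn.neg, hn.neg]; omega

/-- Attaching `c` as the first neighbour at port `Q + 1` of `v`. -/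
theorem IsDraw.attach_first (h : IsDraw T P al G) {v c : V} (hv : v ∈ P) (hc : c ∉ P) {Q : Fin 4}
    (hn : Near P al al' v c Q) (hf : Fits T (Q + 1) v c) :
    IsDraw T (insert c P) al' (TreeDrawing.attach G v (Q + 1) (c :: G v (Q + 1)) c (Q + 2)) := by
  have e2 : Q + 1 + 1 = Q + 2 := by rw [add_assoc]; rfl
  refine h.attach hv hc hn (by simp) ?_ hn.snd ?_ hf
    (hf.swap (by rw [outPort_add_two, outPort_add_one, not_not]))
  · rw [List.pairwise_cons]
    refine ⟨?_, (h.sorted v (Q + 1)).imp_of_mem fun hx hy hxy =>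
      hn.prec (h.mem_left hx) (h.mem_right hx) (h.mem_right hy) hxy⟩
    -- The mirror image: at port `Q + 1` the vertex `c` turns off to the counterclockwise side,
    -- where the nearest bend comes first.
    intro a ha
    have hav : a ≠ v := (h.ne ⟨Q + 1, ha⟩).symm
    have h1 := hn.fst
    have h2 := (hn.new' h.neg (Q + 1) (h.mem_right ha) hav).2 (h.lt ha)
    have h3 : al' Q a ≠ al' Q v := by
      intro e
      have h4 := hn.old Q a (h.mem_right ha) v hv
      have h5 := hn.old Q v hv a (h.mem_right ha)
      exact hav (h.inj Q (h.mem_right ha) hv (by omega))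
    unfold Prec
    rw [e2, hn.neg, hn.neg, hn.neg]
    omega
  · have := hn.fst
    rw [hn.neg, hn.neg]; omega

end TreeDrawing

/-! ### From combinatorial drawings to planar L-drawings. -/

namespace TreeDrawing

variable {V : Type*} {T : EmbeddedDigraph V} {P : Set V} {al : Fin 4 → V → ℤ}
  {G : V → Fin 4 → List V}

/-- All edges at `v` are drawn, in the prescribed cyclic order. -/
def Complete (T : EmbeddedDigraph V) (G : V → Fin 4 → List V) (v : V) : Prop :=
  (G v 0 ++ G v 1 ++ G v 2 ++ G v 3) ~r T.rot v

lemma Complete.nb_iff {v w : V} (h : Complete T G v) : Nb G v w ↔ w ∈ T.rot v := by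
  rw [← h.mem_iff]
  simp [Nb, Fin.exists_fin_succ]

lemma sign_intCast (k : ℤ) : Real.sign (k : ℝ) = (k.sign : ℝ) := by
  rcases lt_trichotomy k 0 with h | h | h
  · rw [Real.sign_of_neg (by exact_mod_cast h), Int.sign_eq_neg_one_of_neg h]; simp
  · simp [h]
  · rw [Real.sign_of_pos (by exact_mod_cast h), Int.sign_eq_one_of_pos h]; simp

/-- Left turns have key `-1 / distance`, negative and increasing with the distance; right turns have
`1 / distance`, positive and decreasing. This is how one real number encodes the three clauses of
`Prec`. -/
lemma sign_div_lt_of_prec {q : Fin 4} {v a b : V} (ha : al q v < al q a) (hb : al q v < al q b)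
    (h : Prec al q v a b) :
    ((al (q + 1) a - al (q + 1) v).sign : ℝ) / ((al q a - al q v : ℤ) : ℝ) <
      ((al (q + 1) b - al (q + 1) v).sign : ℝ) / ((al q b - al q v : ℤ) : ℝ) := by
  have pa : (0 : ℝ) < ((al q a - al q v : ℤ) : ℝ) := by exact_mod_cast sub_pos.2 ha
  have pb : (0 : ℝ) < ((al q b - al q v : ℤ) : ℝ) := by exact_mod_cast sub_pos.2 hb
  rcases h with ⟨h1, h2⟩ | ⟨h1, h2, h3⟩ | ⟨h1, h2, h3⟩
  · rw [Int.sign_eq_neg_one_of_neg (sub_neg.2 h1), Int.sign_eq_one_of_pos (sub_pos.2 h2)]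
    push_cast
    exact (div_neg_of_neg_of_pos (by norm_num) (by exact_mod_cast pa)).trans
      (div_pos one_pos (by exact_mod_cast pb))
  · rw [Int.sign_eq_neg_one_of_neg (sub_neg.2 h1), Int.sign_eq_neg_one_of_neg (sub_neg.2 h2)]
    have h4 : ((al q a - al q v : ℤ) : ℝ) < ((al q b - al q v : ℤ) : ℝ) := by
      exact_mod_cast sub_lt_sub_right h3 _
    have := one_div_lt_one_div_of_lt pa h4
    rw [Int.cast_neg, Int.cast_one, neg_div, neg_div]
    linarith
  · rw [Int.sign_eq_one_of_pos (sub_pos.2 h1), Int.sign_eq_one_of_pos (sub_pos.2 h2)]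
    have h4 : ((al q b - al q v : ℤ) : ℝ) < ((al q a - al q v : ℤ) : ℝ) := by
      exact_mod_cast sub_lt_sub_right h3 _
    have := one_div_lt_one_div_of_lt pb h4
    rw [Int.cast_one]
    exact this

lemma IsDraw.al_zero (h : IsDraw T P al G) (v : V) : al 0 v = - al 2 v := by
  have := h.neg 2 v
  exact this

lemma IsDraw.al_three (h : IsDraw T P al G) (v : V) : al 3 v = - al 1 v := h.neg 1 v

lemma strictBetween_of_mem_uIcc {f : V → ℤ} {a m b : V} {r : ℝ} (hr : r = f m)
    (h : r ∈ Set.uIcc (f a : ℝ) (f b)) (ha : f m ≠ f a) (hb' : f m ≠ f b) :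
    StrictBetween f a m b := by
  subst hr
  rw [Set.mem_uIcc] at h
  have h' : (f a ≤ f m ∧ f m ≤ f b) ∨ (f b ≤ f m ∧ f m ≤ f a) := by exact_mod_cast h
  unfold StrictBetween
  omega

section Drawing

variable {Γ : OrthoDrawing V}

/-- By `Fits` the port decides which of `outKey` and `inKey` applies. There are no independent
bends, so the default values of `headD` and `getLastD`, namely the other end, are used. The four
cases agree because West and South are measured by the negatives of the coordinates for East and
North. -/
lemma IsDraw.key_eq (hpos : ∀ v, Γ.pos v = ((al 2 v : ℝ), (al 1 v : ℝ)))
    (hb : ∀ u v, Γ.bends u v = []) (h : IsDraw T P al G) {v w : V} {q : Fin 4} (hw : w ∈ G v q) :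
    Γ.key T v w = toLex ((q : ℕ),
      ((al (q + 1) w - al (q + 1) v).sign : ℝ) / ((al q w - al q v : ℤ) : ℝ)) := by
  have hlt := h.lt hw
  have hf := h.fits hw
  have h0 := h.al_zero
  have h3 := h.al_three
  have e0 : (0 : Fin 4) + 1 = 1 := rfl
  have e1 : (1 : Fin 4) + 1 = 2 := rfl
  have e2 : (2 : Fin 4) + 1 = 3 := rfl
  have e3 : (3 : Fin 4) + 1 = 0 := rfl
  have hs : ∀ a b : ℤ, Real.sign ((a : ℝ) - b) = ((a - b).sign : ℝ) := by
    intro a b; rw [← sign_intCast]; push_cast; rfl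
  have hsn : ∀ a b : ℤ, (-a - -b).sign = - (a - b).sign := by
    intro a b; rw [← Int.sign_neg]; congr 1; ring
  have hq : q = 0 ∨ q = 1 ∨ q = 2 ∨ q = 3 := by clear hlt hf hw; revert q; decide
  unfold OrthoDrawing.key
  rcases hq with rfl | rfl | rfl | rfl
  · have hf' : T.Adj w v := by rcases hf with hf | hf; exact absurd hf.1 (by decide); exact hf.2
    rw [if_neg (T.asymm _ _ hf'), hb]
    rw [h0, h0] at hlt
    have hlt' : (al 2 w : ℝ) < al 2 v := by exact_mod_cast (by omega : al 2 w < al 2 v)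
    simp only [OrthoDrawing.inKey, hpos, List.getLastD_nil, hlt', if_true, hs, e0, h0]
    congr 2
    push_cast
    rw [neg_div, ← div_neg]; congr 1; ring
  · have hf' : T.Adj v w := by rcases hf with hf | hf; exact hf.2; exact absurd (by decide) hf.1
    rw [if_pos hf', hb]
    have hlt' : (al 1 v : ℝ) < al 1 w := by exact_mod_cast hlt
    simp only [OrthoDrawing.outKey, hpos, List.headD_nil, hlt', if_true, hs, e1]
    congr 2
    push_cast; rfl
  · have hf' : T.Adj w v := by rcases hf with hf | hf; exact absurd hf.1 (by decide); exact hf.2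
    rw [if_neg (T.asymm _ _ hf'), hb]
    have hlt' : ¬ (al 2 w : ℝ) < al 2 v := by exact_mod_cast (by omega : ¬ al 2 w < al 2 v)
    simp only [OrthoDrawing.inKey, hpos, List.getLastD_nil, hlt', if_false, hs, e2, h3, hsn]
    congr 2
    push_cast; rfl
  · have hf' : T.Adj v w := by rcases hf with hf | hf; exact hf.2; exact absurd (by decide) hf.1
    rw [if_pos hf', hb]
    rw [h3, h3] at hlt
    have hlt' : ¬ (al 1 v : ℝ) < al 1 w := by exact_mod_cast (by omega : ¬ al 1 v < al 1 w)
    simp only [OrthoDrawing.outKey, hpos, List.headD_nil, hlt', if_false, hs, e3, h3, h0, hsn]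
    congr 2
    push_cast
    rw [neg_div, ← div_neg]; congr 1; ring

lemma IsDraw.pairwise_key (hpos : ∀ v, Γ.pos v = ((al 2 v : ℝ), (al 1 v : ℝ)))
    (hb : ∀ u v, Γ.bends u v = []) (h : IsDraw T P al G) (v : V) :
    (G v 0 ++ G v 1 ++ G v 2 ++ G v 3).Pairwise fun a b => Γ.key T v a < Γ.key T v b := by
  have h1 : ∀ q, (G v q).Pairwise fun a b => Γ.key T v a < Γ.key T v b := fun q =>
    (h.sorted v q).imp_of_mem fun ha hb' hab => by
      rw [IsDraw.key_eq hpos hb h ha, IsDraw.key_eq hpos hb h hb', Prod.Lex.toLex_lt_toLex]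
      exact Or.inr ⟨rfl, sign_div_lt_of_prec (h.lt ha) (h.lt hb') hab⟩
  have h2 : ∀ q q' : Fin 4, q < q' → ∀ a ∈ G v q, ∀ b ∈ G v q', Γ.key T v a < Γ.key T v b := by
    intro q q' hq a ha b hb'
    rw [IsDraw.key_eq hpos hb h ha, IsDraw.key_eq hpos hb h hb', Prod.Lex.toLex_lt_toLex]
    exact Or.inl hq
  simp only [List.pairwise_append, h1, true_and, List.mem_append]
  refine ⟨⟨h2 0 1 (by decide), ?_⟩, ?_⟩
  · rintro a (ha | ha) b hb'
    · exact h2 0 2 (by decide) a ha b hb'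
    · exact h2 1 2 (by decide) a ha b hb'
  · rintro a ((ha | ha) | ha) b hb'
    · exact h2 0 3 (by decide) a ha b hb'
    · exact h2 1 3 (by decide) a ha b hb'
    · exact h2 2 3 (by decide) a ha b hb'

lemma piece_iff (hb : ∀ u v, Γ.bends u v = []) {p q : ℝ × ℝ} :
    Γ.Piece T p q ↔ ∃ u v, T.Adj u v ∧ p = Γ.pos u ∧ q = Γ.pos v := by
  simp [OrthoDrawing.Piece, OrthoDrawing.chain, hb]

lemma splitComplexity_eq_zero (hb : ∀ u v, Γ.bends u v = []) :
    Γ.splitComplexity T = 0 := by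
  simp [OrthoDrawing.splitComplexity, hb]

/-- A meeting point lies in two closed intervals. Away from the three coincidences, distinctness of
coordinates makes both memberships strict, which `noncrossing` forbids. -/
lemma IsDraw.noncrossing_vert_hor (hpos : ∀ v, Γ.pos v = ((al 2 v : ℝ), (al 1 v : ℝ)))
    (h : IsDraw T Set.univ al G) (hc : ∀ v, Complete T G v)
    {a b a' b' : V} (hab : T.Adj a b) (hab' : T.Adj a' b') {z : ℝ × ℝ}
    (hz : z ∈ vertSeg (Γ.pos a) (Γ.pos b)) (hz' : z ∈ horSeg (Γ.pos a') (Γ.pos b')) :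
    a = a' ∨ b = b' ∨ a = b' := by
  by_contra! hne
  have n1 : Nb G a b := (hc a).nb_iff.2 ((T.mem_rot _ _).2 (Or.inl hab))
  have n2 : Nb G a' b' := (hc a').nb_iff.2 ((T.mem_rot _ _).2 (Or.inl hab'))
  have inj : ∀ q u w, al q u = al q w → u = w := fun q u w e =>
    h.inj q (Set.mem_univ _) (Set.mem_univ _) e
  simp only [vertSeg, horSeg, hpos, Set.mem_ofPred_eq] at hz hz'
  refine h.noncrossing a b a' b' hab n1 hab' n2 ⟨?_, ?_⟩
  · exact strictBetween_of_mem_uIcc hz'.1 hz.2 (fun e => hne.2.2 (inj _ _ _ e).symm)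
      fun e => hne.2.1 (inj _ _ _ e).symm
  · exact strictBetween_of_mem_uIcc hz.1 hz'.2 (fun e => hne.1 (inj _ _ _ e))
      fun e => hne.2.2 (inj _ _ _ e)

/-- A complete drawing of the whole tree is a planar L-drawing. -/
theorem IsDraw.isPCOD (hpos : ∀ v, Γ.pos v = ((al 2 v : ℝ), (al 1 v : ℝ)))
    (hb : ∀ u v, Γ.bends u v = []) (h : IsDraw T Set.univ al G) (hc : ∀ v, Complete T G v) : Γ.IsPCOD T := by
  have inj : ∀ q u w, al q u = al q w → u = w := fun q u w e =>
    h.inj q (Set.mem_univ _) (Set.mem_univ _) e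
  have hfin : ∀ i : Γ.Node T, ∃ v, i = Sum.inl v := by
    rintro (v | ⟨a, k⟩)
    · exact ⟨v, rfl⟩
    · rw [hb] at k; exact k.elim0
  have inj1 : ∀ u w, (Γ.pos u).1 = (Γ.pos w).1 → u = w := by
    intro u w e
    rw [hpos, hpos] at e
    exact inj 2 _ _ (Int.cast_injective e)
  have inj2 : ∀ u w, (Γ.pos u).2 = (Γ.pos w).2 → u = w := by
    intro u w e
    rw [hpos, hpos] at e
    exact inj 1 _ _ (Int.cast_injective e)
  refine ⟨?_, ?_, ⟨?_, ?_⟩, fun v => ⟨_, hc v, IsDraw.pairwise_key hpos hb h v⟩⟩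
  · intro i j e
    obtain ⟨u, rfl⟩ := hfin i
    obtain ⟨w, rfl⟩ := hfin j
    rw [inj1 u w e]
  · intro i j e
    obtain ⟨u, rfl⟩ := hfin i
    obtain ⟨w, rfl⟩ := hfin j
    rw [inj2 u w e]
  · intro p q p' q' h1 h2 _ z hz
    obtain ⟨a, b, hab, rfl, rfl⟩ := (piece_iff hb).1 h1
    obtain ⟨a', b', hab', rfl, rfl⟩ := (piece_iff hb).1 h2
    -- Two vertical segments that meet have the same abscissa and hence the same tail; two
    -- horizontal ones have the same head. The mixed cases are `IsDraw.noncrossing_vert_hor`.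
    rcases hz with ⟨hz | hz, hz' | hz'⟩
    · obtain rfl := inj1 a a' (hz.1.symm.trans hz'.1)
      exact Or.inl ⟨rfl, hz, hz'⟩
    · rcases IsDraw.noncrossing_vert_hor hpos h hc hab hab' hz hz' with rfl | rfl | rfl
      · exact Or.inl ⟨rfl, hz, hz.1, by rw [hz'.1]; exact Set.right_mem_uIcc⟩
      · exact Or.inr (Or.inl ⟨rfl, ⟨hz'.1, by rw [hz.1]; exact Set.left_mem_uIcc⟩, hz'⟩)
      · exact Or.inr (Or.inr (Or.inl ⟨Prod.ext hz.1 hz'.1, Prod.ext hz.1 hz'.1⟩))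
    · rcases IsDraw.noncrossing_vert_hor hpos h hc hab' hab hz' hz with rfl | rfl | rfl
      · exact Or.inl ⟨rfl, ⟨hz'.1, by rw [hz.1]; exact Set.right_mem_uIcc⟩, hz'⟩
      · exact Or.inr (Or.inl ⟨rfl, hz, ⟨hz.1, by rw [hz'.1]; exact Set.left_mem_uIcc⟩⟩)
      · exact Or.inr (Or.inr (Or.inr ⟨Prod.ext hz'.1 hz.1, Prod.ext hz'.1 hz.1⟩))
    · obtain rfl := inj2 b b' (hz.1.symm.trans hz'.1)
      exact Or.inr (Or.inl ⟨rfl, hz, hz'⟩)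
  · intro w p q h1 hz
    obtain ⟨a, b, hab, rfl, rfl⟩ := (piece_iff hb).1 h1
    rcases hz with hz | hz
    · exact Or.inl (by rw [inj1 w a hz.1])
    · exact Or.inr (by rw [inj2 w b hz.1])

lemma atCorner_of_forall (hb : ∀ u v, Γ.bends u v = []) (v : V) (right upper : Bool)
    (hx : ∀ w, if right then (Γ.pos w).1 ≤ (Γ.pos v).1 else (Γ.pos v).1 ≤ (Γ.pos w).1)
    (hy : ∀ w, if upper then (Γ.pos w).2 ≤ (Γ.pos v).2 else (Γ.pos v).2 ≤ (Γ.pos w).2) :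
    Γ.AtCorner T v right upper := by
  have mono : ∀ (f : Bool) (a b c t : ℝ), (if f then a ≤ c else c ≤ a) →
      (if f then b ≤ c else c ≤ b) → t ∈ Set.uIcc a b → if f then t ≤ c else c ≤ t := by
    intro f a b c t h1 h2 h3
    rw [Set.mem_uIcc] at h3
    cases f <;> simp only [Bool.false_eq_true, if_true, if_false] at * <;>
      rcases h3 with h3 | h3 <;> linarith [h3.1, h3.2]
  rintro z (⟨w, rfl⟩ | ⟨p, q, hp, hz⟩)
  · exact ⟨hx w, hy w⟩
  · obtain ⟨a, b, -, rfl, rfl⟩ := (piece_iff hb).1 hp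
    rcases hz with hz | hz
    · exact ⟨by rw [hz.1]; exact hx a, mono _ _ _ _ _ (hy a) (hy b) hz.2⟩
    · exact ⟨mono _ _ _ _ _ (hx a) (hx b) hz.2, by rw [hz.1]; exact hy b⟩

end Drawing

end TreeDrawing

namespace TreeDrawing

variable {V : Type*}

/-! ### Alternations along a list -/

/-- The number of consecutive pairs of `l` that are related by `g`. -/
def countSteps (g : V → V → Bool) : List V → ℕ
  | a :: b :: l => (if g a b then 1 else 0) + countSteps g (b :: l)
  | _ => 0

/-- The element `b` is kept in both halves, so no consecutive pair gets lost at the cut. -/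
lemma countSteps_append (g : V → V → Bool) (l₁ : List V) (b : V) (l₂ : List V) :
    countSteps g (l₁ ++ b :: l₂) = countSteps g (l₁ ++ [b]) + countSteps g (b :: l₂) := by
  induction l₁ with
  | nil => simp [countSteps]
  | cons a l ih =>
    cases l with
    | nil => simp [countSteps]
    | cons c l =>
      simp only [List.cons_append, countSteps] at *
      rw [ih, add_assoc]

/-- With `b = a` the left side is the cyclic count over `a :: l`, which thus becomes a linear count
after the first element is repeated at the end. A free `b` makes the induction work. -/
lemma countP_zip_eq_countSteps (g : V → V → Bool) (a b : V) (l : List V) :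
    ((a :: l).zip (l ++ [b])).countP (fun p => g p.1 p.2) = countSteps g (a :: l ++ [b]) := by
  induction l generalizing a with
  | nil => simp [countSteps, List.countP_cons]
  | cons c l ih =>
    have := ih c
    simp only [List.cons_append, List.zip_cons_cons, List.countP_cons, countSteps] at *
    rw [this, add_comm]

lemma one_le_countSteps {g : V → V → Bool} {f : V → Prop} (hg : ∀ a b, g a b ↔ ¬ (f a ↔ f b))
    (a b : V) (l : List V) (h : ¬ (f a ↔ f b)) : 1 ≤ countSteps g (a :: l ++ [b]) := by
  induction l generalizing a with
  | nil => simp [countSteps, (hg a b).2 h]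
  | cons c l ih =>
    simp only [List.cons_append, countSteps]
    by_cases hac : f a ↔ f c
    · have := ih c (by rwa [← hac])
      simp only [List.cons_append] at this
      omega
    · simp [(hg a c).2 hac]

lemma countP_zip_rotate {l l' : List V} (h : l ~r l') (g : V × V → Bool) :
    (l.zip (l.rotate 1)).countP g = (l'.zip (l'.rotate 1)).countP g := by
  obtain ⟨n, rfl⟩ := h
  rw [List.rotate_rotate, add_comm, ← List.rotate_rotate]
  have := List.zipWith_rotate_distrib Prod.mk l (l.rotate 1) n (by simp)
  change _ = List.countP g (List.zipWith Prod.mk _ _)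
  rw [← this]
  exact ((List.rotate_perm _ n).countP_eq g).symm

open Classical in
/-- The edges between `v` and its neighbours `a` and `b` have different directions at `v`. -/
noncomputable def differ (T : EmbeddedDigraph V) (v a b : V) : Bool :=
  decide (¬ (T.Adj v a ↔ T.Adj v b))

/-- If the clockwise list of neighbours `r :: m ++ s` of `v` is such that the edges in `s` have the
direction of `r` but the last edge in `m` has not, then there are at most three changes of
direction in `r :: m`. -/
theorem countSteps_le_three {T : EmbeddedDigraph V} {v r z : V} {m s : List V}
    (hT : T.alternations v ≤ 4) (hrot : (r :: (m ++ [z] ++ s)) ~r T.rot v)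
    (hz : ¬ (T.Adj v z ↔ T.Adj v r)) : countSteps (differ T v) (r :: (m ++ [z])) ≤ 3 := by
  have h1 : T.alternations v = countSteps (differ T v) (r :: (m ++ [z] ++ s) ++ [r]) := by
    rw [← countP_zip_eq_countSteps]
    have := countP_zip_rotate hrot fun p => differ T v p.1 p.2
    rw [List.rotate_cons_succ, List.rotate_zero] at this
    rw [this]
    rfl
  have e : r :: (m ++ [z] ++ s) ++ [r] = (r :: m) ++ z :: (s ++ [r]) := by simp
  rw [e, countSteps_append] at h1
  -- The way from `z` through `s` back to `r` uses at least one of the four changes.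
  have h2 := one_le_countSteps (g := differ T v) (f := fun a => T.Adj v a)
    (by intro a b; simp [differ]) z r s hz
  simp only [List.cons_append] at h1 h2 ⊢
  omega

/-! ### Inserting into lists -/

/-- `l'` arises from `l` by inserting `c` directly after or directly before `v`. -/
def InsertBeside (after : Prop) [Decidable after] (v c : V) (l l' : List V) : Prop :=
  ∃ l₁ l₂, l = l₁ ++ v :: l₂ ∧ l' = l₁ ++ (if after then v :: c :: l₂ else c :: v :: l₂)

lemma exists_insertBeside (after : Prop) [Decidable after] {v : V} (c : V) {l : List V}
    (hv : v ∈ l) : ∃ l', InsertBeside after v c l l' := by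
  obtain ⟨l₁, l₂, h⟩ := List.append_of_mem hv
  exact ⟨_, l₁, l₂, h, rfl⟩

section InsertBeside

variable {after : Prop} [Decidable after] {v c : V} {l l' : List V}

lemma InsertBeside.perm (h : InsertBeside after v c l l') : List.Perm l' (c :: l) := by
  obtain ⟨l₁, l₂, rfl, rfl⟩ := h
  split_ifs
  · have : l₁ ++ v :: c :: l₂ = (l₁ ++ [v]) ++ c :: l₂ := by simp
    rw [this]
    exact List.perm_middle.trans (by simp)
  · exact List.perm_middle

lemma InsertBeside.mem_iff (h : InsertBeside after v c l l') {a : V} :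
    a ∈ l' ↔ a = c ∨ a ∈ l := by
  rw [h.perm.mem_iff, List.mem_cons]

lemma InsertBeside.nodup (h : InsertBeside after v c l l') (hl : l.Nodup) (hc : c ∉ l) :
    l'.Nodup := by
  rw [h.perm.nodup_iff, List.nodup_cons]
  exact ⟨hc, hl⟩

variable [DecidableEq V]

/-- Positions beyond the insertion place shift by one. All comparisons of old and new positions are
read off from these formulas. -/
lemma InsertBeside.idxOf (h : InsertBeside after v c l l') (hl : l.Nodup) (hc : c ∉ l) :
    (∀ a ∈ l, a ≠ v → l'.idxOf a = if l.idxOf a < l.idxOf v then l.idxOf a else l.idxOf a + 1) ∧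
    (∀ a ∈ l, a ≠ v → l.idxOf a ≠ l.idxOf v) ∧
    l'.idxOf v = (if after then l.idxOf v else l.idxOf v + 1) ∧
    l'.idxOf c = (if after then l.idxOf v + 1 else l.idxOf v) := by
  obtain ⟨l₁, l₂, rfl, rfl⟩ := h
  have hv1 : v ∉ l₁ := by
    intro hv
    exact (List.disjoint_of_nodup_append hl) hv (by simp)
  have hc1 : c ∉ l₁ := fun hh => hc (by simp [hh])
  have hcv : c ≠ v := fun hh => hc (by simp [hh])
  have hc2 : c ∉ l₂ := fun hh => hc (by simp [hh])
  have ev : (l₁ ++ v :: l₂).idxOf v = l₁.length := by simp [List.idxOf_append, hv1]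
  have elt : ∀ a ∈ l₁, l₁.idxOf a < l₁.length := fun a ha => List.idxOf_lt_length_of_mem ha
  refine ⟨?_, ?_, ?_, ?_⟩
  · intro a ha hav
    have hac : a ≠ c := fun e => hc (e ▸ ha)
    rw [ev]
    by_cases ha1 : a ∈ l₁
    · simp [List.idxOf_append, ha1, elt a ha1]
    · split_ifs <;>
        simp_all [List.idxOf_append, List.idxOf_cons_ne, Ne.symm hav, Ne.symm hac] <;> omega
  · intro a ha hav
    rw [ev]
    by_cases ha1 : a ∈ l₁
    · have := elt a ha1
      simp only [List.idxOf_append, ha1, if_true]; omega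
    · simp [List.idxOf_append, ha1, List.idxOf_cons_ne _ (Ne.symm hav)]
  · rw [ev]
    split_ifs <;> simp [List.idxOf_append, hv1, List.idxOf_cons_ne _ hcv, add_comm]
  · rw [ev]
    split_ifs <;> simp [List.idxOf_append, hc1, List.idxOf_cons_ne _ hcv.symm, add_comm]

lemma InsertBeside.lt_iff (h : InsertBeside after v c l l') (hl : l.Nodup) (hc : c ∉ l) {a b : V}
    (ha : a ∈ l) (hb : b ∈ l) : l'.idxOf a < l'.idxOf b ↔ l.idxOf a < l.idxOf b := by
  obtain ⟨h1, h2, h3, h4⟩ := h.idxOf hl hc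
  rcases eq_or_ne a v with rfl | hav <;> rcases eq_or_ne b a with rfl | hba
  · simp
  · have := h2 b hb hba
    rw [h1 b hb hba, h3]
    split_ifs <;> omega
  · simp
  · have := h2 a ha hav
    rcases eq_or_ne b v with rfl | hbv
    · rw [h1 a ha hav, h3]
      split_ifs <;> omega
    · have := h2 b hb hbv
      rw [h1 a ha hav, h1 b hb hbv]
      split_ifs <;> omega

lemma InsertBeside.lt_new_iff (h : InsertBeside after v c l l') (hl : l.Nodup) (hc : c ∉ l)
    {a : V} (ha : a ∈ l) (hav : a ≠ v) :
    (l'.idxOf a < l'.idxOf c ↔ l.idxOf a < l.idxOf v) ∧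
      (l'.idxOf c < l'.idxOf a ↔ l.idxOf v < l.idxOf a) := by
  obtain ⟨h1, h2, h3, h4⟩ := h.idxOf hl hc
  have := h2 a ha hav
  rw [h1 a ha hav, h4]
  split_ifs <;> omega

end InsertBeside

/-! ### Coordinates from two linear orders. -/

/-- The coordinates given by the order of the vertices in the two lists. -/
def alOf [DecidableEq V] (xs ys : List V) : Fin 4 → V → ℤ :=
  ![fun v => -(xs.idxOf v : ℤ), fun v => (ys.idxOf v : ℤ), fun v => (xs.idxOf v : ℤ),
    fun v => -(ys.idxOf v : ℤ)]

lemma forall_fin_four {p : Fin 4 → Prop} : (∀ q, p q) ↔ p 0 ∧ p 1 ∧ p 2 ∧ p 3 := by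
  simp [Fin.forall_fin_succ]

variable [DecidableEq V]

lemma alOf_neg (xs ys : List V) (q : Fin 4) (v : V) :
    alOf xs ys (q + 2) v = - alOf xs ys q v := by
  revert q
  rw [forall_fin_four]
  refine ⟨?_, ?_, ?_, ?_⟩
  · change (xs.idxOf v : ℤ) = - -(xs.idxOf v : ℤ); simp
  · rfl
  · rfl
  · change (ys.idxOf v : ℤ) = - -(ys.idxOf v : ℤ); simp

/-- The quadrants `1` and `2` are those to the right of `v`, and `0` and `1` those above it. Being
adjacent to `v` in both lists is what makes `c` indistinguishable from `v` for all other vertices.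
-/
lemma near_of_insertBeside {xs ys xs' ys' : List V} {v c : V} {Q : Fin 4}
    (hx : InsertBeside (Q = 1 ∨ Q = 2) v c xs xs') (hy : InsertBeside (Q = 0 ∨ Q = 1) v c ys ys')
    (hxs : xs.Nodup) (hys : ys.Nodup) (hmem : ∀ a, a ∈ ys ↔ a ∈ xs) (hc : c ∉ xs) :
    Near {a | a ∈ xs} (alOf xs ys) (alOf xs' ys') v c Q := by
  have hc' : c ∉ ys := fun h => hc ((hmem c).1 h)
  obtain ⟨-, -, hx3, hx4⟩ := hx.idxOf hxs hc
  obtain ⟨-, -, hy3, hy4⟩ := hy.idxOf hys hc'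
  have hQ : (alOf xs' ys' Q v < alOf xs' ys' Q c) ∧
      (alOf xs' ys' (Q + 1) v < alOf xs' ys' (Q + 1) c) := by
    have h4 : ∀ q : Fin 4, q = 0 ∨ q = 1 ∨ q = 2 ∨ q = 3 := by decide
    rcases h4 Q with rfl | rfl | rfl | rfl
    · change -(xs'.idxOf v : ℤ) < -(xs'.idxOf c : ℤ) ∧ (ys'.idxOf v : ℤ) < (ys'.idxOf c : ℤ)
      rw [hx3, hx4, hy3, hy4]
      simp
    · change (ys'.idxOf v : ℤ) < (ys'.idxOf c : ℤ) ∧ (xs'.idxOf v : ℤ) < (xs'.idxOf c : ℤ)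
      rw [hx3, hx4, hy3, hy4]
      simp
    · change (xs'.idxOf v : ℤ) < (xs'.idxOf c : ℤ) ∧ -(ys'.idxOf v : ℤ) < -(ys'.idxOf c : ℤ)
      rw [hx3, hx4, hy3, hy4]
      simp
    · change -(ys'.idxOf v : ℤ) < -(ys'.idxOf c : ℤ) ∧ -(xs'.idxOf v : ℤ) < -(xs'.idxOf c : ℤ)
      rw [hx3, hx4, hy3, hy4]
      simp
  refine ⟨alOf_neg xs' ys', ?_, ?_, hQ.1, hQ.2⟩
  · intro q a ha b hb
    have h1 := hx.lt_iff hxs hc (a := a) (b := b) ha hb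
    have h2 := hy.lt_iff hys hc' (a := a) (b := b) ((hmem a).2 ha) ((hmem b).2 hb)
    have h3 := hx.lt_iff hxs hc (a := b) (b := a) hb ha
    have h4 := hy.lt_iff hys hc' (a := b) (b := a) ((hmem b).2 hb) ((hmem a).2 ha)
    revert q
    rw [forall_fin_four]
    simp [alOf, h1, h2, h3, h4]
  · intro q a ha hav
    have h1 := hx.lt_new_iff hxs hc ha hav
    have h2 := hy.lt_new_iff hys hc' ((hmem a).2 ha) hav
    revert q
    rw [forall_fin_four]
    simp [alOf, h1, h2]

end TreeDrawing

namespace TreeDrawing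

variable {V : Type*} {T : EmbeddedDigraph V} {xs ys xs' ys' : List V} {G : V → Fin 4 → List V}
  {v r c : V} {d k : Fin 4} {p s : List V}

/-! ### Growing a drawing -/

/-- The only neighbour of `v` drawn so far is `r`, attached at port `d`. -/
def Fresh (G : V → Fin 4 → List V) (v r : V) (d : Fin 4) : Prop :=
  G v d = [r] ∧ ∀ q ≠ d, G v q = []

/-- The neighbours of `v` drawn so far are `s ++ r :: p` in clockwise order from the first one at
port `d`, and there are none after port `d + k`. -/
structure Expanding (G : V → Fin 4 → List V) (v r : V) (d k : Fin 4) (p s : List V) : Prop where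
  concat : G v d ++ (G v (d + 1) ++ (G v (d + 2) ++ G v (d + 3))) = s ++ r :: p
  empty : ∀ j, k < j → G v (d + j) = []

lemma fits_iff {q : Fin 4} (hc : c ∈ T.rot v) : Fits T q v c ↔ (OutPort q ↔ T.Adj v c) := by
  have h1 := (T.mem_rot v c).1 hc
  have h2 := T.asymm v c
  unfold Fits
  by_cases h3 : T.Adj v c <;> by_cases h4 : OutPort q <;> simp_all

lemma insert_setOf {after : Prop} [Decidable after] (h : InsertBeside after v c xs xs') :
    insert c {a | a ∈ xs} = {a | a ∈ xs'} := by
  ext a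
  simp [h.mem_iff]

lemma Fresh.expanding (h : Fresh G v r d) : Expanding G v r d 0 [] [] := by
  have key : ∀ j : Fin 4, 0 < j → G v (d + j) = [] := fun j hj =>
    h.2 _ fun e => by simp [add_eq_left] at e; simp [e] at hj
  refine ⟨?_, key⟩
  rw [key 1 (by decide), key 2 (by decide), key 3 (by decide), h.1]
  simp

lemma Expanding.mono (h : Expanding G v r d k p s) {k' : Fin 4} (hk : k ≤ k') :
    Expanding G v r d k' p s := ⟨h.concat, fun j hj => h.empty j (hk.trans_lt hj)⟩

lemma Expanding.nb_iff (h : Expanding G v r d k p s) {w : V} : Nb G v w ↔ w ∈ s ++ r :: p := by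
  rw [← h.concat]
  simp only [List.mem_append, Nb]
  constructor
  · rintro ⟨q, hq⟩
    have key : ∀ q d : Fin 4, q = d ∨ q = d + 1 ∨ q = d + 2 ∨ q = d + 3 := by decide
    rcases key q d with rfl | rfl | rfl | rfl <;> simp [hq]
  · rintro (h | h | h | h) <;> exact ⟨_, h⟩

/-- `Expanding` reads the ports from `d` on and `Complete` from `0` on, which is a rotation; another
rotation brings `r` to the front. -/
lemma Expanding.complete (h : Expanding G v r d k p s) (hrot : (r :: (p ++ s)) ~r T.rot v) :
    Complete T G v := by
  have h1 : (s ++ r :: p) ~r T.rot v :=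
    (List.isRotated_append (l := s) (l' := r :: p)).trans (by simpa using hrot)
  rw [← h.concat] at h1
  refine List.IsRotated.trans ?_ h1
  have h4 : ∀ q : Fin 4, q = 0 ∨ q = 1 ∨ q = 2 ∨ q = 3 := by decide
  rcases h4 d with rfl | rfl | rfl | rfl
  · change _ ~r G v 0 ++ (G v 1 ++ (G v 2 ++ G v 3))
    simp only [List.append_assoc]
    exact List.IsRotated.refl _
  · change _ ~r G v 1 ++ (G v 2 ++ (G v 3 ++ G v 0))
    have := List.isRotated_append (l := G v 0) (l' := G v 1 ++ (G v 2 ++ G v 3))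
    simpa using this
  · change _ ~r G v 2 ++ (G v 3 ++ (G v 0 ++ G v 1))
    have := List.isRotated_append (l := G v 0 ++ G v 1) (l' := G v 2 ++ G v 3)
    simpa using this
  · change _ ~r G v 3 ++ (G v 0 ++ (G v 1 ++ G v 2))
    have := List.isRotated_append (l := G v 0 ++ (G v 1 ++ G v 2)) (l' := G v 3)
    simpa using this

variable [DecidableEq V]

/-- A drawing whose coordinates are the positions in the lists `xs` and `ys`. -/
structure Placed (T : EmbeddedDigraph V) (xs ys : List V) (G : V → Fin 4 → List V) : Prop where
  draw : IsDraw T {a | a ∈ xs} (alOf xs ys) G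
  nodup_x : xs.Nodup
  nodup_y : ys.Nodup
  mem_iff : ∀ a, a ∈ ys ↔ a ∈ xs

theorem Placed.attach_last (h : Placed T xs ys G) (hv : v ∈ xs) (hc : c ∉ xs) {Q : Fin 4}
    (hx : InsertBeside (Q = 1 ∨ Q = 2) v c xs xs') (hy : InsertBeside (Q = 0 ∨ Q = 1) v c ys ys')
    (hf : Fits T Q v c) : Placed T xs' ys' (attach G v Q (G v Q ++ [c]) c (Q + 3)) := by
  have hn := near_of_insertBeside hx hy h.nodup_x h.nodup_y h.mem_iff hc
  refine ⟨?_, hx.nodup h.nodup_x hc, hy.nodup h.nodup_y fun hh => hc ((h.mem_iff c).1 hh), ?_⟩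
  · rw [← insert_setOf hx]
    exact h.draw.attach_last hv hc hn hf
  · intro a
    rw [hx.mem_iff, hy.mem_iff, h.mem_iff]

theorem Placed.attach_first (h : Placed T xs ys G) (hv : v ∈ xs) (hc : c ∉ xs) {Q : Fin 4}
    (hx : InsertBeside (Q = 1 ∨ Q = 2) v c xs xs') (hy : InsertBeside (Q = 0 ∨ Q = 1) v c ys ys')
    (hf : Fits T (Q + 1) v c) :
    Placed T xs' ys' (attach G v (Q + 1) (c :: G v (Q + 1)) c (Q + 2)) := by
  have hn := near_of_insertBeside hx hy h.nodup_x h.nodup_y h.mem_iff hc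
  refine ⟨?_, hx.nodup h.nodup_x hc, hy.nodup h.nodup_y fun hh => hc ((h.mem_iff c).1 hh), ?_⟩
  · rw [← insert_setOf hx]
    exact h.draw.attach_first hv hc hn hf
  · intro a
    rw [hx.mem_iff, hy.mem_iff, h.mem_iff]

lemma attach_of_ne {q q' : Fin 4} {L : List V} {a : V} (hav : a ≠ v) (hac : a ≠ c) :
    attach G v q L c q' a = G a := by
  funext p
  simp [attach, hav, hac]

lemma fresh_attach {q q' : Fin 4} {L : List V} : Fresh (attach G v q L c q') c v q' := by
  constructor
  · simp [attach]
  · intro p hp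
    simp [attach, hp]

lemma attach_self (hvc : v ≠ c) {q' : Fin 4} {L : List V} (j : Fin 4) :
    attach G v (d + k) L c q' v (d + j) = if j = k then L else G v (d + j) := by
  simp [attach, hvc]

/-- The ports after `d + k` are empty, so the end of the list at port `d + k` is the end of the
whole sequence. -/
lemma Expanding.attach_last (h : Expanding G v r d k p s) (hvc : v ≠ c) (q' : Fin 4) :
    Expanding (attach G v (d + k) (G v (d + k) ++ [c]) c q') v r d k (p ++ [c]) s := by
  have h0 := attach_self (G := G) (L := G v (d + k) ++ [c]) (q' := q') (d := d) (k := k) hvc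
  refine ⟨?_, ?_⟩
  · have h4 : ∀ q : Fin 4, q = 0 ∨ q = 1 ∨ q = 2 ∨ q = 3 := by decide
    have e := h.concat
    have e0 : d = d + 0 := by simp
    rw [show s ++ r :: (p ++ [c]) = (s ++ r :: p) ++ [c] by simp, ← h.concat]
    rw [h0 1, h0 2, h0 3]
    have h00 := h0 0
    rw [add_zero] at h00
    rw [h00]
    have hem := h.empty
    rcases h4 k with rfl | rfl | rfl | rfl
    · simp [hem 1 (by decide), hem 2 (by decide), hem 3 (by decide)]
    · simp [hem 2 (by decide), hem 3 (by decide)]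
    · simp [hem 3 (by decide)]
    · simp
  · intro j hj
    rw [h0 j, if_neg hj.ne', h.empty j hj]

lemma Expanding.attach_first (h : Expanding G v r d k p s) (hvc : v ≠ c) (q' : Fin 4) :
    Expanding (attach G v d (c :: G v d) c q') v r d k p (c :: s) := by
  have h0 := attach_self (G := G) (L := c :: G v d) (q' := q') (d := d) (k := 0) hvc
  simp only [add_zero] at h0
  have h00 := h0 0
  simp only [add_zero, if_true] at h00
  refine ⟨?_, ?_⟩
  · rw [h0 1, h0 2, h0 3, h00]
    simp [← h.concat]
  · intro j hj
    rw [h0 j, if_neg (Fin.ne_zero_of_lt hj), h.empty j hj]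

/-- The next neighbour to be drawn is not yet placed. -/
lemma Placed.notMem (h : Placed T xs ys G) (hT : T.IsTree) (hv : v ∈ xs)
    (he : Expanding G v r d k p s) {m : List V} (hrot : (r :: (p ++ m ++ s)) ~r T.rot v)
    (hc : c ∈ m) : c ∉ xs := by
  refine h.draw.notMem_of_not_nb hT hv (hrot.mem_iff.1 (by simp [hc])) ?_
  rw [he.nb_iff]
  have hnd : (r :: (p ++ m ++ s)).Nodup := hrot.nodup_iff.2 (T.nodup_rot v)
  simp only [List.nodup_cons, List.mem_append, List.nodup_append] at hnd
  intro hmem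
  simp only [List.mem_append, List.mem_cons] at hmem
  rcases hmem with hmem | rfl | hmem
  · exact hnd.2.2.2 c (Or.inr hc) c hmem rfl
  · exact hnd.1 (Or.inl (Or.inr hc))
  · exact hnd.2.1.2.2 c hmem c hc rfl

/-- What attaching further vertices to `v` leaves as it was. -/
structure Extends (v : V) (xs ys : List V) (G : V → Fin 4 → List V) (xs' ys' : List V)
    (G' : V → Fin 4 → List V) : Prop where
  mem : ∀ a ∈ xs, a ∈ xs'
  eq : ∀ a ∈ xs, a ≠ v → G' a = G a
  fresh : ∀ a ∈ xs', a ∉ xs → ∃ r d, Fresh G' a r d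
  extreme : ∀ q, ∀ a ∈ xs, a ≠ v → (∀ b ∈ xs, b ≠ a → alOf xs ys q a < alOf xs ys q b) →
    ∀ b ∈ xs', b ≠ a → alOf xs' ys' q a < alOf xs' ys' q b

lemma Extends.refl (v : V) (xs ys : List V) (G : V → Fin 4 → List V) :
    Extends v xs ys G xs ys G :=
  ⟨fun _ h => h, fun _ _ _ => rfl, fun _ h h' => absurd h h', fun _ _ _ _ h => h⟩

lemma Extends.trans {xs'' ys'' : List V} {G' G'' : V → Fin 4 → List V} (hv : v ∈ xs)
    (h : Extends v xs ys G xs' ys' G') (h' : Extends v xs' ys' G' xs'' ys'' G'') :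
    Extends v xs ys G xs'' ys'' G'' := by
  refine ⟨fun a ha => h'.mem a (h.mem a ha), fun a ha hav => ?_, fun a ha ha' => ?_,
    fun q a ha hav hext => h'.extreme q a (h.mem a ha) hav (h.extreme q a ha hav hext)⟩
  · rw [h'.eq a (h.mem a ha) hav, h.eq a ha hav]
  · by_cases hm : a ∈ xs'
    · obtain ⟨r, d, hf⟩ := h.fresh a hm ha'
      have hav : a ≠ v := fun e => ha' (e ▸ hv)
      exact ⟨r, d, by rw [Fresh, h'.eq a hm hav]; exact hf⟩
    · exact h'.fresh a ha hm

/-- Extremality survives because `c` inherits the comparisons of `v`: a vertex other than `v` that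
is strictly behind `v` is strictly behind `c` as well. -/
lemma extends_attach {Q q q' : Fin 4} {L : List V} (h : Placed T xs ys G) (hc : c ∉ xs)
    (hx : InsertBeside (Q = 1 ∨ Q = 2) v c xs xs') (hy : InsertBeside (Q = 0 ∨ Q = 1) v c ys ys')
    (hv : v ∈ xs) : Extends v xs ys G xs' ys' (attach G v q L c q') := by
  have hn := near_of_insertBeside hx hy h.nodup_x h.nodup_y h.mem_iff hc
  refine ⟨fun a ha => hx.mem_iff.2 (Or.inr ha), fun a ha hav => ?_, fun a ha ha' => ?_, ?_⟩
  · exact attach_of_ne hav fun e => hc (e ▸ ha)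
  · obtain rfl : a = c := (hx.mem_iff.1 ha).resolve_right ha'
    exact ⟨v, q', fresh_attach⟩
  · intro p a ha hav hext b hb hba
    rcases hx.mem_iff.1 hb with rfl | hb
    · exact (hn.new p a ha hav).2 (hext v hv hav.symm)
    · exact (hn.old p a ha b hb).2 (hext b hb hba)

/-- Drawing the next neighbour counterclockwise from the parent `r`. -/
theorem Placed.step_first (h : Placed T xs ys G) (hT : T.IsTree) (hv : v ∈ xs)
    (he : Expanding G v r d 0 [] s) {m : List V} (hrot : (r :: (m ++ [c] ++ s)) ~r T.rot v)
    (hd : OutPort d ↔ T.Adj v c)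
    (hx : InsertBeside (d + 3 = 1 ∨ d + 3 = 2) v c xs xs')
    (hy : InsertBeside (d + 3 = 0 ∨ d + 3 = 1) v c ys ys') :
    c ∉ xs ∧ Placed T xs' ys' (attach G v d (c :: G v d) c (d + 1)) ∧
      Expanding (attach G v d (c :: G v d) c (d + 1)) v r d 0 [] (c :: s) := by
  have hc : c ∉ xs := h.notMem hT hv he (m := m ++ [c]) (by simpa using hrot) (by simp)
  have hcr : c ∈ T.rot v := hrot.mem_iff.1 (by simp)
  -- Quadrant `d + 3` is the one just counterclockwise of direction `d`, so a vertex placed there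
  -- can be the first one at port `d`.
  have e1 : d + 3 + 1 = d := by rw [add_assoc]; exact add_zero d
  have e2 : d + 3 + 2 = d + 1 := by rw [add_assoc]; rfl
  have := h.attach_first hv hc hx hy (by rw [e1]; exact (fits_iff hcr).2 hd)
  rw [e1, e2] at this
  exact ⟨hc, this, he.attach_first (fun e => hc (by rwa [← e])) _⟩

/-- Drawing the next neighbour clockwise. -/
theorem Placed.step_last (h : Placed T xs ys G) (hT : T.IsTree) (hv : v ∈ xs)
    (he : Expanding G v r d k p s) {m : List V} (hrot : (r :: (p ++ c :: m ++ s)) ~r T.rot v)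
    (hd : OutPort (d + k) ↔ T.Adj v c)
    (hx : InsertBeside (d + k = 1 ∨ d + k = 2) v c xs xs')
    (hy : InsertBeside (d + k = 0 ∨ d + k = 1) v c ys ys') :
    c ∉ xs ∧ Placed T xs' ys' (attach G v (d + k) (G v (d + k) ++ [c]) c (d + k + 3)) ∧
      Expanding (attach G v (d + k) (G v (d + k) ++ [c]) c (d + k + 3)) v r d k (p ++ [c]) s := by
  have hc : c ∉ xs := h.notMem hT hv he (m := c :: m) hrot (by simp)
  have hcr : c ∈ T.rot v := hrot.mem_iff.1 (by simp)
  exact ⟨hc, h.attach_last hv hc hx hy ((fits_iff hcr).2 hd),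
    he.attach_last (fun e => hc (by rwa [← e])) _⟩

end TreeDrawing

/-! ### Modality and the choice of ports. -/

namespace TreeDrawing

variable {V : Type*} {T : EmbeddedDigraph V} {xs ys xs' ys' : List V} {G : V → Fin 4 → List V}
  {v r c : V} {d k : Fin 4} {p s : List V}

/-- The port `d + k` is the one reached after the neighbours in `r :: p` of `v` have been
attached in clockwise order, beginning at port `d`. -/
def PortAfter (T : EmbeddedDigraph V) (v r : V) (d k : Fin 4) (p : List V) : Prop :=
  (k : ℕ) = countSteps (differ T v) (r :: p) ∧
    ∃ p₀ a, r :: p = p₀ ++ [a] ∧ (OutPort (d + k) ↔ T.Adj v a)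

lemma portAfter_nil (h : OutPort d ↔ T.Adj v r) : PortAfter T v r d 0 [] :=
  ⟨by simp [countSteps], [], r, rfl, by simpa using h⟩

open Classical in
lemma PortAfter.countSteps_eq (h : PortAfter T v r d k p) (c : V) :
    countSteps (differ T v) (r :: (p ++ [c])) =
      k + if (OutPort (d + k) ↔ T.Adj v c) then 0 else 1 := by
  obtain ⟨h1, p₀, a, h2, h3⟩ := h
  rw [h1, ← List.cons_append, h2, List.append_assoc, List.singleton_append, countSteps_append]
  congr 1
  simp [countSteps, differ, h3]

lemma PortAfter.same (h : PortAfter T v r d k p) (hc : OutPort (d + k) ↔ T.Adj v c) :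
    PortAfter T v r d k (p ++ [c]) :=
  ⟨by simp [h.countSteps_eq, hc], r :: p, c, rfl, hc⟩

/-- Consecutive ports have opposite directions, so the next port suits `c`. The bound by three keeps
`k + 1` from wrapping around in `Fin 4`. -/
lemma PortAfter.change (h : PortAfter T v r d k p) (hc : ¬ (OutPort (d + k) ↔ T.Adj v c))
    (h3 : countSteps (differ T v) (r :: (p ++ [c])) ≤ 3) :
    k < k + 1 ∧ PortAfter T v r d (k + 1) (p ++ [c]) ∧ (OutPort (d + (k + 1)) ↔ T.Adj v c) := by
  have e := h.countSteps_eq c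
  rw [if_neg hc] at e
  have hk : k < 3 := by rw [Fin.lt_def]; change (k : ℕ) < 3; omega
  have hk' : ((k + 1 : Fin 4) : ℕ) = k + 1 := by clear h hc e h3; revert k; decide
  have ho : OutPort (d + (k + 1)) ↔ T.Adj v c := by
    rw [← add_assoc, outPort_add_one]
    tauto
  exact ⟨by rw [Fin.lt_def, hk']; omega, ⟨by rw [hk', e], r :: p, c, rfl, ho⟩, ho⟩

/-- Applied to the neighbours after the parent: `s` is drawn counterclockwise at the parent's port,
`m` clockwise. The deviating last element of `m` forces the change of direction that
`countSteps_le_three` needs. -/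
lemma exists_append_maximal_suffix (f : V → Prop) (l : List V) :
    ∃ m s, l = m ++ s ∧ (∀ a ∈ s, f a) ∧ (m = [] ∨ ∃ m' z, m = m' ++ [z] ∧ ¬ f z) := by
  induction l using List.reverseRecOn with
  | nil => exact ⟨[], [], rfl, by simp, Or.inl rfl⟩
  | append_singleton l z ih =>
    by_cases hz : f z
    · obtain ⟨m, s, rfl, h1, h2⟩ := ih
      refine ⟨m, s ++ [z], by simp, ?_, h2⟩
      intro a ha
      rcases List.mem_append.1 ha with ha | ha
      · exact h1 a ha
      · rw [List.mem_singleton.1 ha]; exact hz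
    · exact ⟨l ++ [z], [], by simp, by simp, Or.inr ⟨l, z, rfl, hz⟩⟩

lemma exists_rotated_cons (h : r ∈ T.rot v) : ∃ l, (r :: l) ~r T.rot v := by
  obtain ⟨l₁, l₂, h⟩ := List.append_of_mem h
  exact ⟨l₂ ++ l₁, by rw [h]; exact (List.isRotated_append (l := l₁) (l' := r :: l₂)).symm⟩

lemma countSteps_prefix_le (g : V → V → Bool) (r c : V) (p m : List V) :
    countSteps g (r :: (p ++ [c])) ≤ countSteps g (r :: (p ++ c :: m)) := by
  rw [← List.cons_append, ← List.cons_append, countSteps_append g (r :: p) c m]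
  omega

/-- There are at most three changes of direction in the part of the neighbour list of `v` that is
drawn clockwise from `r`. -/
lemma countSteps_le_three_of_split {m p' : List V} (hT : T.alternations v ≤ 4)
    (hrot : (r :: (m ++ s)) ~r T.rot v)
    (hm : m = [] ∨ ∃ m' z, m = m' ++ [z] ∧ ¬ (T.Adj v z ↔ T.Adj v r)) (hp : m = p ++ c :: p') :
    countSteps (differ T v) (r :: (p ++ [c])) ≤ 3 := by
  rcases hm with rfl | ⟨m', z, rfl, hz⟩
  · simp at hp
  · refine (countSteps_prefix_le _ r c p p').trans ?_
    rw [← hp]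
    exact countSteps_le_three hT hrot hz

variable [DecidableEq V]

lemma Placed.fresh_mem (h : Placed T xs ys G) (hf : Fresh G v r d) :
    v ∈ xs ∧ r ∈ T.rot v ∧ (OutPort d ↔ T.Adj v r) := by
  have hr : r ∈ G v d := by simp [hf.1]
  have h1 := h.draw.fits hr
  have h2 : r ∈ T.rot v := by
    rw [T.mem_rot]
    rcases h1 with h1 | h1
    · exact Or.inl h1.2
    · exact Or.inr h1.2
  exact ⟨h.draw.mem_left hr, h2, (fits_iff h2).1 h1⟩

/-- All missing neighbours of a vertex can be attached. -/
theorem Placed.expand (h : Placed T xs ys G) (hT : T.IsTree) (hmod : T.alternations v ≤ 4)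
    (hf : Fresh G v r d) :
    ∃ xs' ys' G', Placed T xs' ys' G' ∧ Extends v xs ys G xs' ys' G' ∧ Complete T G' v := by
  obtain ⟨hv, hr, hdr⟩ := h.fresh_mem hf
  obtain ⟨l, hl⟩ := exists_rotated_cons hr
  obtain ⟨m, s, rfl, hs, hm⟩ := exists_append_maximal_suffix (fun a => T.Adj v a ↔ T.Adj v r) l
  -- The neighbour next to `r` comes first, that is, `s` is processed from its end, because each new
  -- vertex has to be the first one at port `d`.
  have backward : ∀ s₂ s₁, s = s₁ ++ s₂ → ∃ xs' ys' G', Placed T xs' ys' G' ∧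
      Extends v xs ys G xs' ys' G' ∧ Expanding G' v r d 0 [] s₂ := by
    intro s₂
    induction s₂ with
    | nil => exact fun _ _ => ⟨xs, ys, G, h, .refl _ _ _ _, hf.expanding⟩
    | cons c s₂ ih =>
      intro s₁ e
      obtain ⟨xs₁, ys₁, G₁, h1, h2, h3⟩ := ih (s₁ ++ [c]) (by simp [e])
      have hv1 := h2.mem v hv
      obtain ⟨xs₂, hx⟩ := exists_insertBeside (d + 3 = 1 ∨ d + 3 = 2) c hv1
      obtain ⟨ys₂, hy⟩ := exists_insertBeside (d + 3 = 0 ∨ d + 3 = 1) c ((h1.mem_iff v).2 hv1)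
      obtain ⟨hc, h4, h5⟩ := h1.step_first hT hv1 h3 (m := m ++ s₁) (c := c)
        (by simpa [e] using hl) (hdr.trans (hs c (by simp [e])).symm) hx hy
      exact ⟨_, _, _, h4, h2.trans hv (extends_attach h1 hc hx hy hv1), h5⟩
  -- Starting from the result for all of `s`, the vertices of `m` follow in their order; `k`
  -- increases only where the direction changes.
  have forward : ∀ p p', m = p ++ p' → ∃ xs' ys' G' k, Placed T xs' ys' G' ∧
      Extends v xs ys G xs' ys' G' ∧ Expanding G' v r d k p s ∧ PortAfter T v r d k p := by
    intro p
    induction p using List.reverseRecOn with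
    | nil =>
      intro _ _
      obtain ⟨xs₁, ys₁, G₁, h1, h2, h3⟩ := backward s [] rfl
      exact ⟨xs₁, ys₁, G₁, 0, h1, h2, h3, portAfter_nil hdr⟩
    | append_singleton p c ih =>
      intro p' e
      have e' : m = p ++ c :: p' := by simp [e]
      obtain ⟨xs₁, ys₁, G₁, k, h1, h2, h3, h4⟩ := ih (c :: p') e'
      obtain ⟨k', hk, h5, h6⟩ : ∃ k', k ≤ k' ∧ PortAfter T v r d k' (p ++ [c]) ∧
          (OutPort (d + k') ↔ T.Adj v c) := by
        by_cases hc : OutPort (d + k) ↔ T.Adj v c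
        · exact ⟨k, le_rfl, h4.same hc, hc⟩
        · obtain ⟨h5, h6, h7⟩ := h4.change hc (countSteps_le_three_of_split hmod hl hm e')
          exact ⟨k + 1, h5.le, h6, h7⟩
      have hv1 := h2.mem v hv
      obtain ⟨xs₂, hx⟩ := exists_insertBeside (d + k' = 1 ∨ d + k' = 2) c hv1
      obtain ⟨ys₂, hy⟩ := exists_insertBeside (d + k' = 0 ∨ d + k' = 1) c ((h1.mem_iff v).2 hv1)
      obtain ⟨hc, h7, h8⟩ := h1.step_last hT hv1 (h3.mono hk) (m := p') (c := c)
        (by simpa [e] using hl) h6 hx hy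
      exact ⟨_, _, _, k', h7, h2.trans hv (extends_attach h1 hc hx hy hv1), h8, h5⟩
  obtain ⟨xs₁, ys₁, G₁, k, h1, h2, h3, -⟩ := forward m [] (by simp)
  exact ⟨xs₁, ys₁, G₁, h1, h2, h3.complete hl⟩

/-! ### Drawing the whole tree. -/

/-- A drawing in which every placed vertex is finished contains all vertices. -/
theorem Placed.mem_of_complete (h : Placed T xs ys G) (hT : T.IsTree) (hv : v ∈ xs)
    (hc : ∀ a ∈ xs, Complete T G a) (a : V) : a ∈ xs := by
  have hr := (SimpleGraph.reachable_iff_reflTransGen v a).1 (hT.1.preconnected v a)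
  induction hr with
  | refl => exact hv
  | @tail a b _ hab ih =>
    obtain ⟨q, hq⟩ := (hc a ih).nb_iff.2 ((T.mem_rot a b).2 hab.2)
    exact h.draw.mem_right hq

/-- Induction on a bound for the number of unfinished vertices, placed or not. Expanding a fresh
vertex finishes it, keeps all other finished ones, and produces only fresh ones. A finished vertex
is never expanded again, so its extremality is preserved throughout. -/
theorem Placed.exists_complete [Finite V] (hT : T.IsTree) (hmod : T.IsModal 4) (N : ℕ) :
    ∀ xs ys G, Placed T xs ys G → (∀ v ∈ xs, Complete T G v ∨ ∃ r d, Fresh G v r d) →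
      {v | ¬ (v ∈ xs ∧ Complete T G v)}.ncard ≤ N →
      ∃ xs' ys' G', Placed T xs' ys' G' ∧ (∀ v ∈ xs', Complete T G' v) ∧ (∀ v ∈ xs, v ∈ xs') ∧
        ∀ q, ∀ a ∈ xs, Complete T G a →
          (∀ b ∈ xs, b ≠ a → alOf xs ys q a < alOf xs ys q b) →
          ∀ b ∈ xs', b ≠ a → alOf xs' ys' q a < alOf xs' ys' q b := by
  induction N with
  | zero =>
    intro xs ys G h _ hN
    refine ⟨xs, ys, G, h, fun v _ => ?_, fun _ h => h, fun _ _ _ _ h => h⟩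
    by_contra hcon
    have := (Set.ncard_eq_zero (Set.toFinite _)).1 (Nat.le_zero.1 hN)
    exact Set.notMem_empty v (this ▸ fun hh => hcon hh.2)
  | succ N ih =>
    intro xs ys G h hst hN
    by_cases hall : ∀ v ∈ xs, Complete T G v
    · exact ⟨xs, ys, G, h, hall, fun _ h => h, fun _ _ _ _ h => h⟩
    · push Not at hall
      obtain ⟨v, hv, hvc⟩ := hall
      obtain ⟨r, d, hf⟩ := (hst v hv).resolve_left hvc
      obtain ⟨xs₁, ys₁, G₁, h1, h2, h3⟩ := h.expand hT (hmod v) hf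
      have hkeep : ∀ a ∈ xs, a ≠ v → (Complete T G₁ a ↔ Complete T G a) := by
        intro a ha hav
        rw [Complete, Complete, h2.eq a ha hav]
      obtain ⟨xs₂, ys₂, G₂, h4, h5, h6, h7⟩ := ih xs₁ ys₁ G₁ h1 (by
        intro a ha
        by_cases hax : a ∈ xs
        · rcases eq_or_ne a v with rfl | hav
          · exact Or.inl h3
          · rw [hkeep a hax hav]
            simp only [Fresh, h2.eq a hax hav]
            exact hst a hax
        · exact Or.inr (h2.fresh a ha hax)) (by
        -- The unfinished vertices after the expansion form a proper subset of the earlier ones,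
        -- since `v` has left.
        refine Nat.le_of_lt_succ (lt_of_lt_of_le (Set.ncard_lt_ncard ?_ (Set.toFinite _)) hN)
        refine ⟨fun a ha hh => ha ⟨h2.mem a hh.1, ?_⟩, fun hsub => ?_⟩
        · rcases eq_or_ne a v with rfl | hav
          · exact h3
          · exact (hkeep a hh.1 hav).2 hh.2
        · exact hsub (a := v) (fun hh => hvc hh.2) ⟨h2.mem v hv, h3⟩)
      refine ⟨xs₂, ys₂, G₂, h4, h5, fun a ha => h6 a (h2.mem a ha), fun q a ha hac hext => ?_⟩
      have hav : a ≠ v := fun e => hvc (e ▸ hac)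
      exact h7 q a (h2.mem a ha) ((hkeep a ha hav).2 hac) (h2.extreme q a ha hav hext)

lemma placed_singleton (T : EmbeddedDigraph V) (u : V) : Placed T [u] [u] fun _ _ => [] := by
  refine ⟨⟨alOf_neg _ _, ?_, ?_, ?_, ?_, ?_, ?_, ?_, ?_, ?_⟩, by simp, by simp, by simp⟩
  · intro q a ha b hb _
    simp only [List.mem_singleton, Set.mem_ofPred_eq] at ha hb
    rw [ha, hb]
  · intro v q w hw; simp at hw
  · intro v q w hw; simp at hw
  · intro v q w hw; simp at hw
  · intro v q w hw; simp at hw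
  · rintro v w ⟨q, hw⟩; simp at hw
  · simp
  · intro a ha b hb
    simp only [List.mem_singleton, Set.mem_ofPred_eq] at ha hb
    rw [ha, hb]
  · rintro a b _ _ _ ⟨q, hw⟩; simp at hw

/-- A drawing of a single edge between `u` and `w`, with `w` in the quadrant `Q` of `u`. -/
theorem exists_placed_edge {u w : V} (huw : w ∈ T.rot u) {Q : Fin 4}
    (hx : InsertBeside (Q = 1 ∨ Q = 2) u w [u] xs) (hy : InsertBeside (Q = 0 ∨ Q = 1) u w [u] ys) :
    ∃ G d d', Placed T xs ys G ∧ Fresh G u w d ∧ Fresh G w u d' ∧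
      (((OutPort Q ↔ T.Adj u w) ∧ d = Q ∧ d' = Q + 3) ∨
        (¬ (OutPort Q ↔ T.Adj u w) ∧ d = Q + 1 ∧ d' = Q + 2)) := by
  have h := placed_singleton T u
  have hne : w ≠ u := by
    rintro rfl
    rcases (T.mem_rot w w).1 huw with h1 | h1 <;> exact T.asymm _ _ h1 h1
  have hw : w ∉ [u] := by simpa using hne
  by_cases hQ : OutPort Q ↔ T.Adj u w
  · refine ⟨_, Q, Q + 3, h.attach_last (by simp) hw hx hy ((fits_iff huw).2 hQ), ?_,
      fresh_attach, Or.inl ⟨hQ, rfl, rfl⟩⟩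
    refine ⟨by simp [attach, hne.symm], fun q hq => by simp [attach, hne.symm, hq]⟩
  · have hf : Fits T (Q + 1) u w := by
      rw [fits_iff huw, outPort_add_one]; tauto
    refine ⟨_, Q + 1, Q + 2, h.attach_first (by simp) hw hx hy hf, ?_,
      fresh_attach, Or.inr ⟨hQ, rfl, rfl⟩⟩
    refine ⟨by simp [attach, hne.symm], fun q hq => by simp [attach, hne.symm, hq]⟩

/-- The drawing with the coordinates given by two lists. -/
def listDrawing (xs ys : List V) : OrthoDrawing V where
  pos v := ((xs.idxOf v : ℝ), (ys.idxOf v : ℝ))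
  bends _ _ := []

lemma listDrawing_pos (xs ys : List V) (v : V) :
    (listDrawing xs ys).pos v = ((alOf xs ys 2 v : ℝ), (alOf xs ys 1 v : ℝ)) := by
  simp [listDrawing, alOf]

theorem Placed.isPCOD (h : Placed T xs ys G) (hall : ∀ v, v ∈ xs) (hc : ∀ v, Complete T G v) :
    (listDrawing xs ys).IsPCOD T := by
  have huniv : {a | a ∈ xs} = Set.univ := by ext a; simp [hall]
  have hd := h.draw
  rw [huniv] at hd
  exact IsDraw.isPCOD (listDrawing_pos xs ys) (fun _ _ => rfl) hd hc

/-- If `u` is adjacent to `w`, there is a drawing of the whole tree; if `u` is a leaf, it is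
extreme in the directions opposite to `Q` and `Q + 1`. -/
theorem exists_drawing [Finite V] (hT : T.IsTree) (hmod : T.IsModal 4) {u w : V}
    (huw : w ∈ T.rot u) (Q : Fin 4) :
    ∃ xs ys, (listDrawing xs ys).IsPCOD T ∧ (T.IsLeaf u →
      (∀ b, alOf xs ys Q u ≤ alOf xs ys Q b) ∧
      ∀ b, alOf xs ys (Q + 1) u ≤ alOf xs ys (Q + 1) b) := by
  obtain ⟨xs, hx⟩ := exists_insertBeside (Q = 1 ∨ Q = 2) w (List.mem_singleton.2 (rfl : u = u))
  obtain ⟨ys, hy⟩ := exists_insertBeside (Q = 0 ∨ Q = 1) w (List.mem_singleton.2 (rfl : u = u))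
  have hne : w ≠ u := by
    rintro rfl
    rcases (T.mem_rot w w).1 huw with h1 | h1 <;> exact T.asymm _ _ h1 h1
  have hn := near_of_insertBeside hx hy (by simp) (by simp) (by simp) (by simpa using hne)
  obtain ⟨G, d, d', h, hfu, hfw, -⟩ := exists_placed_edge huw hx hy
  have hmem : ∀ a, a ∈ xs ↔ a = w ∨ a = u := fun a => by rw [hx.mem_iff]; simp
  obtain ⟨xs', ys', G', h1, h2, h3, h4⟩ := Placed.exists_complete hT hmod _ xs ys G h (by
    intro a ha
    rcases (hmem a).1 ha with rfl | rfl
    · exact Or.inr ⟨_, _, hfw⟩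
    · exact Or.inr ⟨_, _, hfu⟩) le_rfl
  have hall := h1.mem_of_complete hT (h3 u ((hmem u).2 (Or.inr rfl))) h2
  refine ⟨xs', ys', h1.isPCOD hall fun v => h2 v (hall v), fun hleaf => ?_⟩
  -- A leaf is finished as soon as its only edge is drawn; hence nothing is ever inserted beside
  -- `u`.
  have hcu : Complete T G u := by
    refine hfu.expanding.complete ?_
    obtain ⟨a, ha⟩ := List.length_eq_one_iff.1 hleaf
    rw [ha, List.mem_singleton] at huw
    rw [ha, huw]
    exact List.IsRotated.refl _
  have key : ∀ q, alOf xs ys q u < alOf xs ys q w → ∀ b, alOf xs' ys' q u ≤ alOf xs' ys' q b := by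
    intro q hq b
    rcases eq_or_ne b u with rfl | hb
    · exact le_rfl
    · refine (h4 q u ((hmem u).2 (Or.inr rfl)) hcu ?_ b (hall b) hb).le
      intro a ha hau
      obtain rfl := ((hmem a).1 ha).resolve_right hau
      exact hq
  exact ⟨key Q hn.fst, key (Q + 1) hn.snd⟩

theorem exists_pcod [Finite V] (hT : T.IsTree) (hmod : T.IsModal 4) :
    ∃ Γ : OrthoDrawing V, Γ.IsPCOD T ∧ Γ.splitComplexity T = 0 := by
  obtain ⟨u⟩ := hT.1.nonempty
  by_cases h : ∃ w, w ∈ T.rot u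
  · obtain ⟨w, hw⟩ := h
    obtain ⟨xs, ys, h1, -⟩ := exists_drawing hT hmod hw 0
    exact ⟨_, h1, splitComplexity_eq_zero fun _ _ => rfl⟩
  · have hc : ∀ a ∈ [u], Complete T (fun _ _ => []) a := by
      intro a ha
      rw [List.mem_singleton.1 ha, Complete, List.eq_nil_iff_forall_not_mem.2 fun w hw => h ⟨w, hw⟩]
      exact List.IsRotated.refl _
    have hp := placed_singleton T u
    have hall := hp.mem_of_complete hT (v := u) (by simp) hc
    exact ⟨_, hp.isPCOD hall fun v => hc v (hall v), splitComplexity_eq_zero fun _ _ => rfl⟩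

theorem exists_pcod_atCorner [Finite V] (hT : T.IsTree) (hmod : T.IsModal 4) {u : V}
    (hu : T.IsLeaf u) (right upper : Bool) :
    ∃ Γ : OrthoDrawing V, Γ.IsPCOD T ∧ Γ.splitComplexity T = 0 ∧ Γ.AtCorner T u right upper := by
  obtain ⟨w, hw⟩ := List.length_eq_one_iff.1 hu
  have huw : w ∈ T.rot u := by simp [hw]
  have key : ∀ xs ys : List V,
      (∀ b, if right then alOf xs ys 2 b ≤ alOf xs ys 2 u else alOf xs ys 2 u ≤ alOf xs ys 2 b) →
      (∀ b, if upper then alOf xs ys 1 b ≤ alOf xs ys 1 u else alOf xs ys 1 u ≤ alOf xs ys 1 b) →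
      (listDrawing xs ys).AtCorner T u right upper := by
    intro xs ys h1 h2
    refine atCorner_of_forall (fun _ _ => rfl) u right upper (fun b => ?_) fun b => ?_
    · have := h1 b
      simp only [listDrawing_pos]
      exact_mod_cast this
    · have := h2 b
      simp only [listDrawing_pos]
      exact_mod_cast this
  have neg0 : ∀ (xs ys : List V) a b, alOf xs ys 0 a ≤ alOf xs ys 0 b ↔
      alOf xs ys 2 b ≤ alOf xs ys 2 a := fun xs ys a b => by simp [alOf]
  have neg3 : ∀ (xs ys : List V) a b, alOf xs ys 3 a ≤ alOf xs ys 3 b ↔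
      alOf xs ys 1 b ≤ alOf xs ys 1 a := fun xs ys a b => by simp [alOf]
  -- The leaf is minimal in the directions `Q` and `Q + 1`, so it occupies the corner opposite to
  -- quadrant `Q`; for instance `Q = 1`, North and East, gives the lower left corner.
  cases right <;> cases upper
  · obtain ⟨xs, ys, h1, h2⟩ := exists_drawing hT hmod huw 1
    exact ⟨_, h1, splitComplexity_eq_zero fun _ _ => rfl,
      key xs ys (by simpa using (h2 hu).2) (by simpa using (h2 hu).1)⟩
  · obtain ⟨xs, ys, h1, h2⟩ := exists_drawing hT hmod huw 2
    exact ⟨_, h1, splitComplexity_eq_zero fun _ _ => rfl,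
      key xs ys (by simpa using (h2 hu).1) (by simpa [← neg3] using (h2 hu).2)⟩
  · obtain ⟨xs, ys, h1, h2⟩ := exists_drawing hT hmod huw 0
    exact ⟨_, h1, splitComplexity_eq_zero fun _ _ => rfl,
      key xs ys (by simpa [← neg0] using (h2 hu).1) (by simpa using (h2 hu).2)⟩
  · obtain ⟨xs, ys, h1, h2⟩ := exists_drawing hT hmod huw 3
    exact ⟨_, h1, splitComplexity_eq_zero fun _ _ => rfl,
      key xs ys (by simpa [← neg0] using (h2 hu).2) (by simpa [← neg3] using (h2 hu).1)⟩

end TreeDrawing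

namespace TreeDrawing

open RAM

/-! ### The input -/

section Input

variable {n : ℕ} (T : EmbeddedDigraph (Fin n))

lemma exists_finRange_eq (v : Fin n) : ∃ l₁ l₂, List.finRange n = l₁ ++ v :: l₂ ∧
    (∀ a ∈ l₁, a < v) ∧ ∀ a ∈ l₂, v < a := by
  obtain ⟨l₁, l₂, h⟩ := List.append_of_mem (List.mem_finRange v)
  have hs : (List.finRange n).Pairwise (· < ·) := List.pairwise_lt_finRange n
  rw [h, List.pairwise_append, List.pairwise_cons] at hs
  exact ⟨l₁, l₂, h, fun a ha => hs.2.2 a ha v (by simp), fun a ha => hs.2.1.1 a ha⟩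

/-- The adjacency list of `v` stands in one piece in the list of all slots. -/
lemma exists_slots_eq (v : Fin n) : ∃ A B, T.slots = A ++ ((T.rot v).map fun w => (v, w)) ++ B ∧
    T.inputStore.arr 0 v = A.length ∧
    T.inputStore.arr 0 (v + 1) = A.length + (T.rot v).length := by
  obtain ⟨l₁, l₂, h, h1, h2⟩ := exists_finRange_eq v
  set f : Fin n → List (Fin n × Fin n) := fun v => (T.rot v).map fun w => (v, w) with hf
  have hs : T.slots = l₁.flatMap f ++ f v ++ l₂.flatMap f := by
    rw [EmbeddedDigraph.slots, h, List.flatMap_append, List.flatMap_cons, List.append_assoc]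
  have hA : ∀ p ∈ l₁.flatMap f, p.1 < v := by
    intro p hp
    simp only [List.mem_flatMap, hf, List.mem_map] at hp
    obtain ⟨a, ha, w, -, rfl⟩ := hp
    exact h1 a ha
  have hv : ∀ p ∈ f v, p.1 = v := by
    intro p hp
    simp only [hf, List.mem_map] at hp
    obtain ⟨w, -, rfl⟩ := hp
    rfl
  have hB : ∀ p ∈ l₂.flatMap f, v < p.1 := by
    intro p hp
    simp only [List.mem_flatMap, hf, List.mem_map] at hp
    obtain ⟨a, ha, w, -, rfl⟩ := hp
    exact h2 a ha
  have hlen : (f v).length = (T.rot v).length := by simp [hf]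
  refine ⟨l₁.flatMap f, l₂.flatMap f, hs, ?_, ?_⟩
  · change (if (v : ℕ) ≤ n then _ else _) = _
    rw [if_pos v.2.le, hs, List.countP_append, List.countP_append, List.countP_eq_length.2,
      List.countP_eq_zero.2, List.countP_eq_zero.2]
    · rfl
    · intro p hp
      have := hB p hp
      rw [Fin.lt_def] at this
      simp only [decide_eq_true_eq]; omega
    · intro p hp
      simp [hv p hp]
    · intro p hp
      have := hA p hp
      rw [Fin.lt_def] at this
      simp only [decide_eq_true_eq]; omega
  · change (if (v : ℕ) + 1 ≤ n then _ else _) = _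
    rw [if_pos (Nat.succ_le_of_lt v.2), hs, List.countP_append, List.countP_append, List.countP_eq_length.2,
      List.countP_eq_length.2, List.countP_eq_zero.2, hlen]
    · rfl
    · intro p hp
      have := hB p hp
      rw [Fin.lt_def] at this
      simp only [decide_eq_true_eq]; omega
    · intro p hp
      simp [hv p hp]
    · intro p hp
      have := hA p hp
      rw [Fin.lt_def] at this
      simp only [decide_eq_true_eq]; omega

/-- The position of the adjacency list of `v`. -/
noncomputable def offset (v : Fin n) : ℕ := T.inputStore.arr 0 v

lemma inputStore_succ (v : Fin n) :
    T.inputStore.arr 0 (v + 1) = offset T v + (T.rot v).length := by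
  obtain ⟨A, B, -, h1, h2⟩ := exists_slots_eq T v
  rw [offset, h1, h2]

/-- Stated for arbitrary `f` to serve both the array of neighbours and that of directions. -/
lemma getD_offset {α : Type*} (f : Fin n × Fin n → α) (z : α) (v : Fin n) {i : ℕ}
    (hi : i < (T.rot v).length) :
    (T.slots.map f).getD (offset T v + i) z = f (v, (T.rot v)[i]) := by
  obtain ⟨A, B, hs, h1, -⟩ := exists_slots_eq T v
  rw [offset, h1, hs, List.map_append, List.map_append, List.append_assoc,
    List.getD_append_right _ _ _ _ (by simp), List.length_map, Nat.add_sub_cancel_left,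
    List.getD_append _ _ _ _ (by simpa using hi), List.getD_eq_getElem _ _ (by simpa using hi)]
  simp

lemma inputStore_nbr (v : Fin n) {i : ℕ} (hi : i < (T.rot v).length) :
    T.inputStore.arr 1 (offset T v + i) = ((T.rot v)[i] : ℕ) :=
  getD_offset T (fun p => (p.2 : ℕ)) 0 v hi

open Classical in
lemma inputStore_dir (v : Fin n) {i : ℕ} (hi : i < (T.rot v).length) :
    T.inputStore.arr 2 (offset T v + i) = if T.Adj v (T.rot v)[i] then 1 else 0 :=
  getD_offset T (fun p => if T.Adj p.1 p.2 then 1 else 0) 0 v hi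

end Input

/-! ### Running programs -/

/-- The program `c` halts on the memory `s`, and the running time and the final memory
satisfy `Q`. -/
def Runs (c : Cmd) (s : Store) (Q : ℕ → Store → Prop) : Prop := ∃ t s', Exec c s t s' ∧ Q t s'

section Runs

variable {c e : Cmd} {b : Test} {s : Store} {Q Q' : ℕ → Store → Prop}

lemma Runs.mono (h : Runs c s Q) (hQ : ∀ t s', Q t s' → Q' t s') : Runs c s Q' := by
  obtain ⟨t, s', h1, h2⟩ := h
  exact ⟨t, s', h1, hQ t s' h2⟩

lemma Runs.seq (h : Runs c s fun t s' => Runs e s' fun t' s'' => Q (t + t') s'') :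
    Runs (.seq c e) s Q := by
  obtain ⟨t, s', h1, t', s'', h2, h3⟩ := h
  exact ⟨_, _, .seq h1 h2, h3⟩

/-- A loop whose remaining running time is bounded by the potential `φ` in `I φ`. -/
lemma Runs.loop {I : ℕ → Store → Prop}
    (h : ∀ φ s, I φ s → b.holds s →
      Runs c s fun t s' => ∃ φ', I φ' s' ∧ b.cost + 1 + t + φ' ≤ φ)
    (φ : ℕ) (s : Store) (hI : I φ s) :
    Runs (.while b c) s fun t s' => ∃ φ', I φ' s' ∧ ¬ b.holds s' ∧ t + φ' ≤ φ + b.cost + 1 := by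
  induction φ using Nat.strong_induction_on generalizing s with
  | _ φ ih =>
    by_cases hb : b.holds s
    · obtain ⟨t, s', h1, φ', h2, h3⟩ := h φ s hI hb
      obtain ⟨t', s'', h4, φ'', h5, h6, h7⟩ := ih φ' (by omega) s' h2
      exact ⟨_, s'', .while_true hb h1 h4, φ'', h5, h6, by omega⟩
    · exact ⟨_, s, .while_false hb, φ, hI, hb, by omega⟩

/-- The sequential composition of a list of programs. -/
def block : List Cmd → Cmd
  | [] => .skip
  | c :: l => .seq c (block l)

def LoopFree : Cmd → Prop
  | .skip => True
  | .assign _ _ => True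
  | .write _ _ _ => True
  | .seq c d => LoopFree c ∧ LoopFree d
  | .ite _ c d => LoopFree c ∧ LoopFree d
  | .while _ _ => False

/-- An upper bound for the running time of a loop-free program. -/
def timeBound : Cmd → ℕ
  | .skip => 1
  | .assign _ e => e.cost + 1
  | .write _ i e => i.cost + e.cost + 1
  | .seq c d => timeBound c + timeBound d
  | .ite b c d => b.cost + 1 + max (timeBound c) (timeBound d)
  | .while _ _ => 0

open Classical in
/-- The final memory of a loop-free program. -/
noncomputable def result : Cmd → Store → Store
  | .skip, s => s
  | .assign x e, s => s.setVar x (e.eval s)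
  | .write A i e, s => s.setArr A (i.eval s) (e.eval s)
  | .seq c d, s => result d (result c s)
  | .ite b c d, s => if b.holds s then result c s else result d s
  | .while _ _, s => s

/-- Without loops, termination is automatic and the final memory can be computed as a function. Only
loops need an invariant and a potential. -/
lemma runs_of_loopFree (c : Cmd) (hc : LoopFree c) (s : Store) :
    Runs c s fun t s' => t ≤ timeBound c ∧ s' = result c s := by
  induction c generalizing s with
  | skip => exact ⟨1, s, .skip s, le_rfl, rfl⟩
  | assign x e => exact ⟨_, _, .assign s x e, le_rfl, rfl⟩
  | write A i e => exact ⟨_, _, .write s A i e, le_rfl, rfl⟩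
  | seq c d ihc ihd =>
    obtain ⟨t, s', h1, h2, rfl⟩ := ihc hc.1 s
    obtain ⟨t', s'', h3, h4, rfl⟩ := ihd hc.2 (result c s)
    exact ⟨_, _, .seq h1 h3, add_le_add h2 h4, rfl⟩
  | ite b c d ihc ihd =>
    by_cases hb : b.holds s
    · obtain ⟨t, s', h1, h2, rfl⟩ := ihc hc.1 s
      refine ⟨_, _, .ite_true hb h1, ?_, by simp [result, hb]⟩
      simp only [timeBound]
      omega
    · obtain ⟨t, s', h1, h2, rfl⟩ := ihd hc.2 s
      refine ⟨_, _, .ite_false hb h1, ?_, by simp [result, hb]⟩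
      simp only [timeBound]
      omega
  | _ => exact hc.elim

end Runs

end TreeDrawing

namespace TreeDrawing

open RAM

/-! ### Doubly linked lists -/

/-- The arrays `nxt` and `prv` hold the list `L` as a doubly linked list. -/
def Linked (nxt prv : ℕ → ℕ) (L : List ℕ) : Prop :=
  L.IsChain fun a b => nxt a = b ∧ prv b = a

/-- Together with the next lemma this isolates what an insertion between `u` and `w` overwrites: `u`
never occurs as the left member of a pair in the part ending with `u`, and `w` never as the right
member in the part starting with `w`, so changing `nxt u` and `prv w` does no harm. -/
lemma isChain_imp_left {α : Type*} {R S : α → α → Prop} {A : List α} {u : α}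
    (h : (A ++ [u]).IsChain R) (hRS : ∀ a ∈ A, ∀ b ∈ A ++ [u], R a b → S a b) :
    (A ++ [u]).IsChain S := by
  induction A with
  | nil => simp
  | cons a A ih =>
    cases A with
    | nil =>
      simp only [List.cons_append, List.nil_append, List.isChain_cons_cons] at h ⊢
      exact ⟨hRS a (by simp) u (by simp) h.1, by simp⟩
    | cons b A =>
      simp only [List.cons_append, List.isChain_cons_cons] at h ⊢
      refine ⟨hRS a (by simp) b (by simp) h.1, ?_⟩
      have := ih h.2 fun x hx y hy hxy => hRS x (by simp [hx]) y (by
        rw [List.cons_append]; exact List.mem_cons_of_mem _ hy) hxy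
      simpa using this

lemma isChain_imp_right {α : Type*} {R S : α → α → Prop} {w : α} {B : List α}
    (h : (w :: B).IsChain R) (hRS : ∀ a ∈ w :: B, ∀ b ∈ B, R a b → S a b) :
    (w :: B).IsChain S := by
  induction B generalizing w with
  | nil => simp
  | cons b B ih =>
    simp only [List.isChain_cons_cons] at h ⊢
    exact ⟨hRS w (by simp) b (by simp) h.1, ih h.2 fun x hx y hy hxy =>
      hRS x (List.mem_cons_of_mem _ hx) y (List.mem_cons_of_mem _ hy) hxy⟩

lemma Linked.eq {nxt prv : ℕ → ℕ} {A B : List ℕ} {u w : ℕ}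
    (h : Linked nxt prv (A ++ u :: w :: B)) : nxt u = w ∧ prv w = u := by
  have := (List.isChain_append.1 h).2.1
  rw [List.isChain_cons_cons] at this
  exact this.1

/-- Inserting `c` between `u` and `w`. -/
lemma Linked.insert {nxt prv : ℕ → ℕ} {A B : List ℕ} {u w c : ℕ}
    (h : Linked nxt prv (A ++ u :: w :: B)) (hnd : (A ++ u :: w :: B).Nodup)
    (hc : c ∉ A ++ u :: w :: B) :
    Linked (Function.update (Function.update nxt u c) c w)
      (Function.update (Function.update prv c u) w c) (A ++ u :: c :: w :: B) := by
  have e : A ++ u :: w :: B = (A ++ [u]) ++ (w :: B) := by simp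
  have e' : A ++ u :: c :: w :: B = (A ++ [u]) ++ (c :: w :: B) := by simp
  unfold Linked at *
  have h0 := h
  rw [e] at h hnd hc
  rw [List.isChain_append] at h
  have hd := List.disjoint_of_nodup_append hnd
  have hn1 := (List.nodup_append.1 hnd).1
  have hn2 := (List.nodup_append.1 hnd).2.1
  have huA : u ∉ A := fun hu => List.disjoint_of_nodup_append hn1 hu (by simp)
  have hwB : w ∉ B := (List.nodup_cons.1 hn2).1
  have hcm : c ∉ A ++ [u] ∧ c ∉ w :: B := by
    rwa [List.mem_append, not_or] at hc
  have huc : u ≠ c := fun hh => hcm.1 (by simp [hh])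
  have hwc : w ≠ c := fun hh => hcm.2 (by simp [hh])
  rw [e', List.isChain_append]
  refine ⟨?_, ?_, ?_⟩
  · refine isChain_imp_left h.1 ?_
    intro a ha b hb hab
    have h1 : a ≠ u := fun hh => huA (hh ▸ ha)
    have h2 : a ≠ c := fun hh => hcm.1 (hh ▸ List.mem_append_left _ ha)
    have h3 : b ≠ c := fun hh => hcm.1 (hh ▸ hb)
    have h4 : b ≠ w := fun hh => hd hb (by simp [hh])
    simpa [Function.update_apply, h1, h2, h3, h4] using hab
  · rw [List.isChain_cons_cons]
    refine ⟨by simp, isChain_imp_right h.2.1 ?_⟩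
    intro a ha b hb hab
    have h1 : a ≠ u := fun hh => hd (List.mem_append_right _ (by simp [hh])) ha
    have h2 : a ≠ c := fun hh => hcm.2 (hh ▸ ha)
    have h3 : b ≠ c := fun hh => hcm.2 (hh ▸ List.mem_cons_of_mem _ hb)
    have h4 : b ≠ w := fun hh => hwB (hh ▸ hb)
    simpa [Function.update_apply, h1, h2, h3, h4] using hab
  · intro x hx y hy
    simp only [List.getLast?_append, List.getLast?_singleton, Option.some_or, Option.mem_def,
      Option.some.injEq, List.head?_cons] at hx hy
    subst hx hy
    simp [huc, hwc.symm]

/-- The list of vertices between the sentinels `n` and `n + 1`. -/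
def guarded {n : ℕ} (xs : List (Fin n)) : List ℕ :=
  n :: ((xs.map fun v : Fin n => (v : ℕ)) ++ [n + 1])

lemma mem_guarded {n : ℕ} {xs : List (Fin n)} {v : Fin n} : (v : ℕ) ∈ guarded xs ↔ v ∈ xs := by
  have h1 := v.2.ne
  have h2 : (v : ℕ) ≠ n + 1 := by omega
  simp [guarded, h1, h2, Fin.val_inj]

lemma nodup_guarded {n : ℕ} {xs : List (Fin n)} (h : xs.Nodup) : (guarded xs).Nodup := by
  have h1 : ((xs.map fun v : Fin n => (v : ℕ)) ++ [n + 1]).Nodup := by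
    rw [List.nodup_append]
    refine ⟨h.map Fin.val_injective, by simp, ?_⟩
    rintro a ha b hb rfl
    simp only [List.mem_map] at ha
    obtain ⟨v, -, rfl⟩ := ha
    have := v.2
    simp only [List.mem_singleton] at hb
    omega
  refine List.nodup_cons.2 ⟨?_, h1⟩
  intro hmem
  simp only [List.mem_append, List.mem_map, List.mem_singleton] at hmem
  rcases hmem with ⟨v, -, hv⟩ | hv
  · have := v.2; omega
  · omega

/-- Inserting `c` beside `v`: the element `u` after which it is inserted, and the new list. -/
lemma exists_guarded_eq {n : ℕ} {after : Prop} [Decidable after] {v c : Fin n}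
    {xs xs' : List (Fin n)} (h : InsertBeside after v c xs xs') :
    ∃ A u w B, guarded xs = A ++ u :: w :: B ∧ guarded xs' = A ++ u :: (c : ℕ) :: w :: B ∧
      ((after ∧ u = v) ∨ (¬ after ∧ w = v)) := by
  obtain ⟨l₁, l₂, rfl, rfl⟩ := h
  by_cases ha : after
  -- The sentinels ensure that `w` exists even if `v` is last, and `u` even if `v` is first.
  · obtain ⟨w, B, hw⟩ : ∃ w B, (l₂.map fun v : Fin n => (v : ℕ)) ++ [n + 1] = w :: B :=
      List.exists_cons_of_ne_nil (by simp)
    refine ⟨n :: l₁.map fun v : Fin n => (v : ℕ), v, w, B, ?_, ?_, Or.inl ⟨ha, rfl⟩⟩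
    · rw [← hw]; simp [guarded]
    · rw [← hw]; simp [guarded, ha]
  · obtain ⟨A, u, hu⟩ : ∃ A u, (n :: l₁.map fun v : Fin n => (v : ℕ)) = A ++ [u] :=
      ⟨_, _, (List.dropLast_append_getLast (List.cons_ne_nil _ _)).symm⟩
    have h1 : ∀ l : List (Fin n), guarded (l₁ ++ l) =
        A ++ u :: ((l.map fun v : Fin n => (v : ℕ)) ++ [n + 1]) := by
      intro l
      rw [← List.singleton_append (x := u), ← List.append_assoc, ← hu]
      simp [guarded]
    exact ⟨A, u, v, (l₂.map fun v : Fin n => (v : ℕ)) ++ [n + 1], by rw [h1]; simp,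
      by rw [h1]; simp [ha], Or.inr ⟨ha, rfl⟩⟩

/-! ### The program

Variables: `0` number of vertices, `1` and `2` head and tail of the queue, `3` the vertex `v`
that is being expanded, `4` the slot of its parent, `5` the current slot, `6` the current port, `7` the
neighbour to be attached, `8` and `9` the range of slots of `v`, `10` the previous direction, `11`
and `12` neighbours in a linked list, `13` the quadrant and `14` the port of the new vertex, `15`
the parent of `v`, `16` the slot where the clockwise traversal ends.

Arrays: `5`, `6` and `7`, `8` the linked lists of the x- and y-order, `9` the queue, `10` the ports
of the vertices towards their parents, `11` the parents. -/

section Program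

open Cmd Expr Test

/-- Insert vertex `7` into the linked list after (if `b` holds) or before vertex `3`. -/
def insertCmd (b : Test) (A B : ℕ) : Cmd := block [
  ite b (assign 11 (var 3)) (assign 11 (read B (var 3))),
  assign 12 (read A (var 11)),
  write A (var 11) (var 7),
  write A (var 7) (var 12),
  write B (var 7) (var 11),
  write B (var 12) (var 7)]

/-- Place vertex `7` beside vertex `3` in quadrant `13`, and append it to the queue. -/
def attachCmd : Cmd := block [
  insertCmd (and (lt (const 0) (var 13)) (lt (var 13) (const 3))) 5 6,
  insertCmd (lt (var 13) (const 2)) 7 8,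
  write 10 (var 7) (var 14),
  write 11 (var 7) (var 3),
  write 9 (var 2) (var 7),
  assign 2 (succ (var 2))]

/-- Move to the previous slot. -/
def backCmd : Cmd := ite (eq (var 5) (var 8)) (assign 5 (pred (var 9))) (assign 5 (pred (var 5)))

/-- Move to the next slot. -/
def forwardCmd : Cmd := block [
  assign 5 (succ (var 5)),
  ite (eq (var 5) (var 9)) (assign 5 (var 8)) skip]

/-- The next port counterclockwise. -/
def prevPortCmd (x y : ℕ) : Cmd :=
  ite (eq (var y) (const 0)) (assign x (const 3)) (assign x (pred (var y)))

/-- The next port clockwise. -/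
def nextPortCmd (x y : ℕ) : Cmd :=
  ite (eq (var y) (const 3)) (assign x (const 0)) (assign x (succ (var y)))

def firstStepCmd : Cmd := block [
  assign 7 (read 1 (var 5)),
  prevPortCmd 13 6,
  nextPortCmd 14 6,
  attachCmd,
  backCmd]

def lastStepCmd : Cmd := block [
  assign 10 (read 2 (var 5)),
  forwardCmd,
  ite (eq (read 2 (var 5)) (var 10)) skip (nextPortCmd 6 6),
  assign 7 (read 1 (var 5)),
  assign 13 (var 6),
  prevPortCmd 14 6,
  attachCmd]

def loadCmd : Cmd := block [
  assign 3 (read 9 (var 1)),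
  assign 15 (read 11 (var 3)),
  assign 6 (read 10 (var 3)),
  assign 8 (read 0 (var 3)),
  assign 9 (read 0 (succ (var 3))),
  assign 4 (var 8)]

/-- The scan may pass over all neighbours of the vertex. This is affordable, because all of them but
the parent are about to be attached. -/
def findCmd : Cmd := .while (not (eq (read 1 (var 4)) (var 15))) (assign 4 (succ (var 4)))

def turnBackCmd : Cmd := block [assign 5 (var 4), backCmd]

/-- The comparison with the parent's slot is needed when all edges have the same direction;
otherwise the traversal would not stop there. -/
def firstLoopCmd : Cmd :=
  .while (and (not (eq (var 5) (var 4))) (eq (read 2 (var 5)) (read 2 (var 4)))) firstStepCmd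

def turnForwardCmd : Cmd := block [assign 16 (var 5), assign 5 (var 4)]

/-- A round moves forward before it attaches, so the neighbour in slot `16` is still attached. If
slot `16` is that of the parent, nothing is left and no round takes place. -/
def lastLoopCmd : Cmd := .while (not (eq (var 5) (var 16))) lastStepCmd

def expandCmd : Cmd :=
  seq loadCmd (seq findCmd (seq turnBackCmd (seq firstLoopCmd (seq turnForwardCmd
    (seq lastLoopCmd (assign 1 (succ (var 1))))))))

/-- Start with the edge at slot `0`. -/
def initCmd : Cmd := block [
  assign 7 (read 1 (const 0)),
  write 5 (var 0) (const 0), write 6 (const 0) (var 0),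
  write 5 (const 0) (var 7), write 6 (var 7) (const 0),
  write 5 (var 7) (succ (var 0)), write 6 (succ (var 0)) (var 7),
  write 7 (var 0) (const 0), write 8 (const 0) (var 0),
  write 7 (const 0) (var 7), write 8 (var 7) (const 0),
  write 7 (var 7) (succ (var 0)), write 8 (succ (var 0)) (var 7),
  ite (eq (read 2 (const 0)) (const 1))
    (block [write 10 (const 0) (const 1), write 10 (var 7) (const 0)])
    (block [write 10 (const 0) (const 2), write 10 (var 7) (const 3)]),
  write 11 (const 0) (var 7), write 11 (var 7) (const 0),
  write 9 (const 0) (const 0), write 9 (const 1) (var 7),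
  assign 1 (const 0), assign 2 (const 2)]

/-- Store in array `O` the positions of the vertices in the linked list `A`. -/
def startOutputCmd (A : ℕ) : Cmd := block [assign 11 (read A (var 0)), assign 5 (const 0)]

def outputStepCmd (A O : ℕ) : Cmd := block [
  write O (var 11) (var 5),
  assign 11 (read A (var 11)),
  assign 5 (succ (var 5))]

def outputCmd (A O : ℕ) : Cmd :=
  seq (startOutputCmd A) (.while (lt (var 5) (var 0)) (outputStepCmd A O))

/-- A single vertex has no slots. The output arrays are zero from the start and place it at the
origin. -/
def mainCmd : Cmd :=
  ite (lt (const 1) (var 0))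
    (seq initCmd (seq (.while (lt (var 1) (var 2)) expandCmd)
      (seq (outputCmd 5 3) (outputCmd 7 4))))
    skip

end Program

end TreeDrawing

namespace TreeDrawing

open RAM

/-! ### Correctness of the program -/

variable {n : ℕ} {T : EmbeddedDigraph (Fin n)} {s : Store} {xs ys xs' ys' qs : List (Fin n)}
  {G : Fin n → Fin 4 → List (Fin n)}

lemma insertCmd_spec {b : Test} {A B : ℕ} (hAB : A ≠ B) {v c : Fin n} {after : Prop}
    [Decidable after] (hv : s.var 3 = v) (hc : s.var 7 = c) (hb : b.holds s ↔ after)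
    (hins : InsertBeside after v c xs xs') (hnd : xs.Nodup) (hcx : c ∉ xs)
    (hl : Linked (s.arr A) (s.arr B) (guarded xs)) :
    Linked ((result (insertCmd b A B) s).arr A) ((result (insertCmd b A B) s).arr B)
      (guarded xs') ∧
    (∀ x, x ≠ 11 → x ≠ 12 → (result (insertCmd b A B) s).var x = s.var x) ∧
    ∀ D, D ≠ A → D ≠ B → (result (insertCmd b A B) s).arr D = s.arr D := by
  obtain ⟨L, u, w, R, h1, h2, h3⟩ := exists_guarded_eq hins
  rw [h1] at hl
  have hins' := hl.insert (c := c) (by rw [← h1]; exact nodup_guarded hnd)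
    (by rw [← h1, mem_guarded]; exact hcx)
  have hu := hl.eq
  -- Either way the program finds the predecessor `u` of the new element: it is `v` itself, or it is
  -- read off as the predecessor of `v`.
  have hcu₁ : b.holds s → s.var 3 = u := fun h => by
    rw [hv, ((or_iff_left fun h' => h'.1 (hb.1 h)).1 h3).2]
  have hcu₂ : ¬ b.holds s → s.arr B (s.var 3) = u := fun h => by
    rw [hv, ← ((or_iff_right fun h' => h (hb.2 h'.1)).1 h3).2, hu.2]
  have e : result (insertCmd b A B) s =
      ⟨Function.update (Function.update s.var 11 u) 12 w,
        Function.update (Function.update s.arr A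
          (Function.update (Function.update (s.arr A) u c) c w)) B
          (Function.update (Function.update (s.arr B) c u) w c)⟩ := by
    by_cases hbs : b.holds s
    · have hcu := hcu₁ hbs
      simp [insertCmd, block, result, hbs, Expr.eval, Store.setVar, Store.setArr, hcu, hc, hu.1,
        hAB.symm, Function.update_idem, Function.update_of_ne]
    · have hcu := hcu₂ hbs
      simp [insertCmd, block, result, hbs, Expr.eval, Store.setVar, Store.setArr, hcu, hc, hu.1,
        hAB.symm, Function.update_idem, Function.update_of_ne]
  rw [e, h2]
  refine ⟨?_, ?_, ?_⟩
  · simpa [hAB] using hins'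
  · intro x h11 h12
    simp [h11, h12]
  · intro D hA hB
    simp [hA, hB]

lemma right_iff (Q : Fin 4) : 0 < (Q : ℕ) ∧ (Q : ℕ) < 3 ↔ Q = 1 ∨ Q = 2 := by revert Q; decide

lemma upper_iff (Q : Fin 4) : (Q : ℕ) < 2 ↔ Q = 0 ∨ Q = 1 := by revert Q; decide

lemma attachCmd_spec {v c : Fin n} {Q q' : Fin 4} (hv : s.var 3 = v) (hc : s.var 7 = c)
    (hQ : s.var 13 = Q) (hq' : s.var 14 = q')
    (hx : InsertBeside (Q = 1 ∨ Q = 2) v c xs xs') (hy : InsertBeside (Q = 0 ∨ Q = 1) v c ys ys')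
    (hxs : xs.Nodup) (hys : ys.Nodup) (hcx : c ∉ xs) (hcy : c ∉ ys)
    (hlx : Linked (s.arr 5) (s.arr 6) (guarded xs))
    (hly : Linked (s.arr 7) (s.arr 8) (guarded ys)) :
    ∃ s', s' = result attachCmd s ∧ Linked (s'.arr 5) (s'.arr 6) (guarded xs') ∧
      Linked (s'.arr 7) (s'.arr 8) (guarded ys') ∧
      s'.arr 9 = Function.update (s.arr 9) (s.var 2) c ∧
      s'.arr 10 = Function.update (s.arr 10) c q' ∧
      s'.arr 11 = Function.update (s.arr 11) c v ∧
      s'.var 2 = s.var 2 + 1 ∧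
      (∀ x, x ≠ 2 → x ≠ 11 → x ≠ 12 → s'.var x = s.var x) ∧
      ∀ D, D < 5 → s'.arr D = s.arr D := by
  refine ⟨_, rfl, ?_⟩
  set b₁ : Test := .and (.lt (.const 0) (.var 13)) (.lt (.var 13) (.const 3)) with hb₁
  set b₂ : Test := .lt (.var 13) (.const 2) with hb₂
  obtain ⟨h1, h2, h3⟩ := insertCmd_spec (b := b₁) (A := 5) (B := 6) (by decide) hv hc
    (by rw [hb₁]; simp only [Test.holds, Expr.eval, hQ]; exact right_iff Q)
    hx hxs hcx hlx
  set s₁ := result (insertCmd b₁ 5 6) s with hs₁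
  obtain ⟨k1, k2, k3⟩ := insertCmd_spec (s := s₁) (b := b₂) (A := 7) (B := 8) (by decide)
    (by rw [h2 3 (by decide) (by decide), hv]) (by rw [h2 7 (by decide) (by decide), hc])
    (by
      rw [hb₂]
      simp only [Test.holds, Expr.eval, h2 13 (by decide) (by decide), hQ]
      exact upper_iff Q)
    hy hys hcy (by rwa [h3 7 (by decide) (by decide), h3 8 (by decide) (by decide)])
  set s₂ := result (insertCmd b₂ 7 8) s₁ with hs₂
  have e : result attachCmd s = result (block [
      .write 10 (.var 7) (.var 14), .write 11 (.var 7) (.var 3), .write 9 (.var 2) (.var 7),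
      .assign 2 (.succ (.var 2))]) s₂ := rfl
  have hvar : ∀ x, x ≠ 11 → x ≠ 12 → s₂.var x = s.var x := fun x hx1 hx2 => by
    rw [k2 x hx1 hx2, h2 x hx1 hx2]
  have harr : ∀ D, D ≠ 5 → D ≠ 6 → D ≠ 7 → D ≠ 8 → s₂.arr D = s.arr D :=
    fun D d1 d2 d3 d4 => by rw [k3 D d3 d4, h3 D d1 d2]
  have v2 := hvar 2 (by decide) (by decide)
  have v3 := hvar 3 (by decide) (by decide)
  have v7 := hvar 7 (by decide) (by decide)
  have v14 := hvar 14 (by decide) (by decide)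
  have e2 : result attachCmd s = ⟨Function.update s₂.var 2 (s.var 2 + 1),
      Function.update (Function.update (Function.update s₂.arr 10
        (Function.update (s.arr 10) c q')) 11 (Function.update (s.arr 11) c v)) 9
        (Function.update (s.arr 9) (s.var 2) c)⟩ := by
    rw [e]
    simp [block, result, Expr.eval, Store.setVar, Store.setArr, v2, v3, v7, v14, hv, hc, hq',
      harr]
  rw [e2]
  refine ⟨?_, ?_, ?_, ?_, ?_, ?_, ?_, ?_⟩
  · simpa [k3] using h1
  · simpa using k1
  · simp
  · simp
  · simp
  · simp
  · intro x hx1 hx2 hx3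
    simp [hx1, hvar x hx2 hx3]
  · intro D hD
    have : D ≠ 9 ∧ D ≠ 10 ∧ D ≠ 11 := by omega
    simp [this, harr D (by omega) (by omega) (by omega) (by omega)]

end TreeDrawing

/-! ### The memory during the construction. -/

namespace TreeDrawing

open RAM

variable {n : ℕ} {T : EmbeddedDigraph (Fin n)} {s s' : Store} {xs ys xs' ys' qs : List (Fin n)}
  {G : Fin n → Fin 4 → List (Fin n)} {lo hi : ℕ}

/-- The memory holds a drawing given by the lists `xs` and `ys`, and the list `qs` of its vertices;
those before position `lo` are finished, and those from position `hi` on have no drawn neighbour but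
their parent. -/
structure Inv (T : EmbeddedDigraph (Fin n)) (s : Store) (lo hi : ℕ) (xs ys qs : List (Fin n))
    (G : Fin n → Fin 4 → List (Fin n)) : Prop where
  var_zero : s.var 0 = n
  var_one : s.var 1 = lo
  var_two : s.var 2 = qs.length
  input : ∀ D < 3, s.arr D = T.inputStore.arr D
  placed : Placed T xs ys G
  linkx : Linked (s.arr 5) (s.arr 6) (guarded xs)
  linky : Linked (s.arr 7) (s.arr 8) (guarded ys)
  nodup : qs.Nodup
  mem_iff : ∀ a, a ∈ qs ↔ a ∈ xs
  queue : ∀ i (h : i < qs.length), s.arr 9 i = (qs[i] : ℕ)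
  done : ∀ i (h : i < qs.length), i < lo → Complete T G qs[i]
  todo : ∀ i (h : i < qs.length), hi ≤ i → ∃ r d, Fresh G qs[i] r d ∧
    s.arr 10 (qs[i] : ℕ) = (d : ℕ) ∧ s.arr 11 (qs[i] : ℕ) = (r : ℕ)

lemma Inv.congr (h : Inv T s lo hi xs ys qs G) (h0 : s'.var 0 = s.var 0)
    (h1 : s'.var 1 = s.var 1) (h2 : s'.var 2 = s.var 2) (ha : s'.arr = s.arr) :
    Inv T s' lo hi xs ys qs G := by
  refine ⟨?_, ?_, ?_, ?_, h.placed, ?_, ?_, h.nodup, h.mem_iff, ?_, h.done, ?_⟩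
  · rw [h0, h.var_zero]
  · rw [h1, h.var_one]
  · rw [h2, h.var_two]
  · rw [ha]; exact h.input
  · rw [ha]; exact h.linkx
  · rw [ha]; exact h.linky
  · rw [ha]; exact h.queue
  · rw [ha]; exact h.todo

lemma Inv.setVar (h : Inv T s lo hi xs ys qs G) {x : ℕ} (hx : 3 ≤ x) (a : ℕ) :
    Inv T (s.setVar x a) lo hi xs ys qs G := by
  have h0 : 0 ≠ x := by omega
  have h1 : 1 ≠ x := by omega
  have h2 : 2 ≠ x := by omega
  exact h.congr (by simp [Store.setVar, h0]) (by simp [Store.setVar, h1])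
    (by simp [Store.setVar, h2]) rfl

lemma Inv.lt_length (h : Inv T s lo hi xs ys qs G) : qs.length ≤ n := by
  simpa using h.nodup.length_le_card

/-- During an expansion `hi` is `lo + 1`: the vertex at position `lo` is in general neither finished
nor fresh. All other queue entries differ from `v` and `c` and keep their lists and their recorded
parents; `c` joins the queue as a fresh vertex. -/
lemma Inv.attach {v c : Fin n} (h : Inv T s lo (lo + 1) xs ys qs G) (hlo : lo < qs.length)
    (hqv : qs[lo] = v) {Q q q' : Fin 4} {L : List (Fin n)}
    (hv : s.var 3 = v) (hc : s.var 7 = c) (hQ : s.var 13 = Q) (hq' : s.var 14 = q')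
    (hx : InsertBeside (Q = 1 ∨ Q = 2) v c xs xs') (hy : InsertBeside (Q = 0 ∨ Q = 1) v c ys ys')
    (hcx : c ∉ xs) (hp : Placed T xs' ys' (TreeDrawing.attach G v q L c q')) :
    Inv T (result attachCmd s) lo (lo + 1) xs' ys' (qs ++ [c]) (TreeDrawing.attach G v q L c q') ∧
      ∀ x, 3 ≤ x → x ≠ 11 → x ≠ 12 → (result attachCmd s).var x = s.var x := by
  have hcq : c ∉ qs := fun hh => hcx ((h.mem_iff c).1 hh)
  obtain ⟨s', rfl, h1, h2, h3, h4, h5, h6, h7, h8⟩ := attachCmd_spec hv hc hQ hq' hx hy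
    h.placed.nodup_x h.placed.nodup_y hcx (fun hh => hcx ((h.placed.mem_iff c).1 hh)) h.linkx h.linky
  refine ⟨⟨?_, ?_, ?_, ?_, hp, h1, h2, ?_, ?_, ?_, ?_, ?_⟩, fun x hx1 => h7 x (by omega)⟩
  · rw [h7 0 (by decide) (by decide) (by decide), h.var_zero]
  · rw [h7 1 (by decide) (by decide) (by decide), h.var_one]
  · rw [h6, h.var_two]; simp
  · intro D hD
    rw [h8 D (by omega), h.input D hD]
  · rw [List.nodup_append]
    exact ⟨h.nodup, by simp, by rintro a ha b hb rfl; exact hcq (List.mem_singleton.1 hb ▸ ha)⟩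
  · intro a
    rw [hx.mem_iff, List.mem_append, h.mem_iff, List.mem_singleton, or_comm]
  · intro i hi
    rw [h3, h.var_two]
    rw [List.length_append, List.length_singleton] at hi
    rcases Nat.lt_succ_iff_lt_or_eq.1 hi with hi' | rfl
    · rw [Function.update_of_ne hi'.ne, h.queue i hi', List.getElem_append_left hi']
    · simp
  · intro i hi hilo
    have hi' : i < qs.length := by omega
    have hmem : qs[i] ∈ qs := List.getElem_mem hi'
    rw [List.getElem_append_left hi', Complete, attach_of_ne]
    · exact h.done i hi' hilo
    · rw [← hqv]
      intro e
      rw [h.nodup.getElem_inj_iff] at e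
      omega
    · exact fun e => hcq (e ▸ hmem)
  · intro i hi hilo
    rw [List.length_append, List.length_singleton] at hi
    rcases Nat.lt_succ_iff_lt_or_eq.1 hi with hi' | rfl
    · have hmem : qs[i] ∈ qs := List.getElem_mem hi'
      have hne : qs[i] ≠ c := fun e => hcq (e ▸ hmem)
      have hne' : (qs[i] : ℕ) ≠ c := fun e => hne (Fin.ext e)
      obtain ⟨r, d, h9, h10, h11⟩ := h.todo i hi' hilo
      rw [List.getElem_append_left hi']
      refine ⟨r, d, ?_, ?_, ?_⟩
      · rw [Fresh, attach_of_ne _ hne]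
        · exact h9
        · rw [← hqv]
          intro e
          rw [h.nodup.getElem_inj_iff] at e
          omega
      · rw [h4, Function.update_of_ne hne', h10]
      · rw [h5, Function.update_of_ne hne', h11]
    · refine ⟨v, q', ?_, ?_, ?_⟩
      · simpa using fresh_attach
      · rw [h4]; simp
      · rw [h5]; simp

/-! ### Slots -/

lemma succ_mod_eq {D : ℕ} (hD : 0 < D) (m : ℕ) :
    (m + 1) % D = if m % D + 1 = D then 0 else m % D + 1 := by
  have h1 := Nat.mod_lt m hD
  rw [← Nat.mod_add_mod]
  split_ifs with h
  · rw [h, Nat.mod_self]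
  · exact Nat.mod_eq_of_lt (by omega)

lemma add_mod_inj {D j t t' : ℕ} (ht : t < D) (ht' : t' < D) (h : (j + t) % D = (j + t') % D) :
    t = t' := by
  have h1 : j + t ≡ j + t' [MOD D] := h
  have h2 : t % D = t' % D := Nat.ModEq.add_left_cancel' j h1
  rwa [Nat.mod_eq_of_lt ht, Nat.mod_eq_of_lt ht'] at h2

/-- The slot `t` places after the slot number `j` in the adjacency list of `v`. -/
noncomputable def slot (T : EmbeddedDigraph (Fin n)) (v : Fin n) (j t : ℕ) : ℕ :=
  offset T v + (j + t) % (T.rot v).length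

/-- Rotated so that the parent comes first, the adjacency list turns cyclic distance from the parent
into list position. -/
lemma inputStore_slot {v c : Fin n} {j : ℕ} {A B : List (Fin n)}
    (h : (T.rot v).rotate j = A ++ c :: B) :
    T.inputStore.arr 1 (slot T v j A.length) = (c : ℕ) ∧
      (T.inputStore.arr 2 (slot T v j A.length) = 1 ↔ T.Adj v c) ∧
      (T.inputStore.arr 2 (slot T v j A.length) = 0 ↔ ¬ T.Adj v c) := by
  have hlen : (T.rot v).length = A.length + (B.length + 1) := by
    rw [← List.length_rotate (T.rot v) j, h]; simp
  have hlt : (j + A.length) % (T.rot v).length < (T.rot v).length := Nat.mod_lt _ (by omega)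
  have hc : (T.rot v)[(j + A.length) % (T.rot v).length] = c := by
    have h1 : ((T.rot v).rotate j)[A.length]'(by rw [List.length_rotate]; omega) = c := by
      simp [h]
    rw [List.getElem_rotate] at h1
    simpa [add_comm] using h1
  rw [slot, inputStore_nbr T v hlt, inputStore_dir T v hlt, hc]
  by_cases hadj : T.Adj v c <;> simp [hadj]

/-- The variables that describe the vertex to be expanded and the slot of its parent. -/
structure Ctx (T : EmbeddedDigraph (Fin n)) (s : Store) (v : Fin n) (j : ℕ) : Prop where
  var_three : s.var 3 = v
  var_four : s.var 4 = slot T v j 0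
  var_eight : s.var 8 = offset T v
  var_nine : s.var 9 = offset T v + (T.rot v).length

lemma Ctx.congr {v : Fin n} {j : ℕ} (h : Ctx T s v j) (h3 : s'.var 3 = s.var 3)
    (h4 : s'.var 4 = s.var 4) (h8 : s'.var 8 = s.var 8) (h9 : s'.var 9 = s.var 9) :
    Ctx T s' v j :=
  ⟨h3.trans h.var_three, h4.trans h.var_four, h8.trans h.var_eight, h9.trans h.var_nine⟩

lemma backCmd_result {v : Fin n} {j t : ℕ} (h : Ctx T s v j) (hD : 0 < (T.rot v).length)
    (h5 : s.var 5 = slot T v j (t + 1)) : result backCmd s = s.setVar 5 (slot T v j t) := by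
  have hm := succ_mod_eq hD (j + t)
  have hlt := Nat.mod_lt (j + t) hD
  have e : slot T v j (t + 1) = offset T v + (j + t + 1) % (T.rot v).length := rfl
  rw [e, hm] at h5
  by_cases hc : s.var 5 = s.var 8
  · have : result backCmd s = s.setVar 5 (s.var 9 - 1) := by
      simp [backCmd, result, Test.holds, Expr.eval, hc]
    rw [this, h.var_nine, slot]
    rw [h5, h.var_eight] at hc
    split_ifs at hc
    · congr 1; omega
    · omega
  · have : result backCmd s = s.setVar 5 (s.var 5 - 1) := by
      simp [backCmd, result, Test.holds, Expr.eval, hc]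
    rw [this, slot, h5]
    rw [h5, h.var_eight] at hc
    split_ifs at hc ⊢
    · omega
    · congr 1

lemma forwardCmd_result {v : Fin n} {j t : ℕ} (h : Ctx T s v j) (hD : 0 < (T.rot v).length)
    (h5 : s.var 5 = slot T v j t) :
    result forwardCmd s = s.setVar 5 (slot T v j (t + 1)) := by
  have hm := succ_mod_eq hD (j + t)
  have hlt := Nat.mod_lt (j + t) hD
  have e : slot T v j (t + 1) = offset T v + (j + t + 1) % (T.rot v).length := rfl
  rw [e, hm]
  by_cases hc : s.var 5 + 1 = s.var 9
  · have : result forwardCmd s = s.setVar 5 (s.var 8) := by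
      simp [forwardCmd, block, result, Test.holds, Expr.eval, Store.setVar, hc]
    rw [this, h.var_eight, if_pos]
    · rfl
    · rw [h5, h.var_nine, slot] at hc
      omega
  · have : result forwardCmd s = s.setVar 5 (s.var 5 + 1) := by
      simp [forwardCmd, block, result, Test.holds, Expr.eval, Store.setVar, hc]
    rw [this, h5, if_neg]
    · rfl
    · rw [h5, h.var_nine, slot] at hc
      omega

lemma prevPortCmd_result {x y : ℕ} {d : Fin 4} (h : s.var y = d) :
    result (prevPortCmd x y) s = s.setVar x ((d + 3 : Fin 4) : ℕ) := by
  have key : ∀ d : Fin 4, ((d + 3 : Fin 4) : ℕ) = if (d : ℕ) = 0 then 3 else (d : ℕ) - 1 := by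
    decide
  rw [key]
  by_cases hd : (d : ℕ) = 0 <;> simp [prevPortCmd, result, Test.holds, Expr.eval, h, hd]

lemma nextPortCmd_result {x y : ℕ} {d : Fin 4} (h : s.var y = d) :
    result (nextPortCmd x y) s = s.setVar x ((d + 1 : Fin 4) : ℕ) := by
  have key : ∀ d : Fin 4, ((d + 1 : Fin 4) : ℕ) = if (d : ℕ) = 3 then 0 else (d : ℕ) + 1 := by
    decide
  rw [key]
  by_cases hd : (d : ℕ) = 3 <;> simp [nextPortCmd, result, Test.holds, Expr.eval, h, hd]

end TreeDrawing

/-! ### One round of each traversal around a vertex. -/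

namespace TreeDrawing

open RAM

variable {n : ℕ} {T : EmbeddedDigraph (Fin n)} {s s' : Store} {v r c : Fin n} {j lo N : ℕ}
  {d k : Fin 4} {m p p' suf : List (Fin n)}

/-- The state of the counterclockwise traversal of the neighbours of `v`: those in `suf` have been
attached, those in `m` have not. -/
structure FirstInv (T : EmbeddedDigraph (Fin n)) (s : Store) (v r : Fin n) (j lo N : ℕ) (d : Fin 4)
    (m suf : List (Fin n)) : Prop where
  ctx : Ctx T s v j
  var_five : s.var 5 = slot T v j m.length
  var_six : s.var 6 = d
  rotate : (T.rot v).rotate j = r :: (m ++ suf)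
  same : ∀ a ∈ suf, (T.Adj v a ↔ T.Adj v r)
  port : OutPort d ↔ T.Adj v r
  inv : ∃ xs ys qs G, Inv T s lo (lo + 1) xs ys qs G ∧ qs[lo]? = some v ∧
    Expanding G v r d 0 [] suf ∧ qs.length = N + suf.length

lemma rotated_of_rotate {l : List (Fin n)} (h : (T.rot v).rotate j = l) : l ~r T.rot v :=
  List.IsRotated.symm ⟨j, h⟩

theorem firstStep_spec (h : FirstInv T s v r j lo N d (m ++ [c]) suf) (hT : T.IsTree)
    (hc : T.Adj v c ↔ T.Adj v r) :
    FirstInv T (result firstStepCmd s) v r j lo N d m (c :: suf) := by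
  obtain ⟨xs, ys, qs, G, hI, hq, hE, hN⟩ := h.inv
  obtain ⟨hlo, hqv⟩ := List.getElem?_eq_some_iff.1 hq
  have hv : v ∈ xs := (hI.mem_iff v).1 (hqv ▸ List.getElem_mem hlo)
  have hrot := rotated_of_rotate h.rotate
  have hread : s.arr 1 (s.var 5) = c := by
    have := (inputStore_slot (T := T) (v := v) (j := j) (c := c) (A := r :: m) (B := suf)
      (by simp [h.rotate])).1
    rw [hI.input 1 (by decide), h.var_five]
    simpa using this
  obtain ⟨xs', hx⟩ := exists_insertBeside (d + 3 = 1 ∨ d + 3 = 2) c hv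
  obtain ⟨ys', hy⟩ := exists_insertBeside (d + 3 = 0 ∨ d + 3 = 1) c ((hI.placed.mem_iff v).2 hv)
  obtain ⟨hcx, hP, hE'⟩ := hI.placed.step_first hT hv hE (by simpa using hrot)
    (h.port.trans hc.symm) hx hy
  obtain ⟨s₁, hs₁⟩ : ∃ x, x = s.setVar 7 c := ⟨_, rfl⟩
  obtain ⟨s₂, hs₂⟩ : ∃ x, x = s₁.setVar 13 ((d + 3 : Fin 4) : ℕ) := ⟨_, rfl⟩
  obtain ⟨s₃, hs₃⟩ : ∃ x, x = s₂.setVar 14 ((d + 1 : Fin 4) : ℕ) := ⟨_, rfl⟩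
  have e1 : result (.assign 7 (.read 1 (.var 5))) s = s₁ := by
    simp [result, Expr.eval, hread, hs₁]
  have e2 : result (prevPortCmd 13 6) s₁ = s₂ := by
    rw [hs₂]
    exact prevPortCmd_result (by simp [hs₁, Store.setVar, h.var_six])
  have e3 : result (nextPortCmd 14 6) s₂ = s₃ := by
    rw [hs₃]
    exact nextPortCmd_result (by simp [hs₂, hs₁, Store.setVar, h.var_six])
  have e : result firstStepCmd s = result backCmd (result attachCmd s₃) := by
    rw [← e3, ← e2, ← e1]; rfl
  have hI₃ : Inv T s₃ lo (lo + 1) xs ys qs G := by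
    rw [hs₃, hs₂, hs₁]
    exact ((hI.setVar (by decide) _).setVar (by decide) _).setVar (by decide) _
  obtain ⟨hI₄, hvar⟩ := hI₃.attach hlo hqv (Q := d + 3) (q' := d + 1)
    (by simp [hs₃, hs₂, hs₁, Store.setVar, h.ctx.var_three]) (by simp [hs₃, hs₂, hs₁, Store.setVar])
    (by simp [hs₃, hs₂, Store.setVar]) (by simp [hs₃, Store.setVar]) hx hy hcx hP
  have hvar' : ∀ x, 3 ≤ x → x ≠ 7 → x ≠ 11 → x ≠ 12 → x ≠ 13 → x ≠ 14 →
      (result attachCmd s₃).var x = s.var x := by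
    intro x h1 h2 h3 h4 h5 h6
    rw [hvar x h1 h3 h4]
    simp [hs₃, hs₂, hs₁, Store.setVar, h2, h5, h6]
  have hctx : Ctx T (result attachCmd s₃) v j :=
    h.ctx.congr (by rw [hvar'] <;> decide) (by rw [hvar'] <;> decide) (by rw [hvar'] <;> decide)
      (by rw [hvar'] <;> decide)
  have hD : 0 < (T.rot v).length := by
    rw [← List.length_rotate (T.rot v) j, h.rotate]; simp
  rw [e, backCmd_result (t := m.length) hctx hD (by
    rw [hvar' 5 (by decide) (by decide) (by decide) (by decide) (by decide) (by decide),
      h.var_five]; simp)]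
  refine ⟨hctx.congr rfl rfl rfl rfl, by simp [Store.setVar], ?_, by simp [h.rotate], ?_, h.port,
    xs', ys', _, _, hI₄.setVar (by decide) _, ?_, hE', by simp [hN, add_assoc]⟩
  · change (result attachCmd s₃).var 6 = d
    rw [hvar' 6 (by decide) (by decide) (by decide) (by decide) (by decide) (by decide), h.var_six]
  · intro a ha
    rcases List.mem_cons.1 ha with rfl | ha
    · exact hc
    · exact h.same a ha
  · rw [List.getElem?_append_left hlo, hq]

/-- The state of the clockwise traversal of the neighbours of `v`: those in `suf` and `p` have been
attached, those in `p'` have not. -/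
structure LastInv (T : EmbeddedDigraph (Fin n)) (s : Store) (v r : Fin n) (j lo N : ℕ) (d : Fin 4)
    (p p' suf : List (Fin n)) : Prop where
  ctx : Ctx T s v j
  var_five : s.var 5 = slot T v j p.length
  var_sixteen : s.var 16 = slot T v j (p.length + p'.length)
  rotate : (T.rot v).rotate j = r :: (p ++ p' ++ suf)
  split : p ++ p' = [] ∨ ∃ m z, p ++ p' = m ++ [z] ∧ ¬ (T.Adj v z ↔ T.Adj v r)
  inv : ∃ xs ys qs G k, Inv T s lo (lo + 1) xs ys qs G ∧ qs[lo]? = some v ∧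
    Expanding G v r d k p suf ∧ PortAfter T v r d k p ∧ s.var 6 = (d + k : Fin 4) ∧
    qs.length = N + p.length + suf.length

/-- The port of the next neighbour `c`, computed from the stored directions. -/
lemma PortAfter.exists_next (hK : PortAfter T v r d k p) {a c : Fin n} {x y : ℕ}
    (hx : (x = 1 ↔ T.Adj v a) ∧ (x = 0 ↔ ¬ T.Adj v a))
    (hy : (y = 1 ↔ T.Adj v c) ∧ (y = 0 ↔ ¬ T.Adj v c)) (hport : OutPort (d + k) ↔ T.Adj v a)
    (h3 : countSteps (differ T v) (r :: (p ++ [c])) ≤ 3) :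
    ∃ k', k ≤ k' ∧ PortAfter T v r d k' (p ++ [c]) ∧ (OutPort (d + k') ↔ T.Adj v c) ∧
      k' = if y = x then k else k + 1 := by
  have hiff : y = x ↔ (OutPort (d + k) ↔ T.Adj v c) := by
    rw [hport]
    by_cases h1 : T.Adj v a <;> by_cases h2 : T.Adj v c
    · rw [hx.1.2 h1, hy.1.2 h2]; simp [h1, h2]
    · rw [hx.1.2 h1, hy.2.2 h2]; simp [h1, h2]
    · rw [hx.2.2 h1, hy.1.2 h2]; simp [h1, h2]
    · rw [hx.2.2 h1, hy.2.2 h2]; simp [h1, h2]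
  by_cases hc : OutPort (d + k) ↔ T.Adj v c
  · exact ⟨k, le_rfl, hK.same hc, hc, by rw [if_pos (hiff.2 hc)]⟩
  · obtain ⟨h5, h6, h7⟩ := hK.change hc h3
    exact ⟨k + 1, h5.le, h6, h7, by rw [if_neg fun hh => hc (hiff.1 hh)]⟩

lemma lastStep_result {t : ℕ} {k' : Fin 4} (hctx : Ctx T s v j) (hD : 0 < (T.rot v).length)
    (h5 : s.var 5 = slot T v j t) (h6 : s.var 6 = (d + k : Fin 4))
    (hc : T.inputStore.arr 1 (slot T v j (t + 1)) = (c : ℕ))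
    (harr1 : s.arr 1 = T.inputStore.arr 1) (harr2 : s.arr 2 = T.inputStore.arr 2)
    (hk' : k' = if T.inputStore.arr 2 (slot T v j (t + 1)) = T.inputStore.arr 2 (slot T v j t)
      then k else k + 1) :
    result lastStepCmd s = result attachCmd
      ((((((s.setVar 10 (T.inputStore.arr 2 (slot T v j t))).setVar 5 (slot T v j (t + 1))).setVar
        6 ((d + k' : Fin 4) : ℕ)).setVar 7 c).setVar 13 ((d + k' : Fin 4) : ℕ)).setVar
        14 ((d + k' + 3 : Fin 4) : ℕ)) := by
  obtain ⟨s₁, hs₁⟩ : ∃ x, x = s.setVar 10 (T.inputStore.arr 2 (slot T v j t)) := ⟨_, rfl⟩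
  obtain ⟨s₂, hs₂⟩ : ∃ x, x = s₁.setVar 5 (slot T v j (t + 1)) := ⟨_, rfl⟩
  obtain ⟨s₃, hs₃⟩ : ∃ x, x = s₂.setVar 6 ((d + k' : Fin 4) : ℕ) := ⟨_, rfl⟩
  obtain ⟨s₄, hs₄⟩ : ∃ x, x = s₃.setVar 7 c := ⟨_, rfl⟩
  obtain ⟨s₅, hs₅⟩ : ∃ x, x = s₄.setVar 13 ((d + k' : Fin 4) : ℕ) := ⟨_, rfl⟩
  obtain ⟨s₆, hs₆⟩ : ∃ x, x = s₅.setVar 14 ((d + k' + 3 : Fin 4) : ℕ) := ⟨_, rfl⟩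
  have e1 : result (.assign 10 (.read 2 (.var 5))) s = s₁ := by
    simp [result, Expr.eval, harr2, h5, hs₁]
  have e2 : result forwardCmd s₁ = s₂ := by
    rw [hs₂]
    refine forwardCmd_result (hctx.congr ?_ ?_ ?_ ?_) hD ?_ <;>
      simp [hs₁, Store.setVar, h5]
  have e3 : result (.ite (.eq (.read 2 (.var 5)) (.var 10)) .skip (nextPortCmd 6 6)) s₂ = s₃ := by
    have h26 : s₂.var 6 = (d + k : Fin 4) := by simp [hs₂, hs₁, Store.setVar, h6]
    have hcond : (Test.eq (.read 2 (.var 5)) (.var 10)).holds s₂ ↔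
        T.inputStore.arr 2 (slot T v j (t + 1)) =
          T.inputStore.arr 2 (slot T v j t) := by
      simp [Test.holds, Expr.eval, hs₂, hs₁, Store.setVar, harr2]
    by_cases hcc : T.inputStore.arr 2 (slot T v j (t + 1)) =
          T.inputStore.arr 2 (slot T v j t)
    · rw [if_pos hcc] at hk'
      rw [result, if_pos (hcond.2 hcc), result, hs₃, hk', ← h26]
      simp [Store.setVar]
    · rw [if_neg hcc] at hk'
      rw [result, if_neg (fun hh => hcc (hcond.1 hh)), nextPortCmd_result h26, hs₃, hk', add_assoc]
  have e4 : result (.assign 7 (.read 1 (.var 5))) s₃ = s₄ := by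
    have : s₃.arr 1 (s₃.var 5) = c := by
      simp [hs₃, hs₂, hs₁, Store.setVar, harr1, hc]
    simp [result, Expr.eval, this, hs₄]
  have e5 : result (.assign 13 (.var 6)) s₄ = s₅ := by
    simp [result, Expr.eval, hs₅, hs₄, hs₃, Store.setVar]
  have e6 : result (prevPortCmd 14 6) s₅ = s₆ := by
    rw [hs₆]
    exact prevPortCmd_result (by simp [hs₅, hs₄, hs₃, Store.setVar])
  rw [← hs₁, ← hs₂, ← hs₃, ← hs₄, ← hs₅, ← hs₆]
  rw [← e6, ← e5, ← e4, ← e3, ← e2, ← e1]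
  rfl

theorem lastStep_spec (h : LastInv T s v r j lo N d p (c :: p') suf) (hT : T.IsTree)
    (hmod : T.alternations v ≤ 4) :
    LastInv T (result lastStepCmd s) v r j lo N d (p ++ [c]) p' suf := by
  obtain ⟨xs, ys, qs, G, k, hI, hq, hE, hK, h6, hN⟩ := h.inv
  obtain ⟨hlo, hqv⟩ := List.getElem?_eq_some_iff.1 hq
  have hv : v ∈ xs := (hI.mem_iff v).1 (hqv ▸ List.getElem_mem hlo)
  have hrot := rotated_of_rotate h.rotate
  have hD : 0 < (T.rot v).length := by
    rw [← List.length_rotate (T.rot v) j, h.rotate]; simp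
  -- Here `a` is the neighbour preceding `c`, possibly the parent. The port `d + k` suits `a`, so
  -- comparing the stored directions of `a` and `c` decides whether to move on to the next port.
  obtain ⟨p₀, a, hpa, hport⟩ := hK.2
  have hp₀ : p₀.length = p.length := by
    have := congrArg List.length hpa
    simpa using this.symm
  have hreada := (inputStore_slot (T := T) (v := v) (j := j) (c := a) (A := p₀)
    (B := c :: p' ++ suf) (by
      rw [h.rotate, List.append_assoc, ← List.cons_append, hpa]; simp)).2
  have hreadc := inputStore_slot (T := T) (v := v) (j := j) (c := c) (A := r :: p)
    (B := p' ++ suf) (by simp [h.rotate])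
  rw [hp₀] at hreada
  rw [List.length_cons] at hreadc
  obtain ⟨k', hk, hK', hport', hk'⟩ := hK.exists_next hreada hreadc.2 hport
    (countSteps_le_three_of_split hmod hrot h.split rfl)
  obtain ⟨xs', hx⟩ := exists_insertBeside (d + k' = 1 ∨ d + k' = 2) c hv
  obtain ⟨ys', hy⟩ := exists_insertBeside (d + k' = 0 ∨ d + k' = 1) c ((hI.placed.mem_iff v).2 hv)
  obtain ⟨hcx, hP, hE'⟩ := hI.placed.step_last hT hv (hE.mono hk) (m := p')
    (by simpa using hrot) hport' hx hy
  obtain ⟨s₁, hs₁⟩ : ∃ x, x = s.setVar 10 (T.inputStore.arr 2 (slot T v j p.length)) := ⟨_, rfl⟩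
  obtain ⟨s₂, hs₂⟩ : ∃ x, x = s₁.setVar 5 (slot T v j (p.length + 1)) := ⟨_, rfl⟩
  obtain ⟨s₃, hs₃⟩ : ∃ x, x = s₂.setVar 6 ((d + k' : Fin 4) : ℕ) := ⟨_, rfl⟩
  obtain ⟨s₄, hs₄⟩ : ∃ x, x = s₃.setVar 7 c := ⟨_, rfl⟩
  obtain ⟨s₅, hs₅⟩ : ∃ x, x = s₄.setVar 13 ((d + k' : Fin 4) : ℕ) := ⟨_, rfl⟩
  obtain ⟨s₆, hs₆⟩ : ∃ x, x = s₅.setVar 14 ((d + k' + 3 : Fin 4) : ℕ) := ⟨_, rfl⟩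
  have e : result lastStepCmd s = result attachCmd s₆ := by
    rw [hs₆, hs₅, hs₄, hs₃, hs₂, hs₁]
    exact lastStep_result h.ctx hD h.var_five h6 hreadc.1 (hI.input 1 (by decide))
      (hI.input 2 (by decide)) hk'
  have hI₆ : Inv T s₆ lo (lo + 1) xs ys qs G := by
    rw [hs₆, hs₅, hs₄, hs₃, hs₂, hs₁]
    exact (((((hI.setVar (by decide) _).setVar (by decide) _).setVar (by decide) _).setVar
      (by decide) _).setVar (by decide) _).setVar (by decide) _
  obtain ⟨hI₇, hvar'⟩ := hI₆.attach hlo hqv (Q := d + k') (q' := d + k' + 3)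
    (by simp [hs₆, hs₅, hs₄, hs₃, hs₂, hs₁, Store.setVar, h.ctx.var_three])
    (by simp [hs₆, hs₅, hs₄, Store.setVar])
    (by simp [hs₆, hs₅, Store.setVar]) (by simp [hs₆, Store.setVar]) hx hy hcx hP
  rw [← e] at hI₇ hvar'
  have hs6 : ∀ x, x ≠ 5 → x ≠ 6 → x ≠ 7 → x ≠ 10 → x ≠ 13 → x ≠ 14 → s₆.var x = s.var x := by
    intro x h1 h2 h3 h4 h5 h6
    simp [hs₆, hs₅, hs₄, hs₃, hs₂, hs₁, Store.setVar, h1, h2, h3, h4, h5, h6]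
  refine ⟨h.ctx.congr ?_ ?_ ?_ ?_, ?_, ?_, by simp [h.rotate], by simpa using h.split,
    xs', ys', _, _, k', hI₇, ?_, hE', hK', ?_, ?_⟩
  · rw [hvar', hs6] <;> decide
  · rw [hvar', hs6] <;> decide
  · rw [hvar', hs6] <;> decide
  · rw [hvar', hs6] <;> decide
  · rw [hvar' 5 (by decide) (by decide) (by decide)]
    simp [hs₆, hs₅, hs₄, hs₃, hs₂, Store.setVar]
  · rw [hvar' 16 (by decide) (by decide) (by decide), hs6 16 (by decide) (by decide) (by decide)
      (by decide) (by decide) (by decide), h.var_sixteen]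
    congr 1
    simp; omega
  · rw [List.getElem?_append_left hlo, hq]
  · rw [hvar' 6 (by decide) (by decide) (by decide)]
    simp [hs₆, hs₅, hs₄, hs₃, Store.setVar]
  · simp [hN]; omega

end TreeDrawing

/-! ### The loops and the time for one expansion. -/

namespace TreeDrawing

open RAM

variable {n : ℕ} {T : EmbeddedDigraph (Fin n)} {s s' : Store} {v r c : Fin n} {j lo N : ℕ}
  {d k : Fin 4} {m p p' suf : List (Fin n)}

lemma Runs.of_loopFree {c : Cmd} {Q : ℕ → Store → Prop} (hc : LoopFree c)
    (h : ∀ t ≤ timeBound c, Q t (result c s)) : Runs c s Q :=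
  (runs_of_loopFree c hc s).mono fun t _ ⟨h1, h2⟩ => h2 ▸ h t h1

lemma loopFree_steps : LoopFree firstStepCmd ∧ LoopFree lastStepCmd := by
  simp [firstStepCmd, lastStepCmd, attachCmd, insertCmd, backCmd, forwardCmd, prevPortCmd,
    nextPortCmd, block, LoopFree]

/-- A bound for the running time of one round of the loops that attach vertices. -/
def stepTime : ℕ := timeBound firstStepCmd + timeBound lastStepCmd + 20

lemma slot_inj {t t' : ℕ} (ht : t < (T.rot v).length) (ht' : t' < (T.rot v).length) :
    slot T v j t = slot T v j t' ↔ t = t' :=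
  ⟨fun h => add_mod_inj ht ht' (Nat.add_left_cancel h), fun h => by rw [h]⟩

theorem firstLoop_spec (hT : T.IsTree) (h : FirstInv T s v r j lo N d m suf) :
    Runs firstLoopCmd s fun t s' => t ≤ stepTime * m.length + 20 ∧
      ∃ m' suf', FirstInv T s' v r j lo N d m' suf' ∧
        (m' = [] ∨ ∃ m₀ z, m' = m₀ ++ [z] ∧ ¬ (T.Adj v z ↔ T.Adj v r)) := by
  -- While an unattached neighbour remains, its slot differs from the parent's, so the loop test
  -- amounts to comparing directions.
  have hcond : ∀ s m c suf, FirstInv T s v r j lo N d (m ++ [c]) suf →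
      ((Test.and (.not (.eq (.var 5) (.var 4))) (.eq (.read 2 (.var 5)) (.read 2 (.var 4)))).holds s
        ↔ (T.Adj v c ↔ T.Adj v r)) := by
    intro s m c suf h
    obtain ⟨xs, ys, qs, G, hI, -⟩ := h.inv
    have hlen : (T.rot v).length = m.length + 1 + suf.length + 1 := by
      rw [← List.length_rotate (T.rot v) j, h.rotate]; simp; omega
    have hr := (inputStore_slot (T := T) (v := v) (j := j) (c := r) (A := [])
      (B := m ++ [c] ++ suf) (by rw [h.rotate]; rfl)).2
    have hc := (inputStore_slot (T := T) (v := v) (j := j) (c := c) (A := r :: m) (B := suf)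
      (by simp [h.rotate])).2
    have hne : slot T v j (m.length + 1) ≠ slot T v j 0 := by
      rw [Ne, slot_inj (by omega) (by omega)]; omega
    simp only [List.length_cons, List.length_nil] at hr hc
    simp only [Test.holds, Expr.eval, h.var_five, h.ctx.var_four, hI.input 2 (by decide),
      List.length_append, List.length_singleton, hne, not_false_eq_true, true_and]
    by_cases h1 : T.Adj v r <;> by_cases h2 : T.Adj v c
    · rw [hr.1.2 h1, hc.1.2 h2]; simp [h1, h2]
    · rw [hr.1.2 h1, hc.2.2 h2]; simp [h1, h2]
    · rw [hr.2.2 h1, hc.1.2 h2]; simp [h1, h2]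
    · rw [hr.2.2 h1, hc.2.2 h2]; simp [h1, h2]
  refine (Runs.loop (I := fun φ s => ∃ m suf, φ = stepTime * m.length ∧
    FirstInv T s v r j lo N d m suf) ?_ _ s ⟨m, suf, rfl, h⟩).mono ?_
  · rintro φ s ⟨m, suf, rfl, h⟩ hb
    rcases List.eq_nil_or_concat' m with rfl | ⟨m, c, rfl⟩
    · exact absurd (h.var_five.trans h.ctx.var_four.symm) hb.1
    · refine Runs.of_loopFree loopFree_steps.1 fun t ht => ⟨_, ⟨m, c :: suf, rfl,
        firstStep_spec h hT ((hcond _ _ _ _ h).1 hb)⟩, ?_⟩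
      have : stepTime * (m ++ [c]).length = stepTime * m.length + stepTime := by
        rw [List.length_append, List.length_singleton, mul_add, mul_one]
      rw [this]
      -- The summand `20` pays for the loop test, which costs `11` with the branching.
      have h2 : stepTime = timeBound firstStepCmd + timeBound lastStepCmd + 20 := rfl
      simp only [Test.cost, Expr.cost]
      omega
  · rintro t s' ⟨φ, ⟨m', suf', rfl, h'⟩, hb, ht⟩
    refine ⟨?_, m', suf', h', ?_⟩
    · simp only [Test.cost, Expr.cost] at ht
      omega
    · rcases List.eq_nil_or_concat' m' with rfl | ⟨m', c, rfl⟩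
      · exact Or.inl rfl
      · exact Or.inr ⟨m', c, rfl, fun hh => hb ((hcond _ _ _ _ h').2 hh)⟩

theorem lastLoop_spec (hT : T.IsTree) (hmod : T.alternations v ≤ 4)
    (h : LastInv T s v r j lo N d p p' suf) :
    Runs lastLoopCmd s fun t s' => t ≤ stepTime * p'.length + 20 ∧
      LastInv T s' v r j lo N d (p ++ p') [] suf := by
  obtain ⟨m, hm⟩ : ∃ m, m = p ++ p' := ⟨_, rfl⟩
  refine (Runs.loop (I := fun φ s => ∃ p p', m = p ++ p' ∧ φ = stepTime * p'.length ∧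
    LastInv T s v r j lo N d p p' suf) ?_ _ s ⟨p, p', hm, rfl, h⟩).mono ?_
  · rintro φ s ⟨p, p', hm, rfl, h⟩ hb
    rcases p' with _ | ⟨c, p'⟩
    · exact absurd (h.var_five.trans (by simp [h.var_sixteen, Expr.eval])) hb
    · refine Runs.of_loopFree loopFree_steps.2 fun t ht => ⟨_, ⟨p ++ [c], p', by simp [hm], rfl,
        lastStep_spec h hT hmod⟩, ?_⟩
      have h2 : stepTime = timeBound firstStepCmd + timeBound lastStepCmd + 20 := rfl
      simp only [Test.cost, Expr.cost, List.length_cons, mul_add, mul_one]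
      omega
  · rintro t s' ⟨φ, ⟨q, q', hq, rfl, h'⟩, hb, ht⟩
    refine ⟨?_, ?_⟩
    · simp only [Test.cost, Expr.cost] at ht
      omega
    · have hlen : (T.rot v).length = q.length + q'.length + suf.length + 1 := by
        rw [← List.length_rotate (T.rot v) j, h'.rotate]; simp [add_assoc]
      have e : slot T v j q.length = slot T v j (q.length + q'.length) := by
        simpa [Test.holds, Expr.eval, h'.var_five, h'.var_sixteen] using hb
      rw [slot_inj (by omega) (by omega)] at e
      obtain rfl : q' = [] := List.length_eq_zero_iff.1 (by omega)
      rw [List.append_nil] at hq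
      rw [← hm, hq]
      exact h'

theorem findCmd_spec (harr : s.arr 1 = T.inputStore.arr 1) (h4 : s.var 4 = offset T v)
    (h15 : s.var 15 = r) (hj : j < (T.rot v).length) (hr : (T.rot v)[j] = r) :
    Runs findCmd s fun t s' => t ≤ 9 * j + 6 ∧ s' = s.setVar 4 (offset T v + j) := by
  have hcond : ∀ i ≤ j,
      ((Test.not (.eq (.read 1 (.var 4)) (.var 15))).holds (s.setVar 4 (offset T v + i)) ↔ i < j) := by
    intro i hi
    have hi' : i < (T.rot v).length := by omega
    have e : (Test.not (.eq (.read 1 (.var 4)) (.var 15))).holds (s.setVar 4 (offset T v + i)) ↔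
        (T.rot v)[i] ≠ (T.rot v)[j] := by
      rw [← Fin.val_ne_iff, ← inputStore_nbr T v hi', hr, ← h15, ← harr]
      simp [Test.holds, Expr.eval, Store.setVar]
    rw [e, Ne, (T.nodup_rot v).getElem_inj_iff]
    omega
  -- Each slot passed costs `6` steps for the test and `3` for the increment.
  refine (Runs.loop (I := fun φ s' => ∃ i ≤ j, φ = 9 * (j - i) ∧
    s' = s.setVar 4 (offset T v + i)) ?_ _ s ⟨0, Nat.zero_le _, rfl, ?_⟩).mono ?_
  · rintro φ s' ⟨i, hi, rfl, rfl⟩ hb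
    have hlt := (hcond i hi).1 hb
    refine Runs.of_loopFree trivial fun t ht => ⟨9 * (j - (i + 1)), ⟨i + 1, hlt, rfl, ?_⟩, ?_⟩
    · simp [result, Expr.eval, Store.setVar, add_assoc]
    · simp only [timeBound, Test.cost, Expr.cost] at ht ⊢
      omega
  · rw [add_zero, ← h4]
    simp [Store.setVar]
  · rintro t s' ⟨φ, ⟨i, hi, rfl, rfl⟩, hb, ht⟩
    rw [hcond i hi] at hb
    obtain rfl : i = j := by omega
    simp only [Test.cost, Expr.cost] at ht
    exact ⟨by omega, rfl⟩

lemma exists_rotate_eq (hr : r ∈ T.rot v) : ∃ j, ∃ h : j < (T.rot v).length, (T.rot v)[j] = r ∧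
    ∃ l, (T.rot v).rotate j = r :: l := by
  obtain ⟨j, hj, hjr⟩ := List.getElem_of_mem hr
  refine ⟨j, hj, hjr, List.drop (j + 1) (T.rot v) ++ List.take j (T.rot v), ?_⟩
  rw [List.rotate_eq_drop_append_take hj.le, List.drop_eq_getElem_cons hj, hjr, List.cons_append]

/-- Expanding the next vertex of the queue takes time proportional to the number of new vertices. -/
theorem expandCmd_spec (hT : T.IsTree) (hmod : T.IsModal 4) {xs ys qs : List (Fin n)}
    {G : Fin n → Fin 4 → List (Fin n)} (h : Inv T s lo lo xs ys qs G) (hlo : lo < qs.length) :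
    Runs expandCmd s fun t s' => ∃ xs' ys' qs' G', Inv T s' (lo + 1) (lo + 1) xs' ys' qs' G' ∧
      qs.length ≤ qs'.length ∧
      t ≤ 120 + (2 * stepTime + 9) * (qs'.length - qs.length) := by
  obtain ⟨r, d, hf, h10, h11⟩ := h.todo lo hlo le_rfl
  obtain ⟨v, hqv⟩ : ∃ v, qs[lo] = v := ⟨_, rfl⟩
  rw [hqv] at hf h10 h11
  obtain ⟨hv, hrv, hdr⟩ := h.placed.fresh_mem hf
  obtain ⟨j, hj, hjr, l, hl⟩ := exists_rotate_eq hrv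
  have hlen : (T.rot v).length = l.length + 1 := by
    rw [← List.length_rotate (T.rot v) j, hl]; simp
  have h9 : s.arr 9 lo = v := by rw [h.queue lo hlo, hqv]
  have hin0 : s.arr 0 = T.inputStore.arr 0 := h.input 0 (by decide)
  unfold expandCmd
  refine Runs.seq (Runs.of_loopFree (by simp [loadCmd, block, LoopFree]) fun t₁ ht₁ => ?_)
  obtain ⟨s₁, hs₁⟩ : ∃ x, x = result loadCmd s := ⟨_, rfl⟩
  have hload : s₁ = (((((s.setVar 3 v).setVar 15 r).setVar 6 d).setVar 8 (offset T v)).setVar 9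
      (offset T v + (T.rot v).length)).setVar 4 (offset T v) := by
    rw [hs₁, ← inputStore_succ]
    simp [loadCmd, block, result, Expr.eval, Store.setVar, h.var_one, h9, h10, h11, hin0, offset]
  rw [← hs₁]
  -- From now on `v` is exempt from being fresh.
  have hI₁ : Inv T s₁ lo (lo + 1) xs ys qs G := by
    have hI : Inv T s lo (lo + 1) xs ys qs G := { h with
      todo := fun i hi hle => h.todo i hi (by omega) }
    rw [hload]
    exact (((((hI.setVar (by decide) _).setVar (by decide) _).setVar (by decide) _).setVar
      (by decide) _).setVar (by decide) _).setVar (by decide) _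
  refine Runs.seq ((findCmd_spec (T := T) (v := v) (hI₁.input 1 (by decide))
    (by simp [hload, Store.setVar]) (by simp [hload, Store.setVar]) hj hjr).mono ?_)
  rintro t₂ s₂ ⟨ht₂, hs₂⟩
  have hI₂ : Inv T s₂ lo (lo + 1) xs ys qs G := by rw [hs₂]; exact hI₁.setVar (by decide) _
  have hslot : slot T v j 0 = offset T v + j := by
    rw [slot, add_zero, Nat.mod_eq_of_lt hj]
  have hctx₂ : Ctx T s₂ v j := by
    refine ⟨?_, ?_, ?_, ?_⟩ <;> simp [hs₂, hload, Store.setVar, hslot]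
  have h26 : s₂.var 6 = d := by simp [hs₂, hload, Store.setVar]
  refine Runs.seq (Runs.of_loopFree (by simp [turnBackCmd, backCmd, block, LoopFree])
    fun t₃ ht₃ => ?_)
  -- Cyclically the parent's slot also has number `l.length + 1`, the degree of `v`. One step back
  -- from it is the last neighbour.
  have e₃ : result turnBackCmd s₂ = (s₂.setVar 5 (slot T v j 0)).setVar 5 (slot T v j l.length) := by
    have : result turnBackCmd s₂ = result backCmd (s₂.setVar 5 (s₂.var 4)) := rfl
    rw [this, hctx₂.var_four]
    refine backCmd_result (hctx₂.congr rfl rfl rfl rfl) (by omega) ?_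
    simp [Store.setVar, slot, ← hlen]
  rw [e₃]
  have hF : FirstInv T ((s₂.setVar 5 (slot T v j 0)).setVar 5 (slot T v j l.length)) v r j lo
      qs.length d l [] :=
    ⟨hctx₂.congr rfl rfl rfl rfl, by simp [Store.setVar], by simp [Store.setVar, h26],
      by simp [hl], by simp, hdr, xs, ys, qs, G,
      (hI₂.setVar (by decide) _).setVar (by decide) _,
      List.getElem?_eq_some_iff.2 ⟨hlo, hqv⟩, hf.expanding, by simp⟩
  refine Runs.seq ((firstLoop_spec hT hF).mono ?_)
  rintro t₄ s₄ ⟨ht₄, m, suf, hF₄, hm⟩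
  refine Runs.seq (Runs.of_loopFree (by simp [turnForwardCmd, block, LoopFree]) fun t₅ ht₅ => ?_)
  have e₅ : result turnForwardCmd s₄ = (s₄.setVar 16 (slot T v j m.length)).setVar 5
      (slot T v j 0) := by
    simp [turnForwardCmd, block, result, Expr.eval, Store.setVar, hF₄.var_five, hF₄.ctx.var_four]
  have hL : LastInv T (result turnForwardCmd s₄) v r j lo qs.length d [] m suf := by
    rw [e₅]
    obtain ⟨xs, ys, qs, G, hI, hq, hE, hN⟩ := hF₄.inv
    exact ⟨hF₄.ctx.congr rfl rfl rfl rfl, by simp [Store.setVar], by simp [Store.setVar],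
      by simp [hF₄.rotate], by simpa using hm, xs, ys, qs, G, 0,
      (hI.setVar (by decide) _).setVar (by decide) _, hq, hE, portAfter_nil hdr,
      by simp [Store.setVar, hF₄.var_six], by simpa using hN⟩
  refine Runs.seq ((lastLoop_spec hT (hmod v) hL).mono ?_)
  rintro t₆ s₆ ⟨ht₆, hL₆⟩
  obtain ⟨xs', ys', qs', G', k, hI, hq, hE, -, -, hN⟩ := hL₆.inv
  obtain ⟨hlo', hqv'⟩ := List.getElem?_eq_some_iff.1 hq
  have hlen' : l.length = m.length + suf.length := by
    have := congrArg List.length (hl.symm.trans hF₄.rotate)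
    simpa using this
  simp only [List.nil_append] at hN hE
  refine Runs.of_loopFree trivial fun t₇ ht₇ => ⟨xs', ys', qs', G', ?_, by omega, ?_⟩
  · have e : result (.assign 1 (.succ (.var 1))) s₆ = s₆.setVar 1 (lo + 1) := by
      simp [result, Expr.eval, hI.var_one]
    rw [e]
    refine ⟨hI.var_zero, by simp [Store.setVar], hI.var_two, hI.input, hI.placed, hI.linkx, hI.linky,
      hI.nodup, hI.mem_iff, hI.queue, ?_, hI.todo⟩
    intro i hi hle
    rcases Nat.lt_succ_iff_lt_or_eq.1 hle with hle | rfl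
    · exact hI.done i hi hle
    · rw [hqv']
      exact hE.complete (rotated_of_rotate (by simpa using hL₆.rotate))
  · have b₁ : timeBound loadCmd = 19 := rfl
    have b₃ : timeBound turnBackCmd = 10 := rfl
    have b₅ : timeBound turnForwardCmd = 5 := rfl
    have b₇ : timeBound (.assign 1 (.succ (.var 1))) = 3 := rfl
    -- The vertices gained are the neighbours other than the parent. Their number bounds `j` and the
    -- rounds of each attaching loop, so the scan and both loops are charged to them; `120` covers
    -- the rest.
    have hgrow : qs'.length - qs.length = l.length := by omega
    have c₄ : stepTime * m.length ≤ stepTime * l.length := Nat.mul_le_mul_left _ (by omega)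
    rw [hgrow, add_mul, mul_assoc]
    omega

end TreeDrawing

/-! ### Initialisation, output and the total running time. -/

namespace TreeDrawing

open RAM

variable {n : ℕ} {T : EmbeddedDigraph (Fin n)} {s : Store} {xs ys : List (Fin n)}

lemma length_guarded (xs : List (Fin n)) : (guarded xs).length = xs.length + 2 := by
  simp [guarded]

lemma getElem_guarded (xs : List (Fin n)) {i : ℕ} (hi : i < xs.length) :
    (guarded xs)[i + 1]'(by rw [length_guarded]; omega) = (xs[i] : ℕ) := by
  simp [guarded, hi]

theorem outputCmd_spec {A B O : ℕ} (hAO : A ≠ O) (h0 : s.var 0 = n)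
    (hl : Linked (s.arr A) (s.arr B) (guarded xs)) (hnd : xs.Nodup) (hall : ∀ v, v ∈ xs) :
    Runs (outputCmd A O) s fun t s' => t ≤ 14 * n + 20 ∧ s'.var 0 = n ∧
      (∀ D, D ≠ O → s'.arr D = s.arr D) ∧ ∀ v : Fin n, s'.arr O v = xs.idxOf v := by
  have hlen : xs.length = n := by
    have h1 := hnd.length_le_card
    have h2 : (Finset.univ : Finset (Fin n)).card ≤ xs.toFinset.card :=
      Finset.card_le_card fun v _ => List.mem_toFinset.2 (hall v)
    have h3 := xs.toFinset_card_le
    simp at h1 h2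
    omega
  have hlg := length_guarded xs
  have hnext : ∀ i (hi : i + 1 < (guarded xs).length),
      s.arr A ((guarded xs)[i]) = (guarded xs)[i + 1] := fun i hi =>
    (List.isChain_iff_getElem.1 hl i hi).1
  refine Runs.seq (Runs.of_loopFree (by simp [startOutputCmd, block, LoopFree]) fun t₁ ht₁ => ?_)
  -- The shift to `k + 1` skips the sentinel at the front; after the last vertex the cursor rests on
  -- the other sentinel. A round costs `10` steps and its test `4`.
  refine (Runs.loop (I := fun φ s' => ∃ k, ∃ hk : k ≤ n, φ = 14 * (n - k) ∧ s'.var 0 = n ∧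
    s'.var 5 = k ∧ s'.var 11 = (guarded xs)[k + 1]'(by omega) ∧
    (∀ D, D ≠ O → s'.arr D = s.arr D) ∧
    ∀ i (hi : i < xs.length), i < k → s'.arr O (xs[i] : ℕ) = i) ?_ _ _
    ⟨0, Nat.zero_le _, rfl, ?_, ?_, ?_, ?_, ?_⟩).mono ?_
  · rintro φ s' ⟨k, hk, rfl, h0', h5, h11, harr, hout⟩ hb
    have hlt : k < n := by simpa [Test.holds, Expr.eval, h5, h0'] using hb
    have hkx : k < xs.length := by omega
    have hg := getElem_guarded xs hkx
    have e : result (outputStepCmd A O) s' =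
        ⟨Function.update (Function.update s'.var 11 ((guarded xs)[k + 1 + 1]'(by omega))) 5 (k + 1),
          Function.update s'.arr O (Function.update (s'.arr O) (xs[k] : ℕ) k)⟩ := by
      rw [← hnext (k + 1) (by omega), ← h11]
      simp [outputStepCmd, block, result, Expr.eval, Store.setVar, Store.setArr, h5, hAO,
        harr A hAO, h11, hg]
    refine Runs.of_loopFree (by simp [outputStepCmd, block, LoopFree]) fun t ht =>
      ⟨14 * (n - (k + 1)), ⟨k + 1, hlt, rfl, ?_, ?_, ?_, ?_, ?_⟩, ?_⟩
    · simp [e, h0']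
    · simp [e]
    · simp [e]
    · intro D hD
      simp [e, hD, harr D hD]
    · intro i hi hik
      rw [e]
      rcases Nat.lt_succ_iff_lt_or_eq.1 hik with hik | rfl
      · have hne : (xs[i] : ℕ) ≠ xs[k] := by
          rw [Ne, Fin.val_inj, hnd.getElem_inj_iff]; omega
        simp [hne, hout i hi hik]
      · simp
    · have : timeBound (outputStepCmd A O) = 10 := rfl
      simp only [Test.cost, Expr.cost]
      omega
  · simp [startOutputCmd, block, result, Expr.eval, Store.setVar, h0]
  · simp [startOutputCmd, block, result, Expr.eval, Store.setVar]
  · have h1 := hnext 0 (by omega)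
    have h2 : (guarded xs)[0]'(by omega) = n := by simp [guarded]
    rw [h2] at h1
    simp [startOutputCmd, block, result, Expr.eval, Store.setVar, h0, h1]
  · intro D _
    simp [startOutputCmd, block, result, Store.setVar]
  · intro i hi hi0
    omega
  · rintro t s' ⟨φ, ⟨k, hk, rfl, h0', h5, h11, harr, hout⟩, hb, ht⟩
    have hkn : ¬ k < n := by simpa [Test.holds, Expr.eval, h5, h0'] using hb
    refine ⟨?_, h0', harr, fun v => ?_⟩
    · have : timeBound (startOutputCmd A) = 6 := rfl
      simp only [Test.cost, Expr.cost] at ht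
      omega
    · have hi : xs.idxOf v < xs.length := List.idxOf_lt_length_of_mem (hall v)
      have := hout _ hi (by omega)
      rwa [List.getElem_idxOf hi] at this

/-- With more than one vertex, vertex `0` has a neighbour, and slot `0` holds the first one. -/
theorem initCmd_spec (hT : T.IsTree) (hn : 1 < n) :
    ∃ xs ys qs G, Inv T (result initCmd T.inputStore) 0 0 xs ys qs G ∧ 0 < qs.length := by
  obtain ⟨u, hu⟩ : ∃ u : Fin n, (u : ℕ) = 0 := ⟨⟨0, by omega⟩, rfl⟩
  have hrot : 0 < (T.rot u).length := by
    rw [List.length_pos_iff]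
    intro hnil
    have : Nontrivial (Fin n) := Fin.nontrivial_iff_two_le.2 hn
    obtain ⟨w, hw⟩ := hT.1.preconnected.exists_adj_of_nontrivial u
    have := (T.mem_rot u w).2 hw.2
    simp [hnil] at this
  obtain ⟨c, hc⟩ : ∃ c, (T.rot u)[0] = c := ⟨_, rfl⟩
  have hcu : c ∈ T.rot u := hc ▸ List.getElem_mem hrot
  have hne : u ≠ c := by
    rintro rfl
    rcases (T.mem_rot u u).1 hcu with h1 | h1 <;> exact T.asymm _ _ h1 h1
  have hc0 : (c : ℕ) ≠ 0 := fun e => hne (Fin.ext (hu.trans e.symm))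
  have hcn := c.2
  have hoff : offset T u = 0 := by simp [offset, EmbeddedDigraph.inputStore, hu]
  have hnbr : T.inputStore.arr 1 0 = c := by
    have := inputStore_nbr T u hrot
    rwa [hoff, hc] at this
  have hdir : T.inputStore.arr 2 0 = 1 ↔ T.Adj u c := by
    have := inputStore_dir T u hrot
    rw [hoff, hc] at this
    rw [this]
    by_cases h : T.Adj u c <;> simp [h]
  have hv0 : T.inputStore.var 0 = n := by simp [EmbeddedDigraph.inputStore]
  have hins : InsertBeside (((1 : Fin 4) = 1) ∨ ((1 : Fin 4) = 2)) u c [u] [u, c] :=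
    ⟨[], [], rfl, rfl⟩
  have hins' : InsertBeside (((1 : Fin 4) = 0) ∨ ((1 : Fin 4) = 1)) u c [u] [u, c] :=
    ⟨[], [], rfl, rfl⟩
  obtain ⟨G, d, d', hP, hfu, hfc, hd⟩ := exists_placed_edge hcu hins hins'
  obtain ⟨s', hs'⟩ : ∃ x, x = result initCmd T.inputStore := ⟨_, rfl⟩
  -- The neighbour `c` goes to quadrant `1`, the upper right: an outgoing edge leaves `u` at North
  -- and enters `c` at West, an incoming one enters `u` at East and leaves `c` at South.
  have hport : s'.arr 10 0 = (d : ℕ) ∧ s'.arr 10 c = (d' : ℕ) := by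
    rcases hd with ⟨h1, rfl, rfl⟩ | ⟨h1, rfl, rfl⟩
    · have hadj : T.Adj u c := h1.1 (by decide)
      have := hdir.2 hadj
      simp [hs', initCmd, block, result, Expr.eval, Store.setVar, Store.setArr, Test.holds, hnbr,
        this, hc0.symm]
    · have hadj : ¬ T.Adj u c := fun h => h1 ⟨fun _ => h, fun _ => by decide⟩
      have : ¬ T.inputStore.arr 2 0 = 1 := fun h => hadj (hdir.1 h)
      simp [hs', initCmd, block, result, Expr.eval, Store.setVar, Store.setArr, Test.holds, hnbr,
        this, hc0.symm]
  have hrest : s'.var 0 = n ∧ s'.var 1 = 0 ∧ s'.var 2 = 2 ∧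
      (∀ D < 3, s'.arr D = T.inputStore.arr D) ∧
      Linked (s'.arr 5) (s'.arr 6) [n, 0, c, n + 1] ∧
      Linked (s'.arr 7) (s'.arr 8) [n, 0, c, n + 1] ∧
      s'.arr 9 0 = 0 ∧ s'.arr 9 1 = c ∧ s'.arr 11 0 = c ∧ s'.arr 11 c = 0 := by
    have hn0 : n ≠ 0 := by omega
    have hnc : n ≠ c := by omega
    have hn1 : (c : ℕ) ≠ n + 1 := by omega
    have hD : ∀ D < 3, D ≠ 5 ∧ D ≠ 6 ∧ D ≠ 7 ∧ D ≠ 8 ∧ D ≠ 9 ∧ D ≠ 10 ∧ D ≠ 11 := by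
      intro D hD; omega
    by_cases hb : T.inputStore.arr 2 0 = 1
    · refine ⟨?_, ?_, ?_, ?_, ?_, ?_, ?_, ?_, ?_, ?_⟩
      case refine_4 =>
        intro D h
        simp [hs', initCmd, block, result, Expr.eval, Store.setVar, Store.setArr, Test.holds, hnbr,
          hb, hD D h]
      all_goals simp [Linked, hs', initCmd, block, result, Expr.eval, Store.setVar, Store.setArr,
        Test.holds, hnbr, hb, hc0.symm, hn0, hnc, hn1, hv0]
    · refine ⟨?_, ?_, ?_, ?_, ?_, ?_, ?_, ?_, ?_, ?_⟩
      case refine_4 =>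
        intro D h
        simp [hs', initCmd, block, result, Expr.eval, Store.setVar, Store.setArr, Test.holds, hnbr,
          hb, hD D h]
      all_goals simp [Linked, hs', initCmd, block, result, Expr.eval, Store.setVar, Store.setArr,
        Test.holds, hnbr, hb, hc0.symm, hn0, hnc, hn1, hv0]
  obtain ⟨r0, r1, r2, r3, r5, r7, r9, r9', r11, r12⟩ := hrest
  have hg : guarded [u, c] = [n, 0, (c : ℕ), n + 1] := by simp [guarded, hu]
  refine ⟨[u, c], [u, c], [u, c], G, ?_, by simp⟩
  rw [← hs']
  refine ⟨r0, r1, by simp [r2], r3, hP, by rw [hg]; exact r5, by rw [hg]; exact r7, by simp [hne],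
    by simp, ?_, by simp, ?_⟩
  · intro i hi
    obtain rfl | rfl : i = 0 ∨ i = 1 := by simp at hi; omega
    · simp [r9, hu]
    · simp [r9']
  · intro i hi _
    obtain rfl | rfl : i = 0 ∨ i = 1 := by simp at hi; omega
    · exact ⟨c, d, hfu, by simp [hu, hport.1], by simp [hu, r11]⟩
    · exact ⟨u, d', hfc, by simp [hport.2], by simp [hu, r12]⟩

/-- The constant in the time bound. -/
def timeFactor : ℕ := timeBound initCmd + 2 * stepTime + 300

/-- Amortised analysis: a round moves `lo` by one, which pays `120` and the `4` steps of the test,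
and every vertex it adds to the queue pays for its own attachment. No vertex joins the queue twice,
so both payments are linear in `n`. At the end all placed vertices are finished, so every vertex is
placed. -/
theorem expandLoop_spec (hT : T.IsTree) (hmod : T.IsModal 4) {qs : List (Fin n)}
    {G : Fin n → Fin 4 → List (Fin n)} (h : Inv T s 0 0 xs ys qs G) (hqs : 0 < qs.length) :
    Runs (.while (.lt (.var 1) (.var 2)) expandCmd) s fun t s' =>
      t ≤ (124 + (2 * stepTime + 9)) * n + 4 ∧ s'.var 0 = n ∧ ∃ xs ys,
        Linked (s'.arr 5) (s'.arr 6) (guarded xs) ∧ Linked (s'.arr 7) (s'.arr 8) (guarded ys) ∧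
        xs.Nodup ∧ ys.Nodup ∧ (∀ v, v ∈ xs) ∧ (∀ v, v ∈ ys) ∧ (listDrawing xs ys).IsPCOD T := by
  obtain ⟨K, hK⟩ : ∃ K, K = 2 * stepTime + 9 := ⟨_, rfl⟩
  rw [← hK]
  refine (Runs.loop (I := fun φ s' => ∃ lo xs ys qs G, Inv T s' lo lo xs ys qs G ∧ 0 < qs.length ∧
    lo ≤ qs.length ∧ φ = 124 * (n - lo) + K * (n - qs.length)) ?_ _ s
    ⟨0, xs, ys, qs, G, h, hqs, Nat.zero_le _, rfl⟩).mono ?_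
  · rintro φ s ⟨lo, xs, ys, qs, G, h, hqs, -, rfl⟩ hb
    have hlo : lo < qs.length := by simpa [Test.holds, Expr.eval, h.var_one, h.var_two] using hb
    refine (expandCmd_spec hT hmod h hlo).mono ?_
    rintro t s' ⟨xs', ys', qs', G', h', hle, ht⟩
    rw [← hK] at ht
    refine ⟨_, ⟨lo + 1, xs', ys', qs', G', h', by omega, by omega, rfl⟩, ?_⟩
    have h1 := h.lt_length
    have h2 := h'.lt_length
    have h3 : K * (n - qs.length) = K * (qs'.length - qs.length) + K * (n - qs'.length) := by
      rw [← mul_add]; congr 1; omega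
    simp only [Test.cost, Expr.cost]
    omega
  · rintro t s' ⟨φ, ⟨lo, xs, ys, qs', G, h', hqs', hle, rfl⟩, hb, ht⟩
    have hlo : ¬ lo < qs'.length := by
      simpa [Test.holds, Expr.eval, h'.var_one, h'.var_two] using hb
    have hcomp : ∀ a ∈ xs, Complete T G a := by
      intro a ha
      obtain ⟨i, hi, rfl⟩ := List.getElem_of_mem ((h'.mem_iff a).2 ha)
      exact h'.done i hi (by omega)
    have hall := h'.placed.mem_of_complete hT
      ((h'.mem_iff _).1 (List.getElem_mem hqs')) hcomp
    refine ⟨?_, h'.var_zero, xs, ys, h'.linkx, h'.linky, h'.placed.nodup_x, h'.placed.nodup_y, hall,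
      fun v => (h'.placed.mem_iff v).2 (hall v), h'.placed.isPCOD hall fun v => hcomp v (hall v)⟩
    have h3 : K * (n - qs.length) ≤ K * n := Nat.mul_le_mul_left _ (by omega)
    simp only [Test.cost, Expr.cost] at ht
    rw [add_mul]
    omega

lemma ofCoords_eq {x y : ℕ → ℕ} (hx : ∀ v : Fin n, x v = xs.idxOf v)
    (hy : ∀ v : Fin n, y v = ys.idxOf v) : OrthoDrawing.ofCoords x y = listDrawing xs ys := by
  simp [OrthoDrawing.ofCoords, listDrawing, hx, hy]

/-- The program computes a drawing in linear time. -/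
theorem mainCmd_spec (hT : T.IsTree) (hmod : T.IsModal 4) :
    Runs mainCmd T.inputStore fun t s => t ≤ timeFactor * n ∧
      (OrthoDrawing.ofCoords (s.arr 3) (s.arr 4)).IsPCOD T := by
  have hv0 : T.inputStore.var 0 = n := by simp [EmbeddedDigraph.inputStore]
  obtain ⟨u⟩ := hT.1.nonempty
  have hn0 : 0 < n := u.pos
  have hF : timeFactor = timeBound initCmd + 2 * stepTime + 300 := rfl
  by_cases hn : 1 < n
  · obtain ⟨xs, ys, qs, G, hI, hqs⟩ := initCmd_spec hT hn
    have hrun : Runs (.seq initCmd (.seq (.while (.lt (.var 1) (.var 2)) expandCmd)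
        (.seq (outputCmd 5 3) (outputCmd 7 4)))) T.inputStore fun t s =>
        4 + t ≤ timeFactor * n ∧ (OrthoDrawing.ofCoords (s.arr 3) (s.arr 4)).IsPCOD T := by
      refine Runs.seq (Runs.of_loopFree (by simp [initCmd, block, LoopFree]) fun t₁ ht₁ => ?_)
      refine Runs.seq ((expandLoop_spec hT hmod hI hqs).mono ?_)
      rintro t₂ s₂ ⟨ht₂, h0, xs, ys, hx, hy, hxn, hyn, hxall, hyall, hP⟩
      refine Runs.seq ((outputCmd_spec (O := 3) (by decide) h0 hx hxn hxall).mono ?_)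
      rintro t₃ s₃ ⟨ht₃, h0₃, harr₃, hout₃⟩
      refine (outputCmd_spec (A := 7) (B := 8) (O := 4) (xs := ys) (by decide) h0₃
        (by rw [harr₃ 7 (by decide), harr₃ 8 (by decide)]; exact hy) hyn hyall).mono ?_
      rintro t₄ s₄ ⟨ht₄, -, harr₄, hout₄⟩
      refine ⟨?_, ?_⟩
      -- The constant `48` collects `4` for the outermost branching, `4` from the expansion loop and
      -- `20` from each output; it is absorbed since `n` is positive.
      · have h1 : timeBound initCmd + 48 ≤ (timeBound initCmd + 48) * n :=
          Nat.le_mul_of_pos_right _ hn0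
        have h2 : timeFactor * n = (timeBound initCmd + 48) * n + (124 + (2 * stepTime + 9)) * n +
            14 * n + 14 * n + 91 * n := by
          rw [hF]; ring
        omega
      · rw [ofCoords_eq (xs := xs) (ys := ys) (fun v => by rw [harr₄ 3 (by decide), hout₃ v]) hout₄]
        exact hP
    obtain ⟨t, s, h1, h2, h3⟩ := hrun
    exact ⟨_, s, .ite_true (by simpa [Test.holds, Expr.eval, hv0] using hn) h1, h2, h3⟩
  · refine ⟨_, _, .ite_false (by simpa [Test.holds, Expr.eval, hv0] using hn) (.skip _), ?_, ?_⟩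
    · have : timeFactor ≤ timeFactor * n := Nat.le_mul_of_pos_right _ hn0
      simp only [Test.cost, Expr.cost]
      omega
    · have hsub : ∀ a b : Fin n, a = b := fun a b => Fin.ext (by omega)
      have hc : ∀ v, Complete T (fun _ _ => []) v := by
        intro v
        have : T.rot v = [] := List.eq_nil_iff_forall_not_mem.2 fun w hw => by
          obtain rfl := hsub v w
          rcases (T.mem_rot v v).1 hw with h1 | h1 <;> exact T.asymm _ _ h1 h1
        rw [Complete, this]
        exact List.IsRotated.refl _
      rw [ofCoords_eq (xs := [u]) (ys := [u])]
      · exact (placed_singleton T u).isPCOD (fun v => by simp [hsub v u]) hc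
      · intro v; simp [EmbeddedDigraph.inputStore, hsub v u]
      · intro v; simp [EmbeddedDigraph.inputStore, hsub v u]

end TreeDrawing

/-- Every 4-modal tree with a fixed embedding has a planar confluent orthogonal drawing of split
complexity zero; any leaf can be placed in any corner of the bounding box; and a drawing of split
complexity zero can be computed in linear time: the program leaves the coordinates of the vertices
in the arrays `3` and `4`. -/
theorem mainTheorem6 :
    (∀ (V : Type*) [Finite V] (T : EmbeddedDigraph V), T.IsTree → T.IsModal 4 →
      (∃ Γ : OrthoDrawing V, Γ.IsPCOD T ∧ Γ.splitComplexity T = 0) ∧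
      (∀ v : V, T.IsLeaf v → ∀ right upper : Bool,
        ∃ Γ : OrthoDrawing V, Γ.IsPCOD T ∧ Γ.splitComplexity T = 0 ∧
          Γ.AtCorner T v right upper)) ∧
    (∃ (prog : RAM.Cmd) (C : ℕ), ∀ (n : ℕ) (T : EmbeddedDigraph (Fin n)),
      T.IsTree → T.IsModal 4 →
      ∃ (t : ℕ) (s : RAM.Store), RAM.Exec prog T.inputStore t s ∧ t ≤ C * n ∧
        (OrthoDrawing.ofCoords (s.arr 3) (s.arr 4)).IsPCOD T ∧
        (OrthoDrawing.ofCoords (s.arr 3) (s.arr 4)).splitComplexity T = 0) := by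
  classical
  refine ⟨fun V _ T hT hmod => ⟨TreeDrawing.exists_pcod hT hmod, fun v hv right upper =>
    TreeDrawing.exists_pcod_atCorner hT hmod hv right upper⟩,
    TreeDrawing.mainCmd, TreeDrawing.timeFactor, fun n T hT hmod => ?_⟩
  obtain ⟨t, s, h1, h2, h3⟩ := TreeDrawing.mainCmd_spec hT hmod
  exact ⟨t, s, h1, h2, h3, TreeDrawing.splitComplexity_eq_zero fun _ _ => rfl⟩
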